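/- **Proposition.** Let $\Omega=\mathbb R\times(0,1)$ and $\Omega_r=(-r,r)\times(0,1)$ for $r>0$. Let $k>0$ with $k\ne n\pi$ for all $n\in\mathbb N=\{0,1,2,\dots\}$. Put $\varphi_0=1$ and $\varphi_n(y)=\sqrt2\cos(n\pi y)$ for $n\ge1$, and let $k_n$ be the complex number with $k_n^2=k^2-n^2\pi^2$, $\operatorname{Re}k_n\ge0$, $\operatorname{Im}k_n\ge0$. For a function $f$ on $\Omega$ write $f_n(x)=\int_0^1 f(x,y)\varphi_n(y)\,\mathrm dy$. Let $L^2_{\mathrm{loc}}(\Omega)$, respectively $H^2_{\mathrm{loc}}(\Omega)$, be the space of complex functions on $\Omega$ that belong to $L^2(\Omega_r)$, respectively $H^2(\Omega_r)$, for every $r>0$; functions equal almost everywhere are identified. A function $u\in H^2_{\mathrm{loc}}(\Omega)$ is called outgoing if for every $n\in\mathbb N$ its coefficient $u_n$ (taken as its $C^1$ representative) satisfies $$\Big|u_n'(x)\,\frac{x}{|x|}-ik_n\,u_n(x)\Big|\longrightarrow 0\qquad\text{as }|x|\to+\infty .$$ Then for every $s\in L^1(\Omega)\cap L^2_{\mathrm{loc}}(\Omega)$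 the problem $$\Delta u+k^2u=-s\ \text{ in }\Omega,\qquad \partial_\nu u=0\ \text{ on }\partial\Omega\ \text{(in the sense of traces)},\qquad u\ \text{outgoing},$$ has exactly one solution $u\in H^2_{\mathrm{loc}}(\Omega)$. Moreover, for all $n$ and $x$ the integral in $$u_{k,n}(x)=\frac{i}{2k_n}\int_{\mathbb R}s_n(z)\,e^{ik_n|x-z|}\,\mathrm dz$$ converges absolutely, for every $n$ one has $\int_0^1u(x,y)\varphi_n(y)\,\mathrm dy=u_{k,n}(x)$ for almost every $x\in\mathbb R$, and $$u(x,y)=\sum_{n\in\mathbb N}u_{k,n}(x)\,\varphi_n(y),$$ where the series converges unconditionally for almost every $(x,y)\in\Omega$, and also in $L^2(\Omega_r)$ for every $r>0$. -/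

import Mathlib

open MeasureTheory Filter Topology
open scoped ContDiff

noncomputable section

namespace Waveguide

/-- The infinite strip `Ω = ℝ × (0,1)`. -/
def strip : Set (ℝ × ℝ) := Set.univ ×ˢ Set.Ioo (0 : ℝ) 1

/-- The truncated strip `Ω_r = (-r,r) × (0,1)`. -/
def truncStrip (r : ℝ) : Set (ℝ × ℝ) := Set.Ioo (-r) r ×ˢ Set.Ioo (0 : ℝ) 1

/-- Neumann eigenfunctions of the interval `(0,1)`: `φ_0 = 1`, `φ_n(y) = √2 cos(nπy)`. -/
def mode (n : ℕ) (y : ℝ) : ℝ :=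
  if n = 0 then 1 else Real.sqrt 2 * Real.cos (n * Real.pi * y)

/-- The `n`-th wavenumber `k_n`, i.e. the square root of `k² - n²π²` with nonnegative real and
imaginary parts (see `waveNumber_eq_iff`). One of the two real square roots below is zero, because
`Real.sqrt` vanishes on negative numbers. -/
def waveNumber (k : ℝ) (n : ℕ) : ℂ :=
  (Real.sqrt (k ^ 2 - n ^ 2 * Real.pi ^ 2) : ℂ) +
    Complex.I * (Real.sqrt (n ^ 2 * Real.pi ^ 2 - k ^ 2) : ℂ)

theorem waveNumber_eq_iff (k : ℝ) (n : ℕ) (κ : ℂ) :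
    κ = waveNumber k n ↔
      κ ^ 2 = (k : ℂ) ^ 2 - (n : ℂ) ^ 2 * (Real.pi : ℂ) ^ 2 ∧ 0 ≤ κ.re ∧ 0 ≤ κ.im := by
  have key : waveNumber k n ^ 2 = (k : ℂ) ^ 2 - (n : ℂ) ^ 2 * (Real.pi : ℂ) ^ 2 ∧
      0 ≤ (waveNumber k n).re ∧ 0 ≤ (waveNumber k n).im := by
    refine ⟨?_, ?_, ?_⟩
    · rcases le_total 0 (k ^ 2 - n ^ 2 * Real.pi ^ 2) with h | h
      · have h' : (n : ℝ) ^ 2 * Real.pi ^ 2 - k ^ 2 ≤ 0 := by linarith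
        rw [waveNumber, Real.sqrt_eq_zero_of_nonpos h', Complex.ofReal_zero, mul_zero, add_zero,
          ← Complex.ofReal_pow, Real.sq_sqrt h]
        push_cast
        ring
      · have h' : 0 ≤ (n : ℝ) ^ 2 * Real.pi ^ 2 - k ^ 2 := by linarith
        rw [waveNumber, Real.sqrt_eq_zero_of_nonpos h, Complex.ofReal_zero, zero_add, mul_pow,
          ← Complex.ofReal_pow, Real.sq_sqrt h', Complex.I_sq]
        push_cast
        ring
    · simp [waveNumber, Real.sqrt_nonneg]
    · simp [waveNumber, Real.sqrt_nonneg]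
  constructor
  · rintro rfl
    exact key
  · rintro ⟨h1, h2, h3⟩
    obtain ⟨g1, g2, g3⟩ := key
    rcases sq_eq_sq_iff_eq_or_eq_neg.mp (h1.trans g1.symm) with h | h
    · exact h
    · have hr : κ.re = -(waveNumber k n).re := by rw [h, Complex.neg_re]
      have hi : κ.im = -(waveNumber k n).im := by rw [h, Complex.neg_im]
      apply Complex.ext <;> linarith

/-- The modal coefficient `x ↦ ⟨f(x,·), φ_n⟩` in `L²(0,1)` (the function `φ_n` is real). -/
def modalCoeff (f : ℝ × ℝ → ℂ) (n : ℕ) (x : ℝ) : ℂ :=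
  ∫ y in Set.Ioo (0 : ℝ) 1, (mode n y : ℂ) * f (x, y)

/-- `L²_loc(Ω)`: square integrable on every truncated strip `Ω_r`. -/
def MemL2Loc (f : ℝ × ℝ → ℂ) : Prop :=
  ∀ r : ℝ, 0 < r → MemLp f 2 (volume.restrict (truncStrip r))

/-- `v ∈ L²_loc(Ω)` is the weak derivative of `u ∈ L²_loc(Ω)` in `Ω`, in the direction `e`. -/
def HasWeakDeriv (e : ℝ × ℝ) (u v : ℝ × ℝ → ℂ) : Prop :=
  MemL2Loc u ∧ MemL2Loc v ∧
    ∀ ψ : ℝ × ℝ → ℝ, ContDiff ℝ ∞ ψ → HasCompactSupport ψ → tsupport ψ ⊆ strip →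
      ∫ p in strip, ((fderiv ℝ ψ p e : ℝ) : ℂ) * u p = -∫ p in strip, (ψ p : ℂ) * v p

/-- `u ∈ H¹_loc(Ω)`. -/
def MemH1Loc (u : ℝ × ℝ → ℂ) : Prop :=
  ∃ ux uy : ℝ × ℝ → ℂ, HasWeakDeriv (1, 0) u ux ∧ HasWeakDeriv (0, 1) u uy

/-- `u ∈ H²_loc(Ω)`: `u` and its weak derivatives of order at most two are in `L²_loc(Ω)`. -/
def MemH2Loc (u : ℝ × ℝ → ℂ) : Prop :=
  ∃ ux uy : ℝ × ℝ → ℂ, HasWeakDeriv (1, 0) u ux ∧ HasWeakDeriv (0, 1) u uy ∧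
    MemH1Loc ux ∧ MemH1Loc uy

/-- `Δu + k²u = -s` almost everywhere in `Ω`, the derivatives being weak derivatives. -/
def SolvesHelmholtz (k : ℝ) (s u : ℝ × ℝ → ℂ) : Prop :=
  ∃ ux uy uxx uyy : ℝ × ℝ → ℂ,
    HasWeakDeriv (1, 0) u ux ∧ HasWeakDeriv (0, 1) u uy ∧
    HasWeakDeriv (1, 0) ux uxx ∧ HasWeakDeriv (0, 1) uy uyy ∧
    ∀ᵐ p ∂(volume.restrict strip), uxx p + uyy p + (k : ℂ) ^ 2 * u p = -s p

/-- `g₀` and `g₁` are the traces of `w` on the boundary lines `y = 0` and `y = 1` of `Ω`.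
Traces are defined by integration by parts in `y` against smooth compactly supported
functions on the plane, which need not vanish on the boundary of `Ω`. -/
def HasTraces (w : ℝ × ℝ → ℂ) (g₀ g₁ : ℝ → ℂ) : Prop :=
  LocallyIntegrable g₀ ∧ LocallyIntegrable g₁ ∧
  ∃ wy : ℝ × ℝ → ℂ, HasWeakDeriv (0, 1) w wy ∧
    ∀ ψ : ℝ × ℝ → ℝ, ContDiff ℝ ∞ ψ → HasCompactSupport ψ →
      (∫ p in strip, ((fderiv ℝ ψ p (0, 1) : ℝ) : ℂ) * w p) + ∫ p in strip, (ψ p : ℂ) * wy p =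
        (∫ x, (ψ (x, 1) : ℂ) * g₁ x) - ∫ x, (ψ (x, 0) : ℂ) * g₀ x

/-- The Neumann condition `∂_ν u = 0` on `∂Ω` in the sense of traces. The outward normal is
`(0,1)` at `y = 1` and `(0,-1)` at `y = 0`, so the trace of `∂u/∂y` vanishes on both lines. -/
def NeumannZero (u : ℝ × ℝ → ℂ) : Prop :=
  ∃ uy : ℝ × ℝ → ℂ, HasWeakDeriv (0, 1) u uy ∧ HasTraces uy 0 0

/-- The modal radiation condition: for every `n`, `c(x) = ⟨u(x,·), φ_n⟩` satisfies
`|c'(x) x/|x| - i k_n c(x)| → 0` as `|x| → ∞`. The coefficient is only defined for almost every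
`x`, and `c` is its (unique) continuously differentiable representative. -/
def Outgoing (k : ℝ) (u : ℝ × ℝ → ℂ) : Prop :=
  ∀ n : ℕ, ∃ c : ℝ → ℂ, ContDiff ℝ 1 c ∧ (∀ᵐ x : ℝ, modalCoeff u n x = c x) ∧
    Tendsto (fun x : ℝ => ‖deriv c x * ((x / |x| : ℝ) : ℂ) - Complex.I * waveNumber k n * c x‖)
      (comap (fun x : ℝ => |x|) atTop) (𝓝 0)

/-- `u ∈ H²_loc(Ω)` is an outgoing solution of the Neumann problem for `Δu + k²u = -s`. -/
structure IsSolution (k : ℝ) (s u : ℝ × ℝ → ℂ) : Prop where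
  memH2Loc : MemH2Loc u
  helmholtz : SolvesHelmholtz k s u
  neumann : NeumannZero u
  outgoing : Outgoing k u

/-- `u_{k,n}(x) = (i / 2k_n) ∫_ℝ s_n(z) exp(i k_n |x - z|) dz`. -/
def modalSolution (k : ℝ) (s : ℝ × ℝ → ℂ) (n : ℕ) (x : ℝ) : ℂ :=
  Complex.I / (2 * waveNumber k n) *
    ∫ z : ℝ, modalCoeff s n z * Complex.exp (Complex.I * waveNumber k n * (|x - z| : ℝ))

end Waveguide

end

namespace Waveguide

/-! Expansion in the Neumann eigenfunctions uncouples the problem into the equations u_n'' + k_n²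
u_n = -s_n on the line. As k_n ≠ 0, the kernel i exp(i k_n |x|) / (2 k_n) is the outgoing
fundamental solution. Its convolution with s_n ∈ L¹ is C¹ and solves the equation weakly
(`hasDerivAt_outgoingSol`, `hasWeakDeriv1_outgoingSolDeriv`). It is outgoing because u_n' - i k_n
u_n at x involves only the sources to the right of x, whose mass tends to zero, and symmetrically on
the left (`tendsto_radiation_outgoingSol`).

Existence rests on an estimate uniform in n. For large n one has k_n = iq with q ≥ n. Sources near
Ω_r are handled by Cauchy–Schwarz and Fubini with the kernel mass 2/q; the gain q⁻² is exactly what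
two derivatives cost, and Bessel's inequality sums the rest because s ∈ L²_loc. Sources at distance
at least 1 carry a factor exp(-q), so the bound on ‖s_n‖ in L¹, uniform in n, is enough
(`integral_norm_sq_le_of_norm_le`, `summable_integral_norm_sq`). Hence the series for u, u_x, u_y,
u_xy, u_yy converge in L²_loc by orthogonality, and u_xx is read off from the equation. Weak
derivatives and the Neumann identity survive L²_loc limits (`exists_isSolution`).

For uniqueness, the coefficients of any solution satisfy the weak modal equation
(`IsSolution.modal_equation`). The tests χ(x)φ_n(y) do not vanish on ∂Ω, so cut-offs
(`HasWeakDeriv.integral_by_parts`) and the zero traces are needed. Subtracting the kernel solution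
leaves an outgoing homogeneous solution h. The combinations ±h' - iκh are pure exponentials that do
not decay in the direction where the radiation condition sends them to zero, so h = 0
(`eq_zero_of_outgoing`). Completeness of the cosines in L¹(0,1) concludes.

Pointwise convergence holds because n² u_n(x) is square summable for almost every x, which makes
u_n(x) absolutely summable. -/

/-! ### Measures on the strip and local L² spaces -/

theorem restrict_strip : (volume : Measure (ℝ × ℝ)).restrict strip =
    (volume : Measure ℝ).prod (volume.restrict (Set.Ioo (0 : ℝ) 1)) := by
  rw [strip, Measure.volume_eq_prod, ← Measure.prod_restrict, Measure.restrict_univ]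

theorem restrict_truncStrip (r : ℝ) : (volume : Measure (ℝ × ℝ)).restrict (truncStrip r) =
    ((volume : Measure ℝ).restrict (Set.Ioo (-r) r)).prod
      (volume.restrict (Set.Ioo (0 : ℝ) 1)) := by
  rw [truncStrip, Measure.volume_eq_prod, ← Measure.prod_restrict]

theorem measurableSet_strip : MeasurableSet strip :=
  MeasurableSet.univ.prod measurableSet_Ioo

theorem isOpen_strip : IsOpen strip := isOpen_univ.prod isOpen_Ioo

theorem measurableSet_truncStrip (r : ℝ) : MeasurableSet (truncStrip r) :=
  measurableSet_Ioo.prod measurableSet_Ioo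

theorem truncStrip_subset_strip (r : ℝ) : truncStrip r ⊆ strip :=
  Set.prod_mono (Set.subset_univ _) subset_rfl

theorem truncStrip_mono {r R : ℝ} (h : r ≤ R) : truncStrip r ⊆ truncStrip R :=
  Set.prod_mono (Set.Ioo_subset_Ioo (by linarith) h) subset_rfl

theorem mem_truncStrip_iff {r : ℝ} {p : ℝ × ℝ} :
    p ∈ truncStrip r ↔ |p.1| < r ∧ p ∈ strip := by
  simp [truncStrip, strip, abs_lt]

instance isFiniteMeasure_truncStrip (r : ℝ) :
    IsFiniteMeasure ((volume : Measure (ℝ × ℝ)).restrict (truncStrip r)) := by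
  rw [restrict_truncStrip]; infer_instance

theorem iUnion_truncStrip : ⋃ m : ℕ, truncStrip (m + 1 : ℝ) = strip := by
  ext p
  simp only [Set.mem_iUnion, mem_truncStrip_iff]
  constructor
  · rintro ⟨m, _, h⟩; exact h
  · intro h
    obtain ⟨m, hm⟩ := exists_nat_gt |p.1|
    exact ⟨m, by linarith, h⟩

theorem ae_strip_iff {P : ℝ × ℝ → Prop} :
    (∀ᵐ p ∂(volume.restrict strip), P p) ↔
      ∀ r : ℝ, 0 < r → ∀ᵐ p ∂(volume.restrict (truncStrip r)), P p := by
  constructor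
  · intro h r _
    exact ae_mono (Measure.restrict_mono (truncStrip_subset_strip r) le_rfl) h
  · intro h
    rw [← iUnion_truncStrip, ae_restrict_iUnion_iff]
    intro m
    exact h _ (by positivity)

theorem ae_real_iff {P : ℝ → Prop} :
    (∀ᵐ x : ℝ, P x) ↔ ∀ r : ℝ, 0 < r → ∀ᵐ x ∂(volume.restrict (Set.Ioo (-r) r)), P x := by
  constructor
  · intro h r _
    exact ae_restrict_of_ae h
  · intro h
    have hU : ⋃ m : ℕ, Set.Ioo (-(m + 1 : ℝ)) (m + 1 : ℝ) = Set.univ := by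
      rw [Set.eq_univ_iff_forall]
      intro x
      obtain ⟨m, hm⟩ := exists_nat_gt |x|
      exact Set.mem_iUnion.2 ⟨m, abs_lt.1 (by linarith)⟩
    rw [← Measure.restrict_univ (μ := (volume : Measure ℝ)), ← hU, ae_restrict_iUnion_iff]
    intro m
    exact h _ (by positivity)

theorem MemL2Loc.aestronglyMeasurable {f : ℝ × ℝ → ℂ} (hf : MemL2Loc f) :
    AEStronglyMeasurable f (volume.restrict strip) := by
  rw [← iUnion_truncStrip]
  exact AEStronglyMeasurable.iUnion fun m => (hf _ (by positivity)).aestronglyMeasurable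

theorem MemL2Loc.integrableOn {f : ℝ × ℝ → ℂ} (hf : MemL2Loc f) {r : ℝ} (hr : 0 < r) :
    IntegrableOn f (truncStrip r) :=
  memLp_one_iff_integrable.1 ((hf r hr).mono_exponent (by norm_num))

theorem MemL2Loc.add {f g : ℝ × ℝ → ℂ} (hf : MemL2Loc f) (hg : MemL2Loc g) :
    MemL2Loc (fun p => f p + g p) := fun r hr => (hf r hr).add (hg r hr)

theorem MemL2Loc.sub {f g : ℝ × ℝ → ℂ} (hf : MemL2Loc f) (hg : MemL2Loc g) :
    MemL2Loc (fun p => f p - g p) := fun r hr => (hf r hr).sub (hg r hr)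

theorem MemL2Loc.const_mul {f : ℝ × ℝ → ℂ} (hf : MemL2Loc f) (c : ℂ) :
    MemL2Loc (fun p => c * f p) := fun r hr => (hf r hr).const_mul c

theorem MemL2Loc.sum {ι : Type*} (t : Finset ι) {f : ι → ℝ × ℝ → ℂ}
    (hf : ∀ i ∈ t, MemL2Loc (f i)) : MemL2Loc (fun p => ∑ i ∈ t, f i p) :=
  fun r hr => memLp_finsetSum t fun i hi => hf i hi r hr

theorem MemL2Loc.congr {f g : ℝ × ℝ → ℂ} (hf : MemL2Loc f)
    (h : ∀ᵐ p ∂(volume.restrict strip), f p = g p) : MemL2Loc g :=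
  fun r hr => (hf r hr).ae_eq (ae_strip_iff.1 h r hr)

/-! ### Test weights, convergence in L²_loc and weak derivatives -/

/-- Bounded weights on the plane that vanish for large `|x|`. -/
structure XTest (g : ℝ × ℝ → ℂ) : Prop where
  measurable : Measurable g
  bounded : ∃ C : ℝ, ∀ p, ‖g p‖ ≤ C
  support : ∃ R : ℝ, 0 < R ∧ ∀ p : ℝ × ℝ, R ≤ |p.1| → g p = 0

theorem XTest.of_hasCompactSupport {g : ℝ × ℝ → ℝ} (hc : Continuous g)
    (hs : HasCompactSupport g) : XTest (fun p => (g p : ℂ)) := by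
  refine ⟨by fun_prop, ?_, ?_⟩
  · obtain ⟨C, hC⟩ := hs.exists_bound_of_continuous hc
    exact ⟨C, fun p => by simpa using hC p⟩
  · obtain ⟨R, hR⟩ := (hs.isCompact.isBounded).subset_closedBall 0
    refine ⟨max R 0 + 1, by positivity, fun p hp => ?_⟩
    by_contra h
    have h1 : p ∈ tsupport g := subset_tsupport g (by simpa using h)
    have h2 := hR h1
    rw [Metric.mem_closedBall, dist_zero_right] at h2
    have h3 := norm_fst_le p
    rw [Real.norm_eq_abs] at h3
    have h4 := le_max_left R 0
    linarith

theorem XTest.integrableOn_mul {g f : ℝ × ℝ → ℂ} (hg : XTest g) (hf : MemL2Loc f) :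
    IntegrableOn (fun p => g p * f p) strip := by
  obtain ⟨C, hC⟩ := hg.bounded
  obtain ⟨R, hR, hR'⟩ := hg.support
  have h1 : IntegrableOn (fun p => g p * f p) (truncStrip R) :=
    (hf.integrableOn hR).bdd_mul hg.measurable.aestronglyMeasurable
      (Eventually.of_forall hC)
  refine h1.of_forall_sdiff_eq_zero measurableSet_strip fun p hp => ?_
  have : R ≤ |p.1| := by
    by_contra h
    exact hp.2 (mem_truncStrip_iff.2 ⟨not_le.1 h, hp.1⟩)
  simp [hR' p this]

/-- The radius depends on the weight alone, so one truncated strip serves a whole sequence of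
functions. -/
theorem XTest.exists_setIntegral_eq {g : ℝ × ℝ → ℂ} (hg : XTest g) :
    ∃ R : ℝ, 0 < R ∧ ∀ f : ℝ × ℝ → ℂ,
      ∫ p in strip, g p * f p = ∫ p in truncStrip R, g p * f p := by
  obtain ⟨R, hR, hR'⟩ := hg.support
  refine ⟨R, hR, fun f => setIntegral_eq_of_subset_of_forall_sdiff_eq_zero measurableSet_strip
    (truncStrip_subset_strip R) fun p hp => ?_⟩
  have : R ≤ |p.1| := by
    by_contra h
    exact hp.2 (mem_truncStrip_iff.2 ⟨not_le.1 h, hp.1⟩)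
  simp [hR' p this]

/-- `S N → w` in `L²(Ω_r)` for every `r`. -/
structure TendstoL2Loc (S : ℕ → ℝ × ℝ → ℂ) (w : ℝ × ℝ → ℂ) : Prop where
  mem : ∀ N, MemL2Loc (S N)
  memLim : MemL2Loc w
  tendsto : ∀ r : ℝ, 0 < r →
    Tendsto (fun N => eLpNorm (fun p => w p - S N p) 2 (volume.restrict (truncStrip r)))
      atTop (𝓝 0)

theorem TendstoL2Loc.add {S T : ℕ → ℝ × ℝ → ℂ} {v w : ℝ × ℝ → ℂ} (hS : TendstoL2Loc S v)
    (hT : TendstoL2Loc T w) :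
    TendstoL2Loc (fun N p => S N p + T N p) (fun p => v p + w p) := by
  refine ⟨fun N => (hS.mem N).add (hT.mem N), hS.memLim.add hT.memLim, fun r hr => ?_⟩
  have h := (hS.tendsto r hr).add (hT.tendsto r hr)
  rw [add_zero] at h
  refine tendsto_of_tendsto_of_tendsto_of_le_of_le tendsto_const_nhds h (fun _ => zero_le)
    fun N => ?_
  have h2 := eLpNorm_add_le (p := 2)
    ((hS.memLim r hr).sub (hS.mem N r hr)).aestronglyMeasurable
    ((hT.memLim r hr).sub (hT.mem N r hr)).aestronglyMeasurable (by norm_num)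
  refine le_trans (le_of_eq ?_) h2
  congr 1
  ext p
  simp only [Pi.add_apply, Pi.sub_apply]
  ring

theorem TendstoL2Loc.const_mul {S : ℕ → ℝ × ℝ → ℂ} {v : ℝ × ℝ → ℂ} (hS : TendstoL2Loc S v)
    (c : ℂ) : TendstoL2Loc (fun N p => c * S N p) (fun p => c * v p) := by
  refine ⟨fun N => (hS.mem N).const_mul c, hS.memLim.const_mul c, fun r hr => ?_⟩
  have h := ENNReal.Tendsto.const_mul (a := ‖c‖ₑ) (hS.tendsto r hr) (Or.inr (by simp))
  rw [mul_zero] at h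
  refine h.congr fun N => ?_
  rw [← eLpNorm_const_smul]
  congr 1
  ext p
  simp [mul_sub]

theorem TendstoL2Loc.congr_lim {S : ℕ → ℝ × ℝ → ℂ} {v w : ℝ × ℝ → ℂ} (hS : TendstoL2Loc S v)
    (h : ∀ᵐ p ∂(volume.restrict strip), v p = w p) : TendstoL2Loc S w := by
  refine ⟨hS.mem, hS.memLim.congr h, fun r hr => (hS.tendsto r hr).congr fun N => ?_⟩
  refine eLpNorm_congr_ae ?_
  filter_upwards [ae_strip_iff.1 h r hr] with p hp
  rw [hp]

/-- The weight confines everything to some Ω_R, which has finite measure; there L² convergence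
implies L¹ convergence, and a bounded factor preserves it. -/
theorem XTest.tendsto_integral {g : ℝ × ℝ → ℂ} (hg : XTest g) {S : ℕ → ℝ × ℝ → ℂ}
    {w : ℝ × ℝ → ℂ} (hS : TendstoL2Loc S w) :
    Tendsto (fun N => ∫ p in strip, g p * S N p) atTop (𝓝 (∫ p in strip, g p * w p)) := by
  obtain ⟨R, hR, hR'⟩ := hg.exists_setIntegral_eq
  obtain ⟨C, hC⟩ := hg.bounded
  simp only [hR']
  have hi : ∀ f : ℝ × ℝ → ℂ, MemL2Loc f → IntegrableOn (fun p => g p * f p) (truncStrip R) :=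
    fun f hf => (hg.integrableOn_mul hf).mono_set (truncStrip_subset_strip R)
  refine tendsto_integral_of_L1' _ (hi w hS.memLim).aestronglyMeasurable
    (Eventually.of_forall fun N => hi _ (hS.mem N)) ?_
  set μ := (volume : Measure (ℝ × ℝ)).restrict (truncStrip R)
  have h1 := ENNReal.Tendsto.const_mul
    (a := ENNReal.ofReal C * μ Set.univ ^ (1 / (1 : ENNReal).toReal - 1 / (2 : ENNReal).toReal))
    (hS.tendsto R hR) (Or.inr (ENNReal.mul_ne_top (by simp)
      (ENNReal.rpow_ne_top_of_nonneg (by norm_num) (measure_ne_top _ _))))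
  rw [mul_zero] at h1
  refine tendsto_of_tendsto_of_tendsto_of_le_of_le tendsto_const_nhds h1 (fun _ => zero_le)
    fun N => ?_
  have h2 := eLpNorm_le_eLpNorm_mul_rpow_measure_univ (p := 1) (q := 2) (by norm_num)
    ((hS.memLim R hR).sub (hS.mem N R hR)).aestronglyMeasurable
  have h3 : eLpNorm ((fun p => g p * S N p) - fun p => g p * w p) 1 μ ≤
      ENNReal.ofReal C * eLpNorm (w - S N) 1 μ := by
    refine eLpNorm_le_mul_eLpNorm_of_ae_le_mul (Eventually.of_forall fun p => ?_) 1
    simp only [Pi.sub_apply]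
    rw [← mul_sub, norm_mul, norm_sub_rev (S N p)]
    exact mul_le_mul_of_nonneg_right (hC p) (norm_nonneg _)
  refine h3.trans ?_
  rw [mul_assoc, mul_comm (_ ^ _)]
  exact mul_le_mul_right h2 _

theorem fderiv_xTest {ψ : ℝ × ℝ → ℝ} (hψ : ContDiff ℝ ∞ ψ) (hs : HasCompactSupport ψ)
    (e : ℝ × ℝ) : XTest (fun p => ((fderiv ℝ ψ p e : ℝ) : ℂ)) := by
  refine XTest.of_hasCompactSupport ((hψ.continuous_fderiv (by simp)).clm_apply
    continuous_const) (hs.fderiv_apply (𝕜 := ℝ) e)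

/-- Passing to the limit in integration by parts identities. -/
theorem TendstoL2Loc.integral_add_eq_zero {S T : ℕ → ℝ × ℝ → ℂ} {v w : ℝ × ℝ → ℂ}
    (hS : TendstoL2Loc S v) (hT : TendstoL2Loc T w) {f g : ℝ × ℝ → ℂ} (hf : XTest f)
    (hg : XTest g)
    (h : ∀ N, (∫ p in strip, f p * S N p) + ∫ p in strip, g p * T N p = 0) :
    (∫ p in strip, f p * v p) + ∫ p in strip, g p * w p = 0 := by
  have h1 := (hf.tendsto_integral hS).add (hg.tendsto_integral hT)
  simp only [h] at h1
  exact tendsto_nhds_unique h1 tendsto_const_nhds |>.symm ▸ rfl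

theorem HasWeakDeriv.of_tendsto {S T : ℕ → ℝ × ℝ → ℂ} {v w : ℝ × ℝ → ℂ} {e : ℝ × ℝ}
    (hS : TendstoL2Loc S v) (hT : TendstoL2Loc T w) (h : ∀ N, HasWeakDeriv e (S N) (T N)) :
    HasWeakDeriv e v w := by
  refine ⟨hS.memLim, hT.memLim, fun ψ h1 h2 h3 => ?_⟩
  rw [eq_neg_iff_add_eq_zero]
  refine hS.integral_add_eq_zero hT (fderiv_xTest h1 h2 e)
    (XTest.of_hasCompactSupport h1.continuous h2) fun N => ?_
  rw [← eq_neg_iff_add_eq_zero]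
  exact (h N).2.2 ψ h1 h2 h3

/-- Weak derivatives are unique. -/
theorem HasWeakDeriv.ae_eq {e : ℝ × ℝ} {u u' v v' : ℝ × ℝ → ℂ} (h : HasWeakDeriv e u v)
    (h' : HasWeakDeriv e u' v') (hu : ∀ᵐ p ∂(volume.restrict strip), u p = u' p) :
    ∀ᵐ p ∂(volume.restrict strip), v p = v' p := by
  have hloc : LocallyIntegrableOn (fun p => v p - v' p) strip := by
    rw [locallyIntegrableOn_iff isOpen_strip.isLocallyClosed]
    intro K hK hKc
    obtain ⟨R, hR⟩ := hKc.isBounded.subset_closedBall 0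
    refine ((h.2.1.sub h'.2.1).integrableOn (r := max R 0 + 1) (by positivity)).mono_set
      fun p hp => mem_truncStrip_iff.2 ⟨?_, hK hp⟩
    have h2 := hR hp
    rw [Metric.mem_closedBall, dist_zero_right] at h2
    have h3 := norm_fst_le p
    rw [Real.norm_eq_abs] at h3
    have h4 := le_max_left R 0
    linarith
  have key := isOpen_strip.ae_eq_zero_of_integral_contDiff_smul_eq_zero hloc ?_
  · rw [ae_restrict_iff' measurableSet_strip]
    filter_upwards [key] with p hp hps
    exact sub_eq_zero.1 (hp hps)
  · intro ψ h1 h2 h3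
    have ht := XTest.of_hasCompactSupport h1.continuous h2
    have e1 := h.2.2 ψ h1 h2 h3
    have e2 := h'.2.2 ψ h1 h2 h3
    have e3 : ∫ p in strip, ((fderiv ℝ ψ p e : ℝ) : ℂ) * u p =
        ∫ p in strip, ((fderiv ℝ ψ p e : ℝ) : ℂ) * u' p := by
      refine integral_congr_ae ?_
      filter_upwards [hu] with p hp
      rw [hp]
    -- The fundamental lemma integrates over the whole plane; the support of ψ brings the integral
    -- back to the strip.
    have e4 : ∫ p, ψ p • (v p - v' p) = ∫ p in strip, (ψ p : ℂ) * (v p - v' p) := by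
      rw [setIntegral_eq_integral_of_forall_compl_eq_zero]
      · simp
      · intro p hp
        have : ψ p = 0 := image_eq_zero_of_notMem_tsupport fun h => hp (h3 h)
        simp [this]
    rw [e4]
    simp only [mul_sub]
    rw [integral_sub (ht.integrableOn_mul h.2.1) (ht.integrableOn_mul h'.2.1), sub_eq_zero]
    rw [e1, e2] at e3
    exact neg_injective e3

/-! ### The cosine and sine systems on (0,1) -/

/-- Normalized Dirichlet eigenfunctions of `(0,1)`. -/
noncomputable def sinMode (n : ℕ) (y : ℝ) : ℝ := Real.sqrt 2 * Real.sin (n * Real.pi * y)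

theorem mode_eq (n : ℕ) (y : ℝ) :
    mode n y = (if n = 0 then 1 else Real.sqrt 2) * Real.cos (n * Real.pi * y) := by
  unfold mode
  split_ifs with h
  · simp [h]
  · rfl

theorem contDiff_mode (n : ℕ) : ContDiff ℝ ∞ (mode n) := by
  have : mode n = fun y => (if n = 0 then 1 else Real.sqrt 2) * Real.cos (n * Real.pi * y) :=
    funext (mode_eq n)
  rw [this]
  exact contDiff_const.mul (Real.contDiff_cos.comp (contDiff_const.mul contDiff_id))

theorem contDiff_sinMode (n : ℕ) : ContDiff ℝ ∞ (sinMode n) :=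
  contDiff_const.mul (Real.contDiff_sin.comp (contDiff_const.mul contDiff_id))

theorem hasDerivAt_mode (n : ℕ) (y : ℝ) :
    HasDerivAt (mode n) (-(n * Real.pi) * sinMode n y) y := by
  rcases eq_or_ne n 0 with rfl | hn
  · have : mode 0 = fun _ => (1 : ℝ) := by ext y; simp [mode]
    rw [this]
    simpa using hasDerivAt_const y (1 : ℝ)
  · have : mode n = fun y => Real.sqrt 2 * Real.cos (n * Real.pi * y) := by
      ext y; simp [mode, hn]
    rw [this]
    have h := ((Real.hasDerivAt_cos (n * Real.pi * y)).comp y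
      ((hasDerivAt_id y).const_mul (n * Real.pi))).const_mul (Real.sqrt 2)
    refine h.congr_deriv ?_
    simp only [sinMode]
    ring

theorem hasDerivAt_sinMode (n : ℕ) (y : ℝ) :
    HasDerivAt (sinMode n) (n * Real.pi * mode n y) y := by
  rcases eq_or_ne n 0 with rfl | hn
  · have : sinMode 0 = fun _ => (0 : ℝ) := by ext y; simp [sinMode]
    rw [this]
    simpa using hasDerivAt_const y (0 : ℝ)
  · have h := ((Real.hasDerivAt_sin (n * Real.pi * y)).comp y
      ((hasDerivAt_id y).const_mul (n * Real.pi))).const_mul (Real.sqrt 2)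
    refine h.congr_deriv ?_
    simp only [mode, hn, if_false]
    ring

theorem sinMode_zero (n : ℕ) : sinMode n 0 = 0 := by simp [sinMode]

theorem sinMode_one (n : ℕ) : sinMode n 1 = 0 := by simp [sinMode, Real.sin_nat_mul_pi]

theorem abs_mode_le (n : ℕ) (y : ℝ) : |mode n y| ≤ Real.sqrt 2 := by
  rw [mode_eq, abs_mul]
  have h1 : |(if n = 0 then 1 else Real.sqrt 2)| ≤ Real.sqrt 2 := by
    split_ifs
    · rw [abs_one]; exact Real.one_le_sqrt.2 (by norm_num)
    · rw [abs_of_nonneg (Real.sqrt_nonneg _)]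
  calc _ ≤ Real.sqrt 2 * 1 :=
        mul_le_mul h1 (Real.abs_cos_le_one _) (abs_nonneg _) (Real.sqrt_nonneg _)
    _ = _ := mul_one _

theorem abs_sinMode_le (n : ℕ) (y : ℝ) : |sinMode n y| ≤ Real.sqrt 2 := by
  rw [sinMode, abs_mul, abs_of_nonneg (Real.sqrt_nonneg _)]
  exact mul_le_of_le_one_right (Real.sqrt_nonneg _) (Real.abs_sin_le_one _)

theorem integral_cos_int_mul_pi {j : ℤ} (hj : j ≠ 0) :
    ∫ y in Set.Ioo (0 : ℝ) 1, Real.cos (j * Real.pi * y) = 0 := by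
  rw [← integral_Ioc_eq_integral_Ioo, ← intervalIntegral.integral_of_le zero_le_one]
  have h : (j : ℝ) * Real.pi ≠ 0 := mul_ne_zero (by exact_mod_cast hj) Real.pi_ne_zero
  rw [intervalIntegral.integral_comp_mul_left (fun y => Real.cos y) h, integral_cos]
  simp [Real.sin_int_mul_pi]

theorem integrableOn_Ioo_of_continuous {E : Type*} [NormedAddCommGroup E] {f : ℝ → E}
    (hf : Continuous f) (a b : ℝ) : IntegrableOn f (Set.Ioo a b) :=
  (hf.integrableOn_Icc (a := a) (b := b)).mono_set Set.Ioo_subset_Icc_self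

theorem integral_cos_mul_cos {m n : ℕ} (h : m ≠ n) :
    ∫ y in Set.Ioo (0 : ℝ) 1, Real.cos (m * Real.pi * y) * Real.cos (n * Real.pi * y) = 0 := by
  have e : ∀ y : ℝ, Real.cos (m * Real.pi * y) * Real.cos (n * Real.pi * y) =
      (1 / 2) * Real.cos (((m - n : ℤ) : ℝ) * Real.pi * y) +
      (1 / 2) * Real.cos (((m + n : ℤ) : ℝ) * Real.pi * y) := by
    intro y
    push_cast
    rw [sub_mul, sub_mul, add_mul, add_mul, Real.cos_sub, Real.cos_add]
    ring
  simp_rw [e]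
  rw [integral_add (integrableOn_Ioo_of_continuous (by fun_prop) _ _)
    (integrableOn_Ioo_of_continuous (by fun_prop) _ _), integral_const_mul, integral_const_mul,
    integral_cos_int_mul_pi (by omega), integral_cos_int_mul_pi (by omega)]
  simp

theorem integral_sin_mul_sin {m n : ℕ} (h : m ≠ n) :
    ∫ y in Set.Ioo (0 : ℝ) 1, Real.sin (m * Real.pi * y) * Real.sin (n * Real.pi * y) = 0 := by
  have e : ∀ y : ℝ, Real.sin (m * Real.pi * y) * Real.sin (n * Real.pi * y) =
      (1 / 2) * Real.cos (((m - n : ℤ) : ℝ) * Real.pi * y) -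
      (1 / 2) * Real.cos (((m + n : ℤ) : ℝ) * Real.pi * y) := by
    intro y
    push_cast
    rw [sub_mul, sub_mul, add_mul, add_mul, Real.cos_sub, Real.cos_add]
    ring
  simp_rw [e]
  rw [integral_sub (integrableOn_Ioo_of_continuous (by fun_prop) _ _)
    (integrableOn_Ioo_of_continuous (by fun_prop) _ _), integral_const_mul, integral_const_mul,
    integral_cos_int_mul_pi (by omega), integral_cos_int_mul_pi (by omega)]
  simp

theorem integral_mode_mul_mode (m n : ℕ) :
    ∫ y in Set.Ioo (0 : ℝ) 1, mode m y * mode n y = if m = n then 1 else 0 := by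
  split_ifs with h
  · subst h
    rcases eq_or_ne m 0 with rfl | hm
    · simp [mode]
    · have e : ∀ y : ℝ, mode m y * mode m y =
          1 + Real.cos (((2 * m : ℤ) : ℝ) * Real.pi * y) := by
        intro y
        have h2 : Real.sqrt 2 * Real.sqrt 2 = 2 := Real.mul_self_sqrt (by norm_num)
        simp only [mode, hm, if_false]
        push_cast
        rw [show (2 * (m : ℝ)) * Real.pi * y = 2 * (m * Real.pi * y) by ring, Real.cos_two_mul]
        linear_combination (Real.cos (m * Real.pi * y)) ^ 2 * h2
      simp_rw [e]
      rw [integral_add (integrableOn_Ioo_of_continuous (by fun_prop) _ _)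
        (integrableOn_Ioo_of_continuous (by fun_prop) _ _), integral_cos_int_mul_pi (by omega)]
      simp
  · have e : ∀ y : ℝ, mode m y * mode n y =
        ((if m = 0 then 1 else Real.sqrt 2) * (if n = 0 then 1 else Real.sqrt 2)) *
        (Real.cos (m * Real.pi * y) * Real.cos (n * Real.pi * y)) := by
      intro y
      rw [mode_eq, mode_eq]; ring
    simp_rw [e]
    rw [integral_const_mul, integral_cos_mul_cos h, mul_zero]

theorem integral_sinMode_mul_sinMode {m n : ℕ} (h : m ≠ n) :
    ∫ y in Set.Ioo (0 : ℝ) 1, sinMode m y * sinMode n y = 0 := by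
  have e : ∀ y : ℝ, sinMode m y * sinMode n y = (Real.sqrt 2 * Real.sqrt 2) *
      (Real.sin (m * Real.pi * y) * Real.sin (n * Real.pi * y)) := by
    intro y
    rw [sinMode, sinMode]; ring
  simp_rw [e]
  rw [integral_const_mul, integral_sin_mul_sin h, mul_zero]

theorem integrableOn_ofReal_mul {b : ℝ → ℝ} (hb : Continuous b) {f : ℝ → ℂ}
    (hf : IntegrableOn f (Set.Ioo 0 1)) :
    IntegrableOn (fun y => (b y : ℂ) * f y) (Set.Ioo 0 1) := by
  obtain ⟨C, hC⟩ := (isCompact_Icc (a := (0 : ℝ)) (b := 1)).exists_bound_of_continuousOn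
    hb.continuousOn
  refine hf.bdd_mul (c := C) (by fun_prop) ?_
  filter_upwards [ae_restrict_mem measurableSet_Ioo] with y hy
  simpa using hC y (Set.Ioo_subset_Icc_self hy)

/-- The cosine system is complete in `L¹(0,1)`. -/
theorem ae_eq_zero_of_integral_mode_mul {f : ℝ → ℂ} (hf : IntegrableOn f (Set.Ioo 0 1))
    (h : ∀ n, ∫ y in Set.Ioo (0 : ℝ) 1, (mode n y : ℂ) * f y = 0) :
    ∀ᵐ y ∂(volume.restrict (Set.Ioo (0 : ℝ) 1)), f y = 0 := by
  have h1 : ∀ n : ℕ, ∫ y in Set.Ioo (0 : ℝ) 1, (Real.cos (n * Real.pi * y) : ℂ) * f y = 0 := by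
    intro n
    have h2 := h n
    simp_rw [mode_eq, Complex.ofReal_mul, mul_assoc ((if n = 0 then (1 : ℝ) else Real.sqrt 2 : ℝ) : ℂ)] at h2
    rw [integral_const_mul] at h2
    refine (mul_eq_zero.1 h2).resolve_left ?_
    split_ifs <;> simp
  -- The product formula for cosines trades a power of cos(πy) for neighbouring frequencies.
  -- Induction on the power thus makes f orthogonal to all polynomials in cos(πy).
  have h2 : ∀ m n : ℕ, ∫ y in Set.Ioo (0 : ℝ) 1,
      ((Real.cos (Real.pi * y) ^ m * Real.cos (n * Real.pi * y) : ℝ) : ℂ) * f y = 0 := by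
    intro m
    induction m with
    | zero => intro n; simpa using h1 n
    | succ m ih =>
      intro n
      rcases n with _ | n
      · rw [← ih 1]
        refine integral_congr_ae (Eventually.of_forall fun y => ?_)
        simp [pow_succ]
      · have e : ∀ y : ℝ, ((Real.cos (Real.pi * y) ^ (m + 1) *
            Real.cos ((n + 1 : ℕ) * Real.pi * y) : ℝ) : ℂ) * f y =
            (1 / 2) * (((Real.cos (Real.pi * y) ^ m *
              Real.cos ((n + 2 : ℕ) * Real.pi * y) : ℝ) : ℂ) * f y) +
            (1 / 2) * (((Real.cos (Real.pi * y) ^ m *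
              Real.cos (n * Real.pi * y) : ℝ) : ℂ) * f y) := by
          intro y
          have e1 : Real.cos ((n + 2 : ℕ) * Real.pi * y) =
              Real.cos ((n + 1 : ℕ) * Real.pi * y) * Real.cos (Real.pi * y) -
              Real.sin ((n + 1 : ℕ) * Real.pi * y) * Real.sin (Real.pi * y) := by
            rw [← Real.cos_add]; congr 1; push_cast; ring
          have e2 : Real.cos (n * Real.pi * y) =
              Real.cos ((n + 1 : ℕ) * Real.pi * y) * Real.cos (Real.pi * y) +
              Real.sin ((n + 1 : ℕ) * Real.pi * y) * Real.sin (Real.pi * y) := by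
            rw [← Real.cos_sub]; congr 1; push_cast; ring
          rw [e1, e2]
          push_cast
          ring
        simp_rw [e]
        rw [integral_add
          ((integrableOn_ofReal_mul (by fun_prop) hf).const_mul _)
          ((integrableOn_ofReal_mul (by fun_prop) hf).const_mul _),
          integral_const_mul, integral_const_mul, ih, ih]
        simp
  have h3 : ∀ P : Polynomial ℝ, ∫ y in Set.Ioo (0 : ℝ) 1,
      ((P.eval (Real.cos (Real.pi * y)) : ℝ) : ℂ) * f y = 0 := by
    intro P
    induction P using Polynomial.induction_on' with
    | add p q hp hq =>
      simp_rw [Polynomial.eval_add, Complex.ofReal_add, add_mul]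
      rw [integral_add (integrableOn_ofReal_mul (by fun_prop) hf)
        (integrableOn_ofReal_mul (by fun_prop) hf), hp, hq, add_zero]
    | monomial m a =>
      simp_rw [Polynomial.eval_monomial, Complex.ofReal_mul, mul_assoc]
      rw [integral_const_mul]
      have := h2 m 0
      simp only [Nat.cast_zero, zero_mul, Real.cos_zero, mul_one] at this
      rw [this, mul_zero]
  have h4 : ∀ g : ℝ → ℝ, Continuous g → ∫ y in Set.Ioo (0 : ℝ) 1, (g y : ℂ) * f y = 0 := by
    intro g hg
    rw [← norm_le_zero_iff]
    refine le_of_forall_pos_le_add fun ε hε => ?_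
    rw [zero_add]
    set A := ∫ y in Set.Ioo (0 : ℝ) 1, ‖f y‖
    have hA : 0 ≤ A := integral_nonneg fun _ => norm_nonneg _
    -- On (0,1) the substitution t = cos(πy) is inverted by y = arccos(t)/π, so Weierstrass on
    -- [-1,1] approximates g by polynomials in cos(πy). The denominator A + 1 avoids division by
    -- zero when A = 0.
    obtain ⟨P, hP⟩ := exists_polynomial_near_of_continuousOn (-1) 1
      (fun t => g (Real.arccos t / Real.pi))
      (hg.comp (Real.continuous_arccos.div_const _)).continuousOn (ε / (A + 1)) (by positivity)
    have e1 : ∫ y in Set.Ioo (0 : ℝ) 1, (g y : ℂ) * f y =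
        ∫ y in Set.Ioo (0 : ℝ) 1, ((g y - P.eval (Real.cos (Real.pi * y)) : ℝ) : ℂ) * f y := by
      simp_rw [Complex.ofReal_sub, sub_mul]
      rw [integral_sub (integrableOn_ofReal_mul hg hf)
        (integrableOn_ofReal_mul (by fun_prop) hf), h3, sub_zero]
    rw [e1]
    have e2 : ‖∫ y in Set.Ioo (0 : ℝ) 1,
        ((g y - P.eval (Real.cos (Real.pi * y)) : ℝ) : ℂ) * f y‖ ≤
        ∫ y in Set.Ioo (0 : ℝ) 1, ε / (A + 1) * ‖f y‖ := by
      refine norm_integral_le_of_norm_le (hf.norm.const_mul _) ?_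
      filter_upwards [ae_restrict_mem measurableSet_Ioo] with y hy
      rw [norm_mul]
      refine mul_le_mul_of_nonneg_right ?_ (norm_nonneg _)
      have h5 := hP (Real.cos (Real.pi * y)) ⟨Real.neg_one_le_cos _, Real.cos_le_one _⟩
      rw [Real.arccos_cos (by have := hy.1; positivity)
        (by nlinarith [hy.2, Real.pi_pos]), mul_div_cancel_left₀ _ Real.pi_ne_zero] at h5
      rw [Complex.norm_real, Real.norm_eq_abs, abs_sub_comm]
      exact h5.le
    rw [integral_const_mul] at e2
    refine e2.trans ?_
    rw [div_mul_eq_mul_div, div_le_iff₀ (by positivity)]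
    nlinarith
  have key := isOpen_Ioo.ae_eq_zero_of_integral_contDiff_smul_eq_zero
    hf.locallyIntegrableOn fun g h1 h2 h3 => ?_
  · rw [ae_restrict_iff' measurableSet_Ioo]
    exact key
  · rw [← h4 g h1.continuous, setIntegral_eq_integral_of_forall_compl_eq_zero]
    · simp
    · intro y hy
      simp [image_eq_zero_of_notMem_tsupport fun h => hy (h3 h)]

/-! ### Modal coefficients -/

theorem MemL2Loc.prod_integrable {f : ℝ × ℝ → ℂ} (hf : MemL2Loc f) :
    ∀ᵐ x : ℝ, IntegrableOn (fun y => f (x, y)) (Set.Ioo 0 1) := by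
  rw [ae_real_iff]
  intro r hr
  have h := hf.integrableOn hr
  rw [IntegrableOn, restrict_truncStrip] at h
  exact h.prod_right_ae

/-- A function in `L²_loc(Ω)` whose modal coefficients vanish is zero. -/
theorem MemL2Loc.ae_eq_zero {f : ℝ × ℝ → ℂ} (hf : MemL2Loc f)
    (h : ∀ n, ∀ᵐ x : ℝ, modalCoeff f n x = 0) : ∀ᵐ p ∂(volume.restrict strip), f p = 0 := by
  rw [ae_strip_iff]
  intro r hr
  have hi := hf.integrableOn hr
  -- By Fubini it is enough that almost every slice vanishes, which is completeness of the cosines.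
  -- The countably many exceptional null sets are merged first.
  have h2 : ∫ p in truncStrip r, ‖f p‖ = 0 := by
    have hi2 := hi.norm
    rw [restrict_truncStrip] at hi2 ⊢
    rw [integral_prod _ hi2]
    refine integral_eq_zero_of_ae (ae_restrict_of_ae ?_)
    filter_upwards [hf.prod_integrable, ae_all_iff.2 h] with x hx hx2
    refine integral_eq_zero_of_ae ?_
    filter_upwards [ae_eq_zero_of_integral_mode_mul hx hx2] with y hy
    simp [hy]
  rw [integral_eq_zero_iff_of_nonneg (fun _ => norm_nonneg _) hi.norm] at h2
  filter_upwards [h2] with p hp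
  simpa using hp

theorem modal_test_xTest {χ b : ℝ → ℝ} (hχ : Continuous χ) (hs : HasCompactSupport χ)
    (hb : Continuous b) (hbb : ∃ C, ∀ y, |b y| ≤ C) :
    XTest (fun p => (χ p.1 : ℂ) * (b p.2 : ℂ)) := by
  obtain ⟨C, hC⟩ := hs.exists_bound_of_continuous hχ
  obtain ⟨D, hD⟩ := hbb
  obtain ⟨R, hR⟩ := hs.isCompact.isBounded.subset_closedBall 0
  refine ⟨by fun_prop, ⟨C * D, fun p => ?_⟩, max R 0 + 1, by positivity, fun p hp => ?_⟩
  · rw [norm_mul, Complex.norm_real, Complex.norm_real]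
    exact mul_le_mul (hC _) (hD _) (norm_nonneg _) ((norm_nonneg _).trans (hC p.1))
  · have : χ p.1 = 0 := by
      by_contra h
      have h2 := hR (subset_tsupport χ h)
      rw [Metric.mem_closedBall, dist_zero_right, Real.norm_eq_abs] at h2
      have h4 := le_max_left R 0
      linarith
    simp [this]

theorem integral_strip_mul {χ b : ℝ → ℝ} (hχ : Continuous χ) (hs : HasCompactSupport χ)
    (hb : Continuous b) (hbb : ∃ C, ∀ y, |b y| ≤ C) {f : ℝ × ℝ → ℂ} (hf : MemL2Loc f) :
    ∫ p in strip, ((χ p.1 : ℂ) * (b p.2 : ℂ)) * f p =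
      ∫ x, (χ x : ℂ) * ∫ y in Set.Ioo (0 : ℝ) 1, (b y : ℂ) * f (x, y) := by
  have h := (modal_test_xTest hχ hs hb hbb).integrableOn_mul hf
  rw [IntegrableOn, restrict_strip] at h
  rw [restrict_strip, integral_prod _ h]
  simp_rw [mul_assoc]
  simp_rw [integral_const_mul]

theorem integral_strip_mode_mul {χ : ℝ → ℝ} (hχ : Continuous χ) (hs : HasCompactSupport χ)
    (n : ℕ) {f : ℝ × ℝ → ℂ} (hf : MemL2Loc f) :
    ∫ p in strip, ((χ p.1 : ℂ) * (mode n p.2 : ℂ)) * f p =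
      ∫ x, (χ x : ℂ) * modalCoeff f n x :=
  integral_strip_mul hχ hs (contDiff_mode n).continuous ⟨_, abs_mode_le n⟩ hf

theorem integrable_mode_mul {μ : Measure ℝ} [SFinite μ] {f : ℝ × ℝ → ℂ}
    (hf : Integrable f (μ.prod (volume.restrict (Set.Ioo (0 : ℝ) 1)))) (n : ℕ) :
    Integrable (fun p : ℝ × ℝ => (mode n p.2 : ℂ) * f p)
      (μ.prod (volume.restrict (Set.Ioo (0 : ℝ) 1))) := by
  refine hf.bdd_mul (c := Real.sqrt 2) ?_ (Eventually.of_forall fun p => ?_)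
  · have := (contDiff_mode n).continuous
    exact (by fun_prop : Continuous fun p : ℝ × ℝ => (mode n p.2 : ℂ)).aestronglyMeasurable
  · simpa using abs_mode_le n p.2

theorem integrable_modalCoeff {s : ℝ × ℝ → ℂ} (hs : IntegrableOn s strip) (n : ℕ) :
    Integrable (modalCoeff s n) := by
  rw [IntegrableOn, restrict_strip] at hs
  exact (integrable_mode_mul hs n).integral_prod_left

/-- The bound does not depend on n: this uniformity is what the far-field estimate needs from s ∈
L¹. -/
theorem integral_norm_modalCoeff_le {s : ℝ × ℝ → ℂ} (hs : IntegrableOn s strip) (n : ℕ) :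
    ∫ x, ‖modalCoeff s n x‖ ≤ Real.sqrt 2 * ∫ p in strip, ‖s p‖ := by
  have hs' := hs
  rw [IntegrableOn, restrict_strip] at hs'
  rw [restrict_strip, integral_prod _ hs'.norm, ← integral_const_mul]
  refine integral_mono_ae (integrable_modalCoeff hs n).norm
    (hs'.norm.integral_prod_left.const_mul _) ?_
  filter_upwards [hs'.prod_right_ae] with x hx
  rw [← integral_const_mul]
  refine norm_integral_le_of_norm_le (hx.norm.const_mul _) (Eventually.of_forall fun y => ?_)
  rw [norm_mul, Complex.norm_real]
  exact mul_le_mul_of_nonneg_right (abs_mode_le n y) (norm_nonneg _)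

theorem MemL2Loc.integrableOn_modalCoeff {f : ℝ × ℝ → ℂ} (hf : MemL2Loc f) (n : ℕ) {r : ℝ}
    (hr : 0 < r) : IntegrableOn (modalCoeff f n) (Set.Ioo (-r) r) := by
  have h := hf.integrableOn hr
  rw [IntegrableOn, restrict_truncStrip] at h
  exact (integrable_mode_mul h n).integral_prod_left

theorem locallyIntegrable_of_integrableOn_Ioo {f : ℝ → ℂ}
    (h : ∀ r : ℝ, 0 < r → IntegrableOn f (Set.Ioo (-r) r)) : LocallyIntegrable f := by
  rw [locallyIntegrable_iff]
  intro K hK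
  obtain ⟨R, hR⟩ := hK.isBounded.subset_closedBall 0
  refine (h (max R 0 + 1) (by positivity)).mono_set fun x hx => ?_
  have h2 := hR hx
  rw [Metric.mem_closedBall, dist_zero_right, Real.norm_eq_abs] at h2
  have h4 := le_max_left R 0
  exact abs_lt.1 (by linarith)

theorem MemL2Loc.locallyIntegrable_modalCoeff {f : ℝ × ℝ → ℂ} (hf : MemL2Loc f) (n : ℕ) :
    LocallyIntegrable (modalCoeff f n) :=
  locallyIntegrable_of_integrableOn_Ioo fun _ hr => hf.integrableOn_modalCoeff n hr

theorem integrable_ofReal_mul_of_locallyIntegrable {χ : ℝ → ℝ} (hχ : Continuous χ)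
    (hs : HasCompactSupport χ) {c : ℝ → ℂ} (hc : LocallyIntegrable c) :
    Integrable (fun x => (χ x : ℂ) * c x) := by
  have := hc.integrable_smul_left_of_hasCompactSupport hχ hs
  simpa using this

theorem ae_eq_of_integral_test_mul {c d : ℝ → ℂ} (hc : LocallyIntegrable c)
    (hd : LocallyIntegrable d)
    (h : ∀ χ : ℝ → ℝ, ContDiff ℝ ∞ χ → HasCompactSupport χ →
      ∫ x, (χ x : ℂ) * c x = ∫ x, (χ x : ℂ) * d x) : ∀ᵐ x : ℝ, c x = d x := by
  have key := ae_eq_zero_of_integral_contDiff_smul_eq_zero (hc.sub hd) fun χ h1 h2 => ?_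
  · filter_upwards [key] with x hx
    exact sub_eq_zero.1 hx
  · have := h χ h1 h2
    simp only [Pi.sub_apply, Complex.real_smul, mul_sub]
    rw [integral_sub (integrable_ofReal_mul_of_locallyIntegrable h1.continuous h2 hc)
      (integrable_ofReal_mul_of_locallyIntegrable h1.continuous h2 hd), this, sub_self]

/-- Testing against χ(x)φ_n(y) is continuous for L²_loc convergence, and on the partial sums it
eventually gives ∫ χ c. The weak identity for all χ determines the coefficient almost everywhere. -/
theorem TendstoL2Loc.modalCoeff_ae_eq {S : ℕ → ℝ × ℝ → ℂ} {w : ℝ × ℝ → ℂ}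
    (hS : TendstoL2Loc S w) (n : ℕ) {c : ℝ → ℂ} (hc : LocallyIntegrable c)
    (h : ∀ᶠ N in atTop, ∀ x, modalCoeff (S N) n x = c x) :
    ∀ᵐ x : ℝ, modalCoeff w n x = c x := by
  refine ae_eq_of_integral_test_mul (hS.memLim.locallyIntegrable_modalCoeff n) hc
    fun χ h1 h2 => ?_
  have h3 := (modal_test_xTest h1.continuous h2 (contDiff_mode n).continuous
    ⟨_, abs_mode_le n⟩).tendsto_integral hS
  rw [integral_strip_mode_mul h1.continuous h2 n hS.memLim] at h3
  refine tendsto_nhds_unique h3 (Tendsto.congr' ?_ tendsto_const_nhds)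
  filter_upwards [h] with N hN
  rw [integral_strip_mode_mul h1.continuous h2 n (hS.mem N)]
  simp_rw [hN]

theorem modalCoeff_sum_mode (c : ℕ → ℝ → ℂ) {n N : ℕ} (h : n < N) (x : ℝ) :
    modalCoeff (fun p => ∑ m ∈ Finset.range N, c m p.1 * (mode m p.2 : ℂ)) n x = c n x := by
  unfold modalCoeff
  simp_rw [Finset.mul_sum]
  have hcont := fun m => (contDiff_mode m).continuous
  rw [integral_finsetSum _ fun m _ => integrableOn_Ioo_of_continuous (by fun_prop) _ _]
  have e : ∀ m, ∫ y in Set.Ioo (0 : ℝ) 1, (mode n y : ℂ) * (c m x * (mode m y : ℂ)) =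
      c m x * (if n = m then 1 else 0) := by
    intro m
    have e1 : ∀ y, (mode n y : ℂ) * (c m x * (mode m y : ℂ)) =
        c m x * ((mode n y * mode m y : ℝ) : ℂ) := fun y => by push_cast; ring
    simp_rw [e1]
    rw [integral_const_mul, integral_complex_ofReal, integral_mode_mul_mode]
    split_ifs <;> simp
  simp_rw [e]
  simp [h]

/-! ### Hilbert space tools -/

section L2

variable {α : Type*} [MeasurableSpace α] {μ : Measure α}

theorem inner_toLp_toLp {f g : α → ℂ} (hf : MemLp f 2 μ) (hg : MemLp g 2 μ) :
    inner ℂ (hf.toLp f) (hg.toLp g) = ∫ a, g a * (starRingEnd ℂ) (f a) ∂μ := by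
  rw [L2.inner_def]
  refine integral_congr_ae ?_
  filter_upwards [hf.coeFn_toLp, hg.coeFn_toLp] with a h1 h2
  rw [h1, h2]
  rfl

theorem norm_sq_toLp {f : α → ℂ} (hf : MemLp f 2 μ) :
    ‖hf.toLp f‖ ^ 2 = ∫ a, ‖f a‖ ^ 2 ∂μ := by
  have h1 : ((‖hf.toLp f‖ ^ 2 : ℝ) : ℂ) = inner ℂ (hf.toLp f) (hf.toLp f) := by
    rw [inner_self_eq_norm_sq_to_K]; simp
  rw [inner_toLp_toLp] at h1
  have h2 : ∀ a, f a * (starRingEnd ℂ) (f a) = ((‖f a‖ ^ 2 : ℝ) : ℂ) := fun a => by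
    rw [Complex.mul_conj, Complex.normSq_eq_norm_sq]
  simp_rw [h2] at h1
  rw [integral_complex_ofReal] at h1
  exact_mod_cast h1

theorem integrable_norm_sq {f : α → ℂ} (hf : MemLp f 2 μ) :
    Integrable (fun a => ‖f a‖ ^ 2) μ :=
  (memLp_two_iff_integrable_sq_norm hf.aestronglyMeasurable).1 hf

theorem ae_eq_of_tendsto_eLpNorm {S : ℕ → α → ℂ} {v w : α → ℂ}
    (hS : ∀ N, AEStronglyMeasurable (S N) μ) (hv : AEStronglyMeasurable v μ)
    (hw : AEStronglyMeasurable w μ)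
    (h1 : Tendsto (fun N => eLpNorm (fun a => v a - S N a) 2 μ) atTop (𝓝 0))
    (h2 : Tendsto (fun N => eLpNorm (fun a => w a - S N a) 2 μ) atTop (𝓝 0)) :
    ∀ᵐ a ∂μ, v a = w a := by
  have h3 : eLpNorm (v - w) 2 μ ≤ 0 := by
    have h4 := h1.add h2
    rw [add_zero] at h4
    refine ge_of_tendsto' h4 fun N => ?_
    have h5 := eLpNorm_sub_le (p := 2) (hv.sub (hS N)) (hw.sub (hS N)) (by norm_num)
    rwa [sub_sub_sub_cancel_right] at h5
  have h4 := (eLpNorm_eq_zero_iff (hv.sub hw) (by norm_num)).1 (le_antisymm h3 zero_le)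
  filter_upwards [h4] with a ha
  exact sub_eq_zero.1 ha

/-- The lines spanned by the F n form an orthogonal family, so the Hilbert-space summability
criterion applies without normalizing; some F n may be zero. -/
theorem summable_of_orthogonal {E : Type*} [NormedAddCommGroup E] [InnerProductSpace ℂ E]
    [CompleteSpace E] {F : ℕ → E} (h : ∀ m n, m ≠ n → inner ℂ (F m) (F n) = 0)
    (hs : Summable fun n => ‖F n‖ ^ 2) : Summable F := by
  have hV : OrthogonalFamily ℂ (fun i => Submodule.span ℂ {F i})
      fun i => (Submodule.span ℂ {F i}).subtypeₗᵢ := by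
    refine OrthogonalFamily.of_pairwise fun i j hij => ?_
    change Submodule.span ℂ {F i} ⟂ Submodule.span ℂ {F j}
    rw [Submodule.isOrtho_span]
    rintro u rfl v rfl
    exact h i j hij
  exact (hV.summable_iff_norm_sq_summable
    fun i => ⟨F i, Submodule.mem_span_singleton_self (F i)⟩).2 hs

end L2

/-! ### Bessel's inequality and local Riesz–Fischer -/

theorem memLp_ofReal_of_continuous {b : ℝ → ℝ} (hb : Continuous b) {C : ℝ}
    (hC : ∀ y, |b y| ≤ C) :
    MemLp (fun y => (b y : ℂ)) 2 (volume.restrict (Set.Ioo (0 : ℝ) 1)) :=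
  MemLp.of_bound (by fun_prop) C (Eventually.of_forall fun y => by simpa using hC y)

/-- Bessel's inequality for the cosine system. -/
theorem sum_norm_sq_integral_mode_mul_le {f : ℝ → ℂ}
    (hf : MemLp f 2 (volume.restrict (Set.Ioo (0 : ℝ) 1))) (N : ℕ) :
    ∑ n ∈ Finset.range N, ‖∫ y in Set.Ioo (0 : ℝ) 1, (mode n y : ℂ) * f y‖ ^ 2 ≤
      ∫ y in Set.Ioo (0 : ℝ) 1, ‖f y‖ ^ 2 := by
  have hm := fun n => memLp_ofReal_of_continuous (contDiff_mode n).continuous (abs_mode_le n)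
  have ho : Orthonormal ℂ fun n => (hm n).toLp _ := by
    rw [orthonormal_iff_ite]
    intro i j
    rw [inner_toLp_toLp]
    simp_rw [Complex.conj_ofReal, ← Complex.ofReal_mul]
    rw [integral_complex_ofReal, integral_mode_mul_mode]
    by_cases h : i = j
    · simp [h]
    · simp [h, Ne.symm h]
  have h := ho.sum_inner_products_le (hf.toLp f) (s := Finset.range N)
  rw [norm_sq_toLp] at h
  refine le_trans (le_of_eq ?_) h
  refine Finset.sum_congr rfl fun n _ => ?_
  rw [inner_toLp_toLp]
  simp_rw [Complex.conj_ofReal, mul_comm]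

theorem MemL2Loc.ae_memLp {f : ℝ × ℝ → ℂ} (hf : MemL2Loc f) :
    ∀ᵐ x : ℝ, MemLp (fun y => f (x, y)) 2 (volume.restrict (Set.Ioo (0 : ℝ) 1)) := by
  rw [ae_real_iff]
  intro r hr
  have h1 := hf r hr
  have h2 := integrable_norm_sq h1
  have h3 := h1.aestronglyMeasurable
  rw [restrict_truncStrip] at h2 h3
  filter_upwards [h2.prod_right_ae, h3.prodMk_left] with x hx hx3
  exact (memLp_two_iff_integrable_sq_norm hx3).2 hx

theorem MemL2Loc.memLp_modalCoeff {f : ℝ × ℝ → ℂ} (hf : MemL2Loc f) (n : ℕ) {r : ℝ}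
    (hr : 0 < r) : MemLp (modalCoeff f n) 2 (volume.restrict (Set.Ioo (-r) r)) := by
  have hm := (hf.integrableOn_modalCoeff n hr).aestronglyMeasurable
  rw [memLp_two_iff_integrable_sq_norm hm]
  have h2 := integrable_norm_sq (hf r hr)
  rw [restrict_truncStrip] at h2
  refine h2.integral_prod_left.mono' (hm.norm.pow 2) ?_
  filter_upwards [ae_restrict_of_ae hf.ae_memLp] with x hx
  have h := sum_norm_sq_integral_mode_mul_le hx (n + 1)
  rw [Real.norm_of_nonneg (by positivity)]
  exact (Finset.single_le_sum (f := fun n =>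
    ‖∫ y in Set.Ioo (0 : ℝ) 1, (mode n y : ℂ) * f (x, y)‖ ^ 2) (fun _ _ => by positivity)
    (Finset.self_mem_range_succ n)).trans h

/-- Bessel's inequality on almost every slice, integrated over (-r,r), bounds all partial sums by
the square of the L² norm on Ω_r. -/
theorem MemL2Loc.summable_modalCoeff {f : ℝ × ℝ → ℂ} (hf : MemL2Loc f) {r : ℝ}
    (hr : 0 < r) : Summable fun n => ∫ x in Set.Ioo (-r) r, ‖modalCoeff f n x‖ ^ 2 := by
  refine summable_of_sum_range_le (c := ∫ p in truncStrip r, ‖f p‖ ^ 2)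
    (fun n => integral_nonneg fun _ => by positivity) fun N => ?_
  have h2 := integrable_norm_sq (hf r hr)
  rw [restrict_truncStrip] at h2 ⊢
  have hi := fun n => integrable_norm_sq (hf.memLp_modalCoeff n hr)
  rw [integral_prod _ h2, ← integral_finsetSum _ fun n _ => hi n]
  refine integral_mono_ae (integrable_finsetSum _ fun n _ => hi n) h2.integral_prod_left ?_
  filter_upwards [ae_restrict_of_ae hf.ae_memLp] with x hx
  exact sum_norm_sq_integral_mode_mul_le hx N

theorem memL2Loc_mul {c : ℝ → ℂ} {b : ℝ → ℝ}
    (hc : ∀ r : ℝ, 0 < r → MemLp c 2 (volume.restrict (Set.Ioo (-r) r)))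
    (hb : Continuous b) {C : ℝ} (hC : ∀ y, |b y| ≤ C) :
    MemL2Loc (fun p => c p.1 * (b p.2 : ℂ)) := by
  intro r hr
  rw [restrict_truncStrip]
  have h1 := (hc r hr).comp_fst (volume.restrict (Set.Ioo (0 : ℝ) 1))
  refine h1.of_le_mul (c := C) (h1.aestronglyMeasurable.mul (by fun_prop))
    (Eventually.of_forall fun p => ?_)
  rw [norm_mul, mul_comm, Complex.norm_real]
  exact mul_le_mul_of_nonneg_right (hC _) (norm_nonneg _)

/-- Limits in `L²(Ω_m)` glue to a limit in `L²_loc(Ω)`. -/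
theorem exists_tendstoL2Loc {S : ℕ → ℝ × ℝ → ℂ} (hS : ∀ N, MemL2Loc (S N))
    (h : ∀ r : ℝ, 0 < r → ∃ w : ℝ × ℝ → ℂ, MemLp w 2 (volume.restrict (truncStrip r)) ∧
      Tendsto (fun N => eLpNorm (fun p => w p - S N p) 2 (volume.restrict (truncStrip r)))
        atTop (𝓝 0)) : ∃ w, TendstoL2Loc S w := by
  have h' : ∀ m : ℕ, ∃ w : ℝ × ℝ → ℂ,
      MemLp w 2 (volume.restrict (truncStrip (m + 1 : ℝ))) ∧
      Tendsto (fun N => eLpNorm (fun p => w p - S N p) 2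
        (volume.restrict (truncStrip (m + 1 : ℝ)))) atTop (𝓝 0) :=
    fun m => h _ (by positivity)
  choose W hW hWt using h'
  have hmono : ∀ {r R : ℝ}, r ≤ R → (volume : Measure (ℝ × ℝ)).restrict (truncStrip r) ≤
      volume.restrict (truncStrip R) :=
    fun hrR => Measure.restrict_mono (truncStrip_mono hrR) le_rfl
  have hmonot : ∀ {r R : ℝ} (_ : r ≤ R) (w : ℝ × ℝ → ℂ),
      Tendsto (fun N => eLpNorm (fun p => w p - S N p) 2 (volume.restrict (truncStrip R)))
        atTop (𝓝 0) →
      Tendsto (fun N => eLpNorm (fun p => w p - S N p) 2 (volume.restrict (truncStrip r)))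
        atTop (𝓝 0) := fun hrR w hw =>
    tendsto_of_tendsto_of_tendsto_of_le_of_le tendsto_const_nhds hw (fun _ => zero_le)
      fun N => eLpNorm_mono_measure _ (hmono hrR)
  have hcompat : ∀ j m : ℕ, j ≤ m →
      ∀ᵐ p ∂(volume.restrict (truncStrip (j + 1 : ℝ))), W j p = W m p := by
    intro j m hjm
    have hjm' : (j + 1 : ℝ) ≤ m + 1 := by exact_mod_cast Nat.succ_le_succ hjm
    exact ae_eq_of_tendsto_eLpNorm
      (fun N => (hS N _ (by positivity)).aestronglyMeasurable) (hW j).aestronglyMeasurable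
      ((hW m).mono_measure (hmono hjm')).aestronglyMeasurable (hWt j) (hmonot hjm' _ (hWt m))
  -- Each point lies in the truncated strip numbered by the integer part of |x|, and the glued limit
  -- uses the limit found there. That index varies with the point, so the comparison is made for all
  -- j off one null set.
  have hw : ∀ m : ℕ, ∀ᵐ p ∂(volume.restrict (truncStrip (m + 1 : ℝ))),
      W m p = W ⌊|p.1|⌋₊ p := by
    intro m
    have h1 : ∀ j : ℕ, ∀ᵐ p : ℝ × ℝ, j ≤ m → p ∈ truncStrip (j + 1 : ℝ) → W j p = W m p := by
      intro j
      by_cases hj : j ≤ m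
      · filter_upwards [(ae_restrict_iff' (measurableSet_truncStrip _)).1 (hcompat j m hj)]
          with p hp _ using hp
      · exact Eventually.of_forall fun p h => absurd h hj
    rw [ae_restrict_iff' (measurableSet_truncStrip _)]
    filter_upwards [ae_all_iff.2 h1] with p hp hpm
    rw [mem_truncStrip_iff] at hpm
    refine (hp _ ?_ (mem_truncStrip_iff.2 ⟨Nat.lt_floor_add_one _, hpm.2⟩)).symm
    have h2 : ⌊|p.1|⌋₊ < m + 1 := by
      rw [Nat.floor_lt (abs_nonneg _)]
      exact_mod_cast hpm.1
    omega
  have hall : ∀ r : ℝ, ∃ m : ℕ, r ≤ (m + 1 : ℝ) := fun r => by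
    obtain ⟨m, hm⟩ := exists_nat_gt r
    exact ⟨m, by linarith⟩
  refine ⟨fun p => W ⌊|p.1|⌋₊ p, hS, fun r _ => ?_, fun r _ => ?_⟩
  · obtain ⟨m, hm⟩ := hall r
    exact ((hW m).ae_eq (hw m)).mono_measure (hmono hm)
  · obtain ⟨m, hm⟩ := hall r
    refine hmonot hm _ ((hWt m).congr fun N => eLpNorm_congr_ae ?_)
    filter_upwards [hw m] with p hp
    rw [hp]

/-- A local Riesz–Fischer theorem for series `∑ c_n(x) b_n(y)` with `b_n` orthogonal. -/
theorem exists_tendstoL2Loc_series {c : ℕ → ℝ → ℂ} {b : ℕ → ℝ → ℝ}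
    (hc : ∀ n, ∀ r : ℝ, 0 < r → MemLp (c n) 2 (volume.restrict (Set.Ioo (-r) r)))
    (hb : ∀ n, Continuous (b n)) {C : ℝ} (hC : ∀ n y, |b n y| ≤ C)
    (horth : ∀ m n, m ≠ n → ∫ y in Set.Ioo (0 : ℝ) 1, b m y * b n y = 0)
    (hs : ∀ r : ℝ, 0 < r → Summable fun n => ∫ x in Set.Ioo (-r) r, ‖c n x‖ ^ 2) :
    ∃ w, TendstoL2Loc (fun N p => ∑ n ∈ Finset.range N, c n p.1 * (b n p.2 : ℂ)) w := by
  have hF := fun n => memL2Loc_mul (hc n) (hb n) (hC n)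
  refine exists_tendstoL2Loc (fun N => MemL2Loc.sum _ fun n _ => hF n) fun r hr => ?_
  have hFr := fun n => hF n r hr
  -- Fubini factors each inner product, and its y-factor is zero for distinct modes; this needs no
  -- orthogonality of the c_n.
  have hsum : Summable fun n => (hFr n).toLp _ := by
    refine summable_of_orthogonal (fun m n hmn => ?_) ?_
    · rw [inner_toLp_toLp]
      have e : ∀ p : ℝ × ℝ, c n p.1 * (b n p.2 : ℂ) *
          (starRingEnd ℂ) (c m p.1 * (b m p.2 : ℂ)) =
          (c n p.1 * (starRingEnd ℂ) (c m p.1)) * ((b m p.2 * b n p.2 : ℝ) : ℂ) := by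
        intro p
        rw [map_mul, Complex.conj_ofReal]
        push_cast
        ring
      simp_rw [e]
      rw [restrict_truncStrip, integral_prod_mul
        (fun x => c n x * (starRingEnd ℂ) (c m x)) fun y => ((b m y * b n y : ℝ) : ℂ),
        integral_complex_ofReal, horth m n hmn]
      simp
    · refine Summable.of_nonneg_of_le (fun n => by positivity) (fun n => ?_)
        ((hs r hr).mul_left (C ^ 2))
      rw [norm_sq_toLp]
      simp_rw [norm_mul, mul_pow]
      rw [restrict_truncStrip, integral_prod_mul (fun x => ‖c n x‖ ^ 2)
        fun y => ‖(b n y : ℂ)‖ ^ 2, mul_comm]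
      refine mul_le_mul_of_nonneg_right ?_ (integral_nonneg fun _ => by positivity)
      have h1 : ∫ y in Set.Ioo (0 : ℝ) 1, ‖(b n y : ℂ)‖ ^ 2 ≤
          ∫ y in Set.Ioo (0 : ℝ) 1, C ^ 2 := by
        refine integral_mono (integrableOn_Ioo_of_continuous ?_ _ _)
          (integrableOn_Ioo_of_continuous continuous_const _ _) fun y => ?_
        · have := hb n
          fun_prop
        · rw [Complex.norm_real]
          exact pow_le_pow_left₀ (norm_nonneg _) (hC n y) 2
      simpa using h1
  obtain ⟨f, hf⟩ := hsum
  have hfm := Lp.memLp f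
  refine ⟨f, hfm, ?_⟩
  have h1 := hf.tendsto_sum_nat
  rw [tendsto_iff_norm_sub_tendsto_zero] at h1
  have h2 := ENNReal.tendsto_ofReal h1
  rw [ENNReal.ofReal_zero] at h2
  refine h2.congr fun N => ?_
  rw [norm_sub_rev, ofReal_norm, Lp.enorm_def]
  refine eLpNorm_congr_ae ?_
  have h4 : ∀ᵐ p ∂(volume.restrict (truncStrip r)), ∀ n,
      (hFr n).toLp _ p = c n p.1 * (b n p.2 : ℂ) := ae_all_iff.2 fun n => (hFr n).coeFn_toLp
  have h5 := Lp.coeFn_sub f (∑ n ∈ Finset.range N, (hFr n).toLp _)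
  have h6 := Lp.coeFn_finsetSum (Finset.range N) fun n => (hFr n).toLp _
  filter_upwards [h4, h5, h6] with p h4 h5 h6
  rw [h5, Pi.sub_apply, h6]
  simp [h4]

/-! ### The outgoing solution on the line -/

/-- The outgoing kernel `exp(iκ|t|)`. -/
noncomputable def waveKernel (κ : ℂ) (t : ℝ) : ℂ := Complex.exp (Complex.I * κ * (|t| : ℝ))

/-- `sgn(t) exp(iκ|t|)`. -/
noncomputable def signedWaveKernel (κ : ℂ) (t : ℝ) : ℂ :=
  if 0 < t then Complex.exp (Complex.I * κ * t) else -Complex.exp (-(Complex.I * κ * t))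

theorem waveKernel_of_nonneg (κ : ℂ) {t : ℝ} (ht : 0 ≤ t) :
    waveKernel κ t = Complex.exp (Complex.I * κ * t) := by
  rw [waveKernel, abs_of_nonneg ht]

theorem waveKernel_of_nonpos (κ : ℂ) {t : ℝ} (ht : t ≤ 0) :
    waveKernel κ t = Complex.exp (-(Complex.I * κ * t)) := by
  rw [waveKernel, abs_of_nonpos ht]
  congr 1
  push_cast
  ring

theorem signedWaveKernel_of_pos (κ : ℂ) {t : ℝ} (ht : 0 < t) :
    signedWaveKernel κ t = waveKernel κ t := by
  rw [waveKernel_of_nonneg κ ht.le, signedWaveKernel, if_pos ht]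

theorem signedWaveKernel_of_nonpos (κ : ℂ) {t : ℝ} (ht : t ≤ 0) :
    signedWaveKernel κ t = -waveKernel κ t := by
  rw [waveKernel_of_nonpos κ ht, signedWaveKernel, if_neg (not_lt.2 ht)]

theorem norm_waveKernel (κ : ℂ) (t : ℝ) : ‖waveKernel κ t‖ = Real.exp (-(κ.im * |t|)) := by
  rw [waveKernel, Complex.norm_exp]
  congr 1
  simp

theorem norm_signedWaveKernel (κ : ℂ) (t : ℝ) :
    ‖signedWaveKernel κ t‖ = Real.exp (-(κ.im * |t|)) := by
  rcases lt_or_ge 0 t with h | h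
  · rw [signedWaveKernel_of_pos κ h, norm_waveKernel]
  · rw [signedWaveKernel_of_nonpos κ h, norm_neg, norm_waveKernel]

theorem exp_neg_mul_abs_le_one {q : ℝ} (hq : 0 ≤ q) (t : ℝ) : Real.exp (-(q * |t|)) ≤ 1 := by
  rw [Real.exp_le_one_iff, neg_nonpos]
  positivity

theorem continuous_waveKernel (κ : ℂ) : Continuous (waveKernel κ) := by
  unfold waveKernel
  fun_prop

theorem measurable_signedWaveKernel (κ : ℂ) : Measurable (signedWaveKernel κ) := by
  unfold signedWaveKernel
  exact Measurable.ite measurableSet_Ioi (by fun_prop) (by fun_prop)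

theorem hasDerivAt_waveKernel (κ : ℂ) {t : ℝ} (ht : t ≠ 0) :
    HasDerivAt (waveKernel κ) (Complex.I * κ * signedWaveKernel κ t) t := by
  have h1 : HasDerivAt (fun t : ℝ => Complex.I * κ * (t : ℂ)) (Complex.I * κ) t := by
    simpa using (Complex.ofRealCLM.hasDerivAt (x := t)).const_mul (Complex.I * κ)
  rcases lt_or_gt_of_ne ht with h | h
  · have h2 := h1.neg.cexp
    refine (h2.congr_of_eventuallyEq ?_).congr_deriv ?_
    · filter_upwards [Iio_mem_nhds h] with t ht
      exact waveKernel_of_nonpos κ (le_of_lt ht)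
    · rw [signedWaveKernel, if_neg (not_lt.2 h.le)]
      simp only [Pi.neg_apply]
      ring
  · have h2 := h1.cexp
    refine (h2.congr_of_eventuallyEq ?_).congr_deriv ?_
    · filter_upwards [Ioi_mem_nhds h] with t ht
      exact waveKernel_of_nonneg κ (le_of_lt ht)
    · rw [signedWaveKernel, if_pos h]
      ring

theorem continuousAt_signedWaveKernel (κ : ℂ) {t : ℝ} (ht : t ≠ 0) :
    ContinuousAt (signedWaveKernel κ) t := by
  have hc := (continuous_waveKernel κ).continuousAt (x := t)
  rcases lt_or_gt_of_ne ht with h | h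
  · refine hc.neg.congr ?_
    filter_upwards [Iio_mem_nhds h] with t ht
    exact (signedWaveKernel_of_nonpos κ (le_of_lt ht)).symm
  · refine hc.congr ?_
    filter_upwards [Ioi_mem_nhds h] with t ht
    exact (signedWaveKernel_of_pos κ ht).symm

/-- For t ≥ 0 the derivative of exp(iκt) is bounded by |κ|, because Im κ ≥ 0; the kernel is this
function of |t|, and the absolute value is 1-Lipschitz. -/
theorem norm_waveKernel_sub_le {κ : ℂ} (hκ : 0 ≤ κ.im) (s t : ℝ) :
    ‖waveKernel κ s - waveKernel κ t‖ ≤ ‖κ‖ * |s - t| := by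
  have key : ∀ x ∈ Set.Ici (0 : ℝ), ∀ y ∈ Set.Ici (0 : ℝ),
      ‖Complex.exp (Complex.I * κ * y) - Complex.exp (Complex.I * κ * x)‖ ≤ ‖κ‖ * ‖y - x‖ := by
    intro x hx y hy
    refine (convex_Ici (0 : ℝ)).norm_image_sub_le_of_norm_hasDerivWithin_le
      (f := fun t : ℝ => Complex.exp (Complex.I * κ * t))
      (f' := fun t : ℝ => Complex.exp (Complex.I * κ * t) * (Complex.I * κ))
      (fun t _ => HasDerivAt.hasDerivWithinAt (HasDerivAt.cexp ?_)) (fun t ht => ?_) hx hy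
    · simpa using (Complex.ofRealCLM.hasDerivAt (x := t)).const_mul (Complex.I * κ)
    · rw [← waveKernel_of_nonneg κ ht, norm_mul, norm_waveKernel, norm_mul, Complex.norm_I,
        one_mul]
      exact mul_le_of_le_one_left (norm_nonneg _) (exp_neg_mul_abs_le_one hκ t)
  have h := key |t| (abs_nonneg t) |s| (abs_nonneg s)
  refine h.trans (mul_le_mul_of_nonneg_left ?_ (norm_nonneg _))
  rw [Real.norm_eq_abs]
  exact abs_abs_sub_abs_le_abs_sub s t

/-- The outgoing solution of `U'' + κ² U = -g` on the line. -/
noncomputable def outgoingSol (κ : ℂ) (g : ℝ → ℂ) (x : ℝ) : ℂ :=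
  Complex.I / (2 * κ) * ∫ z, g z * waveKernel κ (x - z)

/-- The derivative of `outgoingSol`. -/
noncomputable def outgoingSolDeriv (κ : ℂ) (g : ℝ → ℂ) (x : ℝ) : ℂ :=
  -(1 / 2) * ∫ z, g z * signedWaveKernel κ (x - z)

section

variable {κ : ℂ} {g : ℝ → ℂ}

theorem integrable_mul_kernel {M : ℝ → ℂ} (hM : Measurable M) (hMb : ∀ t, ‖M t‖ ≤ 1)
    (hg : Integrable g) (x : ℝ) : Integrable fun z => g z * M (x - z) :=
  hg.mul_bdd (c := 1) (hM.comp (measurable_const.sub measurable_id)).aestronglyMeasurable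
    (Eventually.of_forall fun _ => hMb _)

theorem norm_waveKernel_le_one (hκ : 0 ≤ κ.im) (t : ℝ) : ‖waveKernel κ t‖ ≤ 1 := by
  rw [norm_waveKernel]; exact exp_neg_mul_abs_le_one hκ t

theorem norm_signedWaveKernel_le_one (hκ : 0 ≤ κ.im) (t : ℝ) : ‖signedWaveKernel κ t‖ ≤ 1 := by
  rw [norm_signedWaveKernel]; exact exp_neg_mul_abs_le_one hκ t

theorem integrable_mul_waveKernel (hκ : 0 ≤ κ.im) (hg : Integrable g) (x : ℝ) :
    Integrable fun z => g z * waveKernel κ (x - z) :=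
  integrable_mul_kernel (continuous_waveKernel κ).measurable (norm_waveKernel_le_one hκ) hg x

theorem integrable_mul_signedWaveKernel (hκ : 0 ≤ κ.im) (hg : Integrable g) (x : ℝ) :
    Integrable fun z => g z * signedWaveKernel κ (x - z) :=
  integrable_mul_kernel (measurable_signedWaveKernel κ) (norm_signedWaveKernel_le_one hκ) hg x

theorem ae_ne_real (x : ℝ) : ∀ᵐ z : ℝ, x - z ≠ 0 := by
  filter_upwards [compl_mem_ae_iff.2 (measure_singleton (μ := (volume : Measure ℝ)) x)] with z hz
  exact fun h => hz (sub_eq_zero.1 h).symm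

/-- The kernel has a corner at z = x, a null set, and is globally Lipschitz, so dominated
differentiation applies with g merely in L¹. The prefactor -1/2 is (i / 2κ) · iκ. -/
theorem hasDerivAt_outgoingSol (hκ0 : κ ≠ 0) (hκ : 0 ≤ κ.im) (hg : Integrable g) (x : ℝ) :
    HasDerivAt (outgoingSol κ g) (outgoingSolDeriv κ g x) x := by
  have h := (hasDerivAt_integral_of_dominated_loc_of_lip (μ := volume) (𝕜 := ℝ)
    (F := fun x z => g z * waveKernel κ (x - z))
    (F' := fun z => g z * (Complex.I * κ * signedWaveKernel κ (x - z))) (s := Set.univ)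
    (bound := fun z => ‖g z‖ * ‖κ‖) (x₀ := x) univ_mem
    (Eventually.of_forall fun y => (integrable_mul_waveKernel hκ hg y).aestronglyMeasurable)
    (integrable_mul_waveKernel hκ hg x) ?_ ?_ (hg.norm.mul_const _) ?_).2
  · have h2 := h.const_mul (Complex.I / (2 * κ))
    refine h2.congr_deriv ?_
    rw [outgoingSolDeriv]
    have e : ∀ z, g z * (Complex.I * κ * signedWaveKernel κ (x - z)) =
        (Complex.I * κ) * (g z * signedWaveKernel κ (x - z)) := fun z => by ring
    simp_rw [e]
    rw [integral_const_mul, ← mul_assoc]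
    congr 1
    field_simp
    rw [Complex.I_sq]
  · refine hg.aestronglyMeasurable.mul (Measurable.aestronglyMeasurable ?_)
    exact ((measurable_signedWaveKernel κ).comp (measurable_const.sub measurable_id)).const_mul _
  · refine Eventually.of_forall fun z => LipschitzOnWith.of_dist_le_mul fun a _ b _ => ?_
    rw [dist_eq_norm, ← mul_sub, norm_mul, Real.coe_nnabs, abs_of_nonneg (by positivity),
      mul_assoc]
    refine mul_le_mul_of_nonneg_left ?_ (norm_nonneg _)
    have := norm_waveKernel_sub_le hκ (a - z) (b - z)
    rwa [sub_sub_sub_cancel_right] at this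
  · filter_upwards [ae_ne_real x] with z hz
    exact ((hasDerivAt_waveKernel κ hz).comp_sub_const x z).const_mul (g z)

/-- The jump of the signed kernel affects only z = x, which dominated convergence ignores. -/
theorem continuous_outgoingSolDeriv (hκ : 0 ≤ κ.im) (hg : Integrable g) :
    Continuous (outgoingSolDeriv κ g) := by
  rw [continuous_iff_continuousAt]
  intro x
  refine continuousAt_const.mul (continuousAt_of_dominated (bound := fun z => ‖g z‖)
    (Eventually.of_forall fun y =>
      (integrable_mul_signedWaveKernel hκ hg y).aestronglyMeasurable)
    (Eventually.of_forall fun y => Eventually.of_forall fun z => ?_) hg.norm ?_)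
  · rw [norm_mul]
    exact mul_le_of_le_one_right (norm_nonneg _) (norm_signedWaveKernel_le_one hκ _)
  · filter_upwards [ae_ne_real x] with z hz
    exact continuousAt_const.mul (ContinuousAt.comp (f := fun y : ℝ => y - z) (x := x)
      (continuousAt_signedWaveKernel κ hz) (by fun_prop))

theorem contDiff_outgoingSol (hκ0 : κ ≠ 0) (hκ : 0 ≤ κ.im) (hg : Integrable g) :
    ContDiff ℝ 1 (outgoingSol κ g) := by
  rw [contDiff_one_iff_deriv]
  refine ⟨fun x => (hasDerivAt_outgoingSol hκ0 hκ hg x).differentiableAt, ?_⟩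
  have : deriv (outgoingSol κ g) = outgoingSolDeriv κ g :=
    funext fun x => (hasDerivAt_outgoingSol hκ0 hκ hg x).deriv
  rw [this]
  exact continuous_outgoingSolDeriv hκ hg

/-- The two kernels coincide for z < x, so only the sources to the right of x remain. The companion
identity for the left end has the opposite sign and keeps the sources to the left. -/
theorem outgoingSolDeriv_sub (hκ0 : κ ≠ 0) (hκ : 0 ≤ κ.im) (hg : Integrable g) (x : ℝ) :
    outgoingSolDeriv κ g x - Complex.I * κ * outgoingSol κ g x =
      (1 / 2) * ∫ z, g z * (waveKernel κ (x - z) - signedWaveKernel κ (x - z)) := by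
  simp_rw [mul_sub]
  rw [integral_sub (integrable_mul_waveKernel hκ hg x) (integrable_mul_signedWaveKernel hκ hg x),
    outgoingSolDeriv, outgoingSol]
  field_simp
  rw [Complex.I_sq]
  ring

theorem outgoingSolDeriv_add (hκ0 : κ ≠ 0) (hκ : 0 ≤ κ.im) (hg : Integrable g) (x : ℝ) :
    -outgoingSolDeriv κ g x - Complex.I * κ * outgoingSol κ g x =
      (1 / 2) * ∫ z, g z * (waveKernel κ (x - z) + signedWaveKernel κ (x - z)) := by
  simp_rw [mul_add]
  rw [integral_add (integrable_mul_waveKernel hκ hg x) (integrable_mul_signedWaveKernel hκ hg x),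
    outgoingSolDeriv, outgoingSol]
  field_simp
  rw [Complex.I_sq]
  ring

/-- For each fixed source point the kernel is eventually zero, and g dominates. Decay of the kernel
plays no role, so propagating modes with real κ are included. -/
theorem tendsto_integral_kernel_zero {M : ℝ → ℂ} (hM : Measurable M) (hMb : ∀ t, ‖M t‖ ≤ 2)
    (hg : Integrable g) {l : Filter ℝ} [l.IsCountablyGenerated]
    (h : ∀ z, ∀ᶠ x in l, M (x - z) = 0) :
    Tendsto (fun x => (1 / 2 : ℂ) * ∫ z, g z * M (x - z)) l (𝓝 0) := by
  have h1 := tendsto_integral_filter_of_dominated_convergence (μ := volume) (l := l)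
    (F := fun x z => g z * M (x - z)) (f := fun _ => (0 : ℂ)) (fun z => ‖g z‖ * 2)
    (Eventually.of_forall fun x => hg.aestronglyMeasurable.mul
      (hM.comp (measurable_const.sub measurable_id)).aestronglyMeasurable)
    (Eventually.of_forall fun x => Eventually.of_forall fun z => ?_) (hg.norm.mul_const 2)
    (Eventually.of_forall fun z => ?_)
  · simpa using h1.const_mul (1 / 2 : ℂ)
  · rw [norm_mul]
    exact mul_le_mul_of_nonneg_left (hMb _) (norm_nonneg _)
  · refine tendsto_const_nhds.congr' ?_
    filter_upwards [h z] with x hx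
    rw [hx, mul_zero]

/-- The filter |x| → ∞ is the supremum of those at the two ends, and x/|x| is eventually +1 or -1
there. -/
theorem tendsto_radiation_iff {c d : ℝ → ℂ} :
    Tendsto (fun x : ℝ => ‖d x * ((x / |x| : ℝ) : ℂ) - Complex.I * κ * c x‖)
      (comap (fun x : ℝ => |x|) atTop) (𝓝 0) ↔
    Tendsto (fun x => d x - Complex.I * κ * c x) atTop (𝓝 0) ∧
      Tendsto (fun x => -d x - Complex.I * κ * c x) atBot (𝓝 0) := by
  rw [comap_abs_atTop, tendsto_sup, ← tendsto_zero_iff_norm_tendsto_zero,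
    ← tendsto_zero_iff_norm_tendsto_zero, and_comm]
  refine and_congr (tendsto_congr' ?_) (tendsto_congr' ?_)
  · filter_upwards [eventually_gt_atTop 0] with x hx
    rw [abs_of_pos hx, div_self hx.ne']
    simp
  · filter_upwards [eventually_lt_atBot 0] with x hx
    rw [abs_of_neg hx, div_neg, div_self hx.ne]
    simp

theorem tendsto_radiation_outgoingSol (hκ0 : κ ≠ 0) (hκ : 0 ≤ κ.im) (hg : Integrable g) :
    Tendsto (fun x : ℝ => ‖outgoingSolDeriv κ g x * ((x / |x| : ℝ) : ℂ) -
      Complex.I * κ * outgoingSol κ g x‖) (comap (fun x : ℝ => |x|) atTop) (𝓝 0) := by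
  rw [tendsto_radiation_iff]
  simp_rw [outgoingSolDeriv_sub hκ0 hκ hg, outgoingSolDeriv_add hκ0 hκ hg]
  have hm1 := (continuous_waveKernel κ).measurable
  have hm2 := measurable_signedWaveKernel κ
  have hb1 := norm_waveKernel_le_one hκ
  have hb2 := norm_signedWaveKernel_le_one hκ
  refine ⟨tendsto_integral_kernel_zero (M := fun t => waveKernel κ t - signedWaveKernel κ t)
    (hm1.sub hm2) (fun t => (norm_sub_le _ _).trans ?_) hg fun z => ?_,
    tendsto_integral_kernel_zero (M := fun t => waveKernel κ t + signedWaveKernel κ t)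
    (hm1.add hm2) (fun t => (norm_add_le _ _).trans ?_) hg fun z => ?_⟩
  · linarith [hb1 t, hb2 t]
  · filter_upwards [eventually_gt_atTop z] with x hx
    rw [signedWaveKernel_of_pos κ (sub_pos.2 hx), sub_self]
  · linarith [hb1 t, hb2 t]
  · filter_upwards [eventually_le_atBot z] with x hx
    rw [signedWaveKernel_of_nonpos κ (sub_nonpos.2 hx), add_neg_cancel]

end

/-! ### Weak derivatives on the line -/

/-- `d` is the weak derivative of `c` on the line. -/
def HasWeakDeriv1 (c d : ℝ → ℂ) : Prop :=
  ∀ χ : ℝ → ℝ, ContDiff ℝ ∞ χ → HasCompactSupport χ →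
    ∫ x, ((deriv χ x : ℝ) : ℂ) * c x = -∫ x, (χ x : ℂ) * d x

theorem integral_test_kernel_swap {g : ℝ → ℂ} (hg : Integrable g) {χ : ℝ → ℝ}
    (hχ : Continuous χ) (hs : HasCompactSupport χ) {M : ℝ → ℂ} (hM : Measurable M)
    (hMb : ∀ t, ‖M t‖ ≤ 1) :
    ∫ x, (χ x : ℂ) * ∫ z, g z * M (x - z) = ∫ z, g z * ∫ x, (χ x : ℂ) * M (x - z) := by
  have hi : Integrable (Function.uncurry fun x z => (χ x : ℂ) * (g z * M (x - z)))
      ((volume : Measure ℝ).prod volume) := by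
    have h1 : Integrable (fun x => (χ x : ℂ)) := (hχ.integrable_of_hasCompactSupport hs).ofReal
    have h2 := (h1.mul_prod hg).mul_bdd (c := 1) (g := fun p : ℝ × ℝ => M (p.1 - p.2))
      (hM.comp (measurable_fst.sub measurable_snd)).aestronglyMeasurable
      (Eventually.of_forall fun _ => hMb _)
    refine h2.congr (Eventually.of_forall fun p => ?_)
    simp only [Function.uncurry]
    ring
  have h := integral_integral_swap hi
  simp_rw [integral_const_mul] at h
  rw [h]
  refine integral_congr_ae (Eventually.of_forall fun z => ?_)
  simp only
  rw [← integral_const_mul]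
  refine integral_congr_ae (Eventually.of_forall fun x => ?_)
  simp only
  ring

theorem hasDerivAt_ofReal_test {χ : ℝ → ℝ} (hχ : ContDiff ℝ ∞ χ) (x : ℝ) :
    HasDerivAt (fun x => (χ x : ℂ)) ((deriv χ x : ℝ) : ℂ) x :=
  ((hχ.differentiable (by simp)) x).hasDerivAt.ofReal_comp

/-- This is (sgn(t) exp(iκ|t|))' = 2δ + iκ exp(iκ|t|) in the sense of distributions. Integration by
parts on the half-lines on either side of z gives one boundary term χ(z) from each. -/
theorem integral_deriv_mul_signedWaveKernel {κ : ℂ} {χ : ℝ → ℝ} (hχ : ContDiff ℝ ∞ χ)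
    (hs : HasCompactSupport χ) (z : ℝ) :
    ∫ x, ((deriv χ x : ℝ) : ℂ) * signedWaveKernel κ (x - z) =
      -2 * χ z - Complex.I * κ * ∫ x, (χ x : ℂ) * waveKernel κ (x - z) := by
  have hχc := hχ.continuous
  have hdc : Continuous (deriv χ) := hχ.continuous_deriv (by simp)
  have hd : HasCompactSupport (deriv χ) := hs.deriv
  have hexp : ∀ a : ℂ, ContDiff ℝ ∞ fun x : ℝ => Complex.exp (a * ((x - z : ℝ) : ℂ)) := by
    intro a
    exact Complex.contDiff_exp.comp (contDiff_const.mul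
      (Complex.ofRealCLM.contDiff.comp (contDiff_id.sub contDiff_const)))
  have hexpd : ∀ (a : ℂ) (x : ℝ), HasDerivAt (fun x : ℝ => Complex.exp (a * ((x - z : ℝ) : ℂ)))
      (Complex.exp (a * ((x - z : ℝ) : ℂ)) * a) x := by
    intro a x
    have h1 : HasDerivAt (fun x : ℝ => ((x - z : ℝ) : ℂ)) 1 x := by
      simpa using ((hasDerivAt_id x).sub_const z).ofReal_comp
    simpa using (h1.const_mul a).cexp
  have hF : ∀ a : ℂ, ContDiff ℝ 1 fun x : ℝ => (χ x : ℂ) * Complex.exp (a * ((x - z : ℝ) : ℂ)) :=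
    fun a => ((Complex.ofRealCLM.contDiff.comp hχ).mul (hexp a)).of_le (by simp)
  have hFd : ∀ a : ℂ, deriv (fun x : ℝ => (χ x : ℂ) * Complex.exp (a * ((x - z : ℝ) : ℂ))) =
      fun x : ℝ => ((deriv χ x : ℝ) : ℂ) * Complex.exp (a * ((x - z : ℝ) : ℂ)) +
        a * ((χ x : ℂ) * Complex.exp (a * ((x - z : ℝ) : ℂ))) := by
    intro a
    ext x
    refine (((hasDerivAt_ofReal_test hχ x).mul (hexpd a x)).congr_deriv ?_).deriv
    ring
  have hχs : HasCompactSupport fun x => (χ x : ℂ) := hs.comp_left Complex.ofReal_zero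
  have hds : HasCompactSupport fun x => ((deriv χ x : ℝ) : ℂ) := hd.comp_left Complex.ofReal_zero
  have hFs : ∀ a : ℂ, HasCompactSupport
      fun x : ℝ => (χ x : ℂ) * Complex.exp (a * ((x - z : ℝ) : ℂ)) := fun a => hχs.mul_right
  have i1 : ∀ a : ℂ, Integrable
      fun x : ℝ => (χ x : ℂ) * Complex.exp (a * ((x - z : ℝ) : ℂ)) :=
    fun a => (hF a).continuous.integrable_of_hasCompactSupport (hFs a)
  have i2 : ∀ a : ℂ, Integrable
      fun x : ℝ => ((deriv χ x : ℝ) : ℂ) * Complex.exp (a * ((x - z : ℝ) : ℂ)) := fun a =>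
    Continuous.integrable_of_hasCompactSupport
      ((Complex.continuous_ofReal.comp hdc).mul (hexp a).continuous) hds.mul_right
  have hr := (hFs (Complex.I * κ)).integral_Ioi_deriv_eq (hF _) z
  have hl := (hFs (-(Complex.I * κ))).integral_Iic_deriv_eq (hF _) z
  rw [hFd, integral_add (i2 _).integrableOn ((i1 _).const_mul _).integrableOn,
    integral_const_mul] at hr hl
  simp only [sub_self, Complex.ofReal_zero, mul_zero, Complex.exp_zero, mul_one] at hr hl
  have j1 : Integrable fun x => ((deriv χ x : ℝ) : ℂ) * signedWaveKernel κ (x - z) := by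
    rw [← integrableOn_univ, ← Set.Iic_union_Ioi (a := z)]
    refine IntegrableOn.union ?_ ?_
    · refine ((i2 (-(Complex.I * κ))).neg.integrableOn).congr_fun (fun x hx => ?_)
        measurableSet_Iic
      rw [signedWaveKernel_of_nonpos κ (sub_nonpos.2 hx), waveKernel_of_nonpos κ (sub_nonpos.2 hx)]
      simp
    · refine ((i2 (Complex.I * κ)).integrableOn).congr_fun (fun x hx => ?_) measurableSet_Ioi
      simp only
      rw [signedWaveKernel_of_pos κ (sub_pos.2 hx), waveKernel_of_nonneg κ (sub_pos.2 hx).le]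
  have j2 : Integrable fun x => (χ x : ℂ) * waveKernel κ (x - z) :=
    Continuous.integrable_of_hasCompactSupport ((Complex.continuous_ofReal.comp hχc).mul
      ((continuous_waveKernel κ).comp (continuous_id.sub continuous_const))) hχs.mul_right
  rw [← intervalIntegral.integral_Iic_add_Ioi j1.integrableOn j1.integrableOn (b := z),
    ← intervalIntegral.integral_Iic_add_Ioi j2.integrableOn j2.integrableOn (b := z)]
  have e1 : ∫ x in Set.Iic z, ((deriv χ x : ℝ) : ℂ) * signedWaveKernel κ (x - z) =
      -∫ x in Set.Iic z, ((deriv χ x : ℝ) : ℂ) *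
        Complex.exp (-(Complex.I * κ) * ((x - z : ℝ) : ℂ)) := by
    rw [← integral_neg]
    refine setIntegral_congr_fun measurableSet_Iic fun x hx => ?_
    rw [signedWaveKernel_of_nonpos κ (sub_nonpos.2 hx), waveKernel_of_nonpos κ (sub_nonpos.2 hx)]
    simp
  have e2 : ∫ x in Set.Ioi z, ((deriv χ x : ℝ) : ℂ) * signedWaveKernel κ (x - z) =
      ∫ x in Set.Ioi z, ((deriv χ x : ℝ) : ℂ) *
        Complex.exp ((Complex.I * κ) * ((x - z : ℝ) : ℂ)) := by
    refine setIntegral_congr_fun measurableSet_Ioi fun x hx => ?_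
    rw [signedWaveKernel_of_pos κ (sub_pos.2 hx), waveKernel_of_nonneg κ (sub_pos.2 hx).le]
  have e3 : ∫ x in Set.Iic z, (χ x : ℂ) * waveKernel κ (x - z) =
      ∫ x in Set.Iic z, (χ x : ℂ) * Complex.exp (-(Complex.I * κ) * ((x - z : ℝ) : ℂ)) := by
    refine setIntegral_congr_fun measurableSet_Iic fun x hx => ?_
    rw [waveKernel_of_nonpos κ (sub_nonpos.2 hx)]
    simp
  have e4 : ∫ x in Set.Ioi z, (χ x : ℂ) * waveKernel κ (x - z) =
      ∫ x in Set.Ioi z, (χ x : ℂ) * Complex.exp ((Complex.I * κ) * ((x - z : ℝ) : ℂ)) := by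
    refine setIntegral_congr_fun measurableSet_Ioi fun x hx => ?_
    rw [waveKernel_of_nonneg κ (sub_pos.2 hx).le]
  rw [e1, e2, e3, e4]
  linear_combination hr - hl

/-- Fubini moves the test function onto the kernel. The delta of mass 2 there, with the prefactor
-1/2, produces the source -g; the smooth part reproduces -κ² times the solution. -/
theorem hasWeakDeriv1_outgoingSolDeriv {κ : ℂ} {g : ℝ → ℂ} (hκ0 : κ ≠ 0) (hκ : 0 ≤ κ.im)
    (hg : Integrable g) :
    HasWeakDeriv1 (outgoingSolDeriv κ g) (fun x => -κ ^ 2 * outgoingSol κ g x - g x) := by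
  intro χ hχ hs
  have hdc : Continuous (deriv χ) := hχ.continuous_deriv (by simp)
  have hb1 := norm_waveKernel_le_one hκ
  have hb2 := norm_signedWaveKernel_le_one hκ
  have e1 : ∀ x, ((deriv χ x : ℝ) : ℂ) * outgoingSolDeriv κ g x =
      -(1 / 2) * (((deriv χ x : ℝ) : ℂ) * ∫ z, g z * signedWaveKernel κ (x - z)) := fun x => by
    rw [outgoingSolDeriv]; ring
  simp_rw [e1]
  rw [integral_const_mul, integral_test_kernel_swap hg hdc hs.deriv
    (measurable_signedWaveKernel κ) hb2]
  simp_rw [integral_deriv_mul_signedWaveKernel hχ hs]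
  have hcont : Continuous (outgoingSol κ g) := (contDiff_outgoingSol hκ0 hκ hg).continuous
  have hχs : HasCompactSupport fun x => (χ x : ℂ) := hs.comp_left Complex.ofReal_zero
  have i1 : Integrable fun x => (χ x : ℂ) * outgoingSol κ g x :=
    Continuous.integrable_of_hasCompactSupport
      ((Complex.continuous_ofReal.comp hχ.continuous).mul hcont) hχs.mul_right
  have i2 : Integrable fun x => (χ x : ℂ) * g x :=
    integrable_ofReal_mul_of_locallyIntegrable hχ.continuous hs hg.locallyIntegrable
  have e2 : ∀ x, (χ x : ℂ) * (-κ ^ 2 * outgoingSol κ g x - g x) =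
      -κ ^ 2 * ((χ x : ℂ) * outgoingSol κ g x) - (χ x : ℂ) * g x := fun x => by ring
  simp_rw [e2]
  rw [integral_sub (i1.const_mul _) i2, integral_const_mul]
  have e3 : ∀ x, (χ x : ℂ) * outgoingSol κ g x =
      Complex.I / (2 * κ) * ((χ x : ℂ) * ∫ z, g z * waveKernel κ (x - z)) := fun x => by
    rw [outgoingSol]; ring
  simp_rw [e3]
  rw [integral_const_mul, integral_test_kernel_swap hg hχ.continuous hs
    (continuous_waveKernel κ).measurable hb1]
  obtain ⟨C, hC⟩ := hs.exists_bound_of_continuous hχ.continuous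
  have hχi : Integrable fun x => ‖(χ x : ℂ)‖ :=
    ((hχ.continuous.integrable_of_hasCompactSupport hs).ofReal (𝕜 := ℂ)).norm
  have i3 : Integrable fun z => g z * ∫ x, (χ x : ℂ) * waveKernel κ (x - z) := by
    refine hg.mul_bdd (c := ∫ x, ‖(χ x : ℂ)‖) ?_ (Eventually.of_forall fun z =>
      norm_integral_le_of_norm_le hχi (Eventually.of_forall fun x => ?_))
    · refine (Continuous.stronglyMeasurable ?_).integral_prod_left (f := fun x z : ℝ =>
        (χ x : ℂ) * waveKernel κ (x - z)) |>.aestronglyMeasurable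
      have := hχ.continuous
      have := continuous_waveKernel κ
      simp only [Function.uncurry_def]
      fun_prop
    · rw [norm_mul]
      exact mul_le_of_le_one_right (norm_nonneg _) (hb1 _)
  have e4 : ∀ z, g z * (-2 * (χ z : ℂ) -
      Complex.I * κ * ∫ x, (χ x : ℂ) * waveKernel κ (x - z)) =
      -2 * ((χ z : ℂ) * g z) -
        Complex.I * κ * (g z * ∫ x, (χ x : ℂ) * waveKernel κ (x - z)) := fun z => by ring
  simp_rw [e4]
  rw [integral_sub (i2.const_mul _) (i3.const_mul _), integral_const_mul, integral_const_mul]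
  field_simp
  ring

theorem hasWeakDeriv1_of_hasDerivAt {c d : ℝ → ℂ} (h : ∀ x, HasDerivAt c (d x) x)
    (hd : Continuous d) : HasWeakDeriv1 c d := by
  intro χ hχ hs
  have hc : Continuous c := continuous_iff_continuousAt.2 fun x => (h x).continuousAt
  have hχs : HasCompactSupport fun x => (χ x : ℂ) := hs.comp_left Complex.ofReal_zero
  have hds : HasCompactSupport fun x => ((deriv χ x : ℝ) : ℂ) :=
    hs.deriv.comp_left Complex.ofReal_zero
  have hdc : Continuous (deriv χ) := hχ.continuous_deriv (by simp)
  have i1 : Integrable fun x => ((deriv χ x : ℝ) : ℂ) * c x :=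
    Continuous.integrable_of_hasCompactSupport
      ((Complex.continuous_ofReal.comp hdc).mul hc) hds.mul_right
  have i2 : Integrable fun x => (χ x : ℂ) * d x :=
    Continuous.integrable_of_hasCompactSupport
      ((Complex.continuous_ofReal.comp hχ.continuous).mul hd) hχs.mul_right
  have i3 : Integrable fun x => (χ x : ℂ) * c x :=
    Continuous.integrable_of_hasCompactSupport
      ((Complex.continuous_ofReal.comp hχ.continuous).mul hc) hχs.mul_right
  have h2 := integral_eq_zero_of_hasDerivAt_of_integrable
    (fun x => (hasDerivAt_ofReal_test hχ x).mul (h x)) (i1.add i2) i3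
  have h3 := integral_add i1 i2
  rw [eq_neg_iff_add_eq_zero, ← h3]
  exact h2

/-! ### Local L² estimates for evanescent modes -/

theorem integrable_exp_neg_mul_abs {q : ℝ} (hq : 0 < q) :
    Integrable fun t : ℝ => Real.exp (-(q * |t|)) := by
  rw [← integrableOn_univ, ← Set.Iic_union_Ioi (a := (0 : ℝ))]
  refine IntegrableOn.union ?_ ?_
  · refine (integrableOn_exp_mul_Iic hq 0).congr_fun (fun x hx => ?_) measurableSet_Iic
    simp only [abs_of_nonpos (Set.mem_Iic.1 hx)]
    congr 1; ring
  · refine (integrableOn_exp_mul_Ioi (neg_neg_of_pos hq) 0).congr_fun (fun x hx => ?_)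
      measurableSet_Ioi
    simp only [abs_of_pos (Set.mem_Ioi.1 hx)]
    congr 1; ring

theorem integral_exp_neg_mul_abs {q : ℝ} (hq : 0 < q) :
    ∫ t : ℝ, Real.exp (-(q * |t|)) = 2 / q := by
  rw [integral_comp_abs (f := fun t => Real.exp (-(q * t)))]
  have h := integral_exp_mul_Ioi (neg_neg_of_pos hq) 0
  simp only [neg_mul] at h
  rw [h]
  simp
  ring

theorem integrable_exp_neg_mul_abs_sub {q : ℝ} (hq : 0 < q) (x : ℝ) :
    Integrable fun z : ℝ => Real.exp (-(q * |x - z|)) :=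
  (integrable_exp_neg_mul_abs hq).comp_sub_left x

theorem integral_exp_neg_mul_abs_sub {q : ℝ} (hq : 0 < q) (x : ℝ) :
    ∫ z : ℝ, Real.exp (-(q * |x - z|)) = 2 / q := by
  rw [integral_sub_left_eq_self (fun t => Real.exp (-(q * |t|))) volume x,
    integral_exp_neg_mul_abs hq]

theorem integral_exp_neg_mul_abs_sub' {q : ℝ} (hq : 0 < q) (z : ℝ) :
    ∫ x : ℝ, Real.exp (-(q * |x - z|)) = 2 / q := by
  simp_rw [abs_sub_comm _ z]
  exact integral_exp_neg_mul_abs_sub hq z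

/-- The Cauchy–Schwarz inequality with a weight of mass at most `A`. -/
theorem sq_integral_mul_le {α : Type*} [MeasurableSpace α] {μ : Measure α} {f w : α → ℝ} {A : ℝ}
    (hA : 0 < A) (hw : ∀ a, 0 ≤ w a) (hwi : Integrable w μ) (hwA : ∫ a, w a ∂μ ≤ A)
    (hfw : Integrable (fun a => f a * w a) μ) (hffw : Integrable (fun a => f a ^ 2 * w a) μ) :
    (∫ a, f a * w a ∂μ) ^ 2 ≤ A * ∫ a, f a ^ 2 * w a ∂μ := by
  set B := ∫ a, f a * w a ∂μ
  set D := ∫ a, f a ^ 2 * w a ∂μ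
  -- Expanding this square with centre B/A gives D - B²/A ≥ 0, where only an upper bound A for the
  -- mass of the weight is used.
  have h1 : 0 ≤ ∫ a, (f a - B / A) ^ 2 * w a ∂μ :=
    integral_nonneg fun a => mul_nonneg (sq_nonneg _) (hw a)
  have h2 : ∫ a, (f a - B / A) ^ 2 * w a ∂μ = D - 2 * (B / A) * B + (B / A) ^ 2 * ∫ a, w a ∂μ := by
    have e : ∀ a, (f a - B / A) ^ 2 * w a =
        f a ^ 2 * w a - 2 * (B / A) * (f a * w a) + (B / A) ^ 2 * w a := fun a => by ring
    simp_rw [e]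
    have i : Integrable (fun a => f a ^ 2 * w a - 2 * (B / A) * (f a * w a)) μ :=
      hffw.sub (hfw.const_mul _)
    rw [integral_add i (hwi.const_mul _),
      integral_sub hffw (hfw.const_mul _), integral_const_mul, integral_const_mul]
  have h3 : (B / A) ^ 2 * ∫ a, w a ∂μ ≤ (B / A) ^ 2 * A :=
    mul_le_mul_of_nonneg_left hwA (sq_nonneg _)
  have h4 : 0 ≤ D - 2 * (B / A) * B + (B / A) ^ 2 * A := by linarith
  have h5 : D - 2 * (B / A) * B + (B / A) ^ 2 * A = D - B ^ 2 / A := by field_simp; ring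
  rw [h5, sub_nonneg, div_le_iff₀ hA] at h4
  linarith

section

variable {g : ℝ → ℂ} {q r : ℝ}

theorem integrable_norm_mul_exp (hg : Integrable g) (hq : 0 < q) (x : ℝ) :
    Integrable fun z => ‖g z‖ * Real.exp (-(q * |x - z|)) := by
  refine hg.norm.mul_bdd (c := 1) (by fun_prop) (Eventually.of_forall fun z => ?_)
  rw [Real.norm_of_nonneg (Real.exp_nonneg _)]
  exact exp_neg_mul_abs_le_one hq.le _

theorem integrableOn_norm_sq_mul_exp {R : ℝ}
    (hg2 : MemLp g 2 (volume.restrict (Set.Ioo (-R) R))) (hq : 0 < q) (x : ℝ) :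
    IntegrableOn (fun z => ‖g z‖ ^ 2 * Real.exp (-(q * |x - z|))) (Set.Ioo (-R) R) := by
  refine (integrable_norm_sq hg2).mul_bdd (c := 1) (by fun_prop) (Eventually.of_forall fun z => ?_)
  rw [Real.norm_of_nonneg (Real.exp_nonneg _)]
  exact exp_neg_mul_abs_le_one hq.le _

/-- The sources are split at |z| = r + 1. Near ones are treated by Cauchy–Schwarz with kernel mass
2/q; far ones are at distance at least 1 from x, so their kernel is at most exp(-q). The remaining
factor 2 comes from (a + b)² ≤ 2a² + 2b². -/
theorem sq_integral_norm_mul_exp_le (hg : Integrable g)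
    (hg2 : MemLp g 2 (volume.restrict (Set.Ioo (-(r + 1)) (r + 1)))) (hq : 0 < q) {x : ℝ}
    (hx : |x| < r) :
    (∫ z, ‖g z‖ * Real.exp (-(q * |x - z|))) ^ 2 ≤
      4 / q * (∫ z in Set.Ioo (-(r + 1)) (r + 1), ‖g z‖ ^ 2 * Real.exp (-(q * |x - z|))) +
        2 * Real.exp (-(2 * q)) * (∫ z, ‖g z‖) ^ 2 := by
  have hi := integrable_norm_mul_exp hg hq x
  rw [← integral_add_compl (measurableSet_Ioo (a := -(r + 1)) (b := r + 1)) hi]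
  set J₁ := ∫ z in Set.Ioo (-(r + 1)) (r + 1), ‖g z‖ * Real.exp (-(q * |x - z|))
  set J₂ := ∫ z in (Set.Ioo (-(r + 1)) (r + 1))ᶜ, ‖g z‖ * Real.exp (-(q * |x - z|))
  have hJ₁ : J₁ ^ 2 ≤ 2 / q *
      ∫ z in Set.Ioo (-(r + 1)) (r + 1), ‖g z‖ ^ 2 * Real.exp (-(q * |x - z|)) := by
    refine sq_integral_mul_le (by positivity) (fun z => Real.exp_nonneg _)
      (integrable_exp_neg_mul_abs_sub hq x).integrableOn ?_ hi.integrableOn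
      (integrableOn_norm_sq_mul_exp hg2 hq x)
    rw [← integral_exp_neg_mul_abs_sub hq x]
    exact setIntegral_le_integral (integrable_exp_neg_mul_abs_sub hq x)
      (Eventually.of_forall fun z => Real.exp_nonneg _)
  have hJ₂0 : 0 ≤ J₂ := integral_nonneg fun z => by positivity
  have hJ₂ : J₂ ≤ Real.exp (-q) * ∫ z, ‖g z‖ := by
    have h1 : J₂ ≤ ∫ z in (Set.Ioo (-(r + 1)) (r + 1))ᶜ, Real.exp (-q) * ‖g z‖ := by
      refine setIntegral_mono_on hi.integrableOn (hg.norm.const_mul _).integrableOn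
        measurableSet_Ioo.compl fun z hz => ?_
      rw [mul_comm]
      refine mul_le_mul_of_nonneg_right (Real.exp_le_exp.2 ?_) (norm_nonneg _)
      have hz' : r + 1 ≤ |z| := by
        by_contra h
        exact hz (abs_lt.1 (not_le.1 h))
      have h2 : 1 ≤ |x - z| := by
        have := abs_sub_abs_le_abs_sub z x
        rw [abs_sub_comm] at this
        linarith
      nlinarith
    refine h1.trans ?_
    rw [← integral_const_mul]
    exact setIntegral_le_integral (hg.norm.const_mul _)
      (Eventually.of_forall fun z => by positivity)
  have hJ₂2 : J₂ ^ 2 ≤ Real.exp (-(2 * q)) * (∫ z, ‖g z‖) ^ 2 := by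
    have h := pow_le_pow_left₀ hJ₂0 hJ₂ 2
    have e : Real.exp (-q) ^ 2 = Real.exp (-(2 * q)) := by
      rw [← Real.exp_nat_mul]
      congr 1
      push_cast
      ring
    rwa [mul_pow, e] at h
  have h4 : 4 / q = 2 * (2 / q) := by ring
  rw [h4]
  nlinarith [sq_nonneg (J₁ - J₂)]

/-- Integrating the pointwise bound in x and exchanging the integrals gives a second kernel mass
2/q, hence 8/q². The far part is constant in x and picks up the length 2r. -/
theorem integral_norm_sq_le_of_norm_le (hr : 0 < r) (hg : Integrable g)
    (hg2 : MemLp g 2 (volume.restrict (Set.Ioo (-(r + 1)) (r + 1)))) (hq : 0 < q) {F : ℝ → ℂ}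
    {a : ℝ} (hF : ∀ x, ‖F x‖ ≤ a * ∫ z, ‖g z‖ * Real.exp (-(q * |x - z|))) :
    ∫ x in Set.Ioo (-r) r, ‖F x‖ ^ 2 ≤
      a ^ 2 * (8 / q ^ 2 * (∫ z in Set.Ioo (-(r + 1)) (r + 1), ‖g z‖ ^ 2) +
        4 * r * Real.exp (-(2 * q)) * (∫ z, ‖g z‖) ^ 2) := by
  set I := Set.Ioo (-(r + 1)) (r + 1)
  set D : ℝ → ℝ := fun x => ∫ z in I, ‖g z‖ ^ 2 * Real.exp (-(q * |x - z|))
  set K := 2 * Real.exp (-(2 * q)) * (∫ z, ‖g z‖) ^ 2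
  have hprod : Integrable (Function.uncurry fun (x z : ℝ) =>
      ‖g z‖ ^ 2 * Real.exp (-(q * |x - z|)))
      ((volume.restrict (Set.Ioo (-r) r)).prod (volume.restrict I)) := by
    have h1 := ((integrable_norm_sq hg2).comp_snd (volume.restrict (Set.Ioo (-r) r)))
    refine h1.mul_bdd (c := 1) (g := fun p : ℝ × ℝ => Real.exp (-(q * |p.1 - p.2|)))
      (by fun_prop) (Eventually.of_forall fun p => ?_)
    rw [Real.norm_of_nonneg (Real.exp_nonneg _)]
    exact exp_neg_mul_abs_le_one hq.le _
  have hD : Integrable D (volume.restrict (Set.Ioo (-r) r)) := hprod.integral_prod_left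
  have hDint : ∫ x in Set.Ioo (-r) r, D x ≤ 2 / q * ∫ z in I, ‖g z‖ ^ 2 := by
    rw [integral_integral_swap hprod, ← integral_const_mul]
    refine integral_mono hprod.integral_prod_right ((integrable_norm_sq hg2).const_mul _)
      fun z => ?_
    simp only
    rw [integral_const_mul, mul_comm]
    refine mul_le_mul_of_nonneg_right ?_ (by positivity)
    rw [← integral_exp_neg_mul_abs_sub' hq z]
    refine setIntegral_le_integral ?_ (Eventually.of_forall fun z => Real.exp_nonneg _)
    exact (integrable_exp_neg_mul_abs hq).comp_sub_right z
  have h1 : ∫ x in Set.Ioo (-r) r, ‖F x‖ ^ 2 ≤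
      ∫ x in Set.Ioo (-r) r, a ^ 2 * (4 / q * D x + K) := by
    refine integral_mono_of_nonneg (Eventually.of_forall fun x => by positivity)
      (((hD.const_mul _).add (integrable_const _)).const_mul _) ?_
    filter_upwards [ae_restrict_mem measurableSet_Ioo] with x hx
    have h2 := pow_le_pow_left₀ (norm_nonneg _) (hF x) 2
    rw [mul_pow] at h2
    exact h2.trans (mul_le_mul_of_nonneg_left
      (sq_integral_norm_mul_exp_le hg hg2 hq (abs_lt.2 hx)) (sq_nonneg _))
  refine h1.trans ?_
  rw [integral_const_mul]
  refine mul_le_mul_of_nonneg_left ?_ (sq_nonneg _)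
  rw [integral_add (hD.const_mul _) (integrable_const _), integral_const_mul]
  have h3 : ∫ _ in Set.Ioo (-r) r, K = 2 * r * K := by
    rw [setIntegral_const, Measure.real, Real.volume_Ioo, ENNReal.toReal_ofReal (by linarith)]
    rw [smul_eq_mul]; ring
  rw [h3]
  have h4 : 4 / q * ∫ x in Set.Ioo (-r) r, D x ≤ 4 / q * (2 / q * ∫ z in I, ‖g z‖ ^ 2) :=
    mul_le_mul_of_nonneg_left hDint (by positivity)
  have h5 : 4 / q * (2 / q * ∫ z in I, ‖g z‖ ^ 2) = 8 / q ^ 2 * ∫ z in I, ‖g z‖ ^ 2 := by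
    field_simp; ring
  have h6 : 2 * r * K = 4 * r * Real.exp (-(2 * q)) * (∫ z, ‖g z‖) ^ 2 := by
    simp only [K]; ring
  linarith

theorem norm_outgoingSol_le {κ : ℂ} (hκ : κ = Complex.I * q) (hq : 0 < q) (x : ℝ) :
    ‖outgoingSol κ g x‖ ≤ 1 / (2 * q) * ∫ z, ‖g z‖ * Real.exp (-(q * |x - z|)) := by
  have him : κ.im = q := by simp [hκ]
  rw [outgoingSol, norm_mul]
  refine mul_le_mul (le_of_eq ?_) ((norm_integral_le_integral_norm _).trans (le_of_eq ?_))
    (norm_nonneg _) (by positivity)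
  · simp [hκ, abs_of_pos hq]
  · simp_rw [norm_mul, norm_waveKernel, him]

theorem norm_outgoingSolDeriv_le {κ : ℂ} (hκ : κ = Complex.I * q) (x : ℝ) :
    ‖outgoingSolDeriv κ g x‖ ≤ 1 / 2 * ∫ z, ‖g z‖ * Real.exp (-(q * |x - z|)) := by
  have him : κ.im = q := by simp [hκ]
  rw [outgoingSolDeriv, norm_mul]
  refine mul_le_mul (le_of_eq ?_) ((norm_integral_le_integral_norm _).trans (le_of_eq ?_))
    (norm_nonneg _) (by positivity)
  · simp
  · simp_rw [norm_mul, norm_signedWaveKernel, him]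

end

/-! ### Wave numbers and summability of the modal series -/

theorem waveNumber_sq (k : ℝ) (n : ℕ) :
    waveNumber k n ^ 2 = (k : ℂ) ^ 2 - (n : ℂ) ^ 2 * (Real.pi : ℂ) ^ 2 :=
  ((waveNumber_eq_iff k n _).1 rfl).1

theorem waveNumber_im_nonneg (k : ℝ) (n : ℕ) : 0 ≤ (waveNumber k n).im :=
  ((waveNumber_eq_iff k n _).1 rfl).2.2

theorem waveNumber_ne_zero {k : ℝ} (hk : 0 < k) (hkn : ∀ n : ℕ, k ≠ n * Real.pi) (n : ℕ) :
    waveNumber k n ≠ 0 := by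
  intro h
  have h1 := waveNumber_sq k n
  rw [h, zero_pow two_ne_zero] at h1
  have h2 : k ^ 2 = (n * Real.pi) ^ 2 := by
    rw [mul_pow]
    exact_mod_cast (sub_eq_zero.1 h1.symm)
  exact hkn n ((pow_left_inj₀ hk.le (by positivity) two_ne_zero).1 h2)

theorem modalSolution_eq (k : ℝ) (s : ℝ × ℝ → ℂ) (n : ℕ) :
    modalSolution k s n = outgoingSol (waveNumber k n) (modalCoeff s n) := rfl

/-- Beyond the cut-off the wave numbers are imaginary and grow linearly. -/
theorem eventually_waveNumber (k : ℝ) :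
    ∀ᶠ n : ℕ in atTop, ∃ q : ℝ, 1 ≤ n ∧ (n : ℝ) ≤ q ∧ waveNumber k n = Complex.I * q := by
  obtain ⟨m, hm⟩ := exists_nat_ge |k|
  filter_upwards [eventually_ge_atTop (max m 1)] with n hn
  have h1 : 1 ≤ n := (le_max_right _ _).trans hn
  have h2 : |k| ≤ n := hm.trans (by exact_mod_cast (le_max_left _ _).trans hn)
  have h3 : k ^ 2 ≤ (n : ℝ) ^ 2 := by
    rw [← sq_abs k]
    exact pow_le_pow_left₀ (abs_nonneg _) h2 2
  -- Once n ≥ |k|, n²π² - k² ≥ 9n² - n² ≥ n², whence q ≥ n.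
  have h4 : 9 ≤ Real.pi ^ 2 := by nlinarith [Real.pi_gt_three]
  have h5 : (n : ℝ) ^ 2 ≤ n ^ 2 * Real.pi ^ 2 - k ^ 2 := by nlinarith [sq_nonneg (n : ℝ)]
  refine ⟨Real.sqrt (n ^ 2 * Real.pi ^ 2 - k ^ 2), h1, Real.le_sqrt_of_sq_le h5, ?_⟩
  rw [waveNumber, Real.sqrt_eq_zero_of_nonpos (by nlinarith [sq_nonneg (n : ℝ)])]
  simp

section Summability

variable {k : ℝ} {s : ℝ × ℝ → ℂ}

/-- With q ≥ n the loss n² is absorbed by 8/q² in the near part, leaving a Bessel sum. In the far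
part n² exp(-2n) is summable against the uniform L¹ bound M. -/
theorem summable_integral_norm_sq (hs1 : IntegrableOn s strip) (hs2 : MemL2Loc s)
    {F : ℕ → ℝ → ℂ} {C : ℝ}
    (hF : ∀ (n : ℕ) (q : ℝ), 1 ≤ n → (n : ℝ) ≤ q → waveNumber k n = Complex.I * q →
      ∀ x, ‖F n x‖ ≤ C * n * ∫ z, ‖modalCoeff s n z‖ * Real.exp (-(q * |x - z|)))
    {r : ℝ} (hr : 0 < r) : Summable fun n => ∫ x in Set.Ioo (-r) r, ‖F n x‖ ^ 2 := by
  set M := Real.sqrt 2 * ∫ p in strip, ‖s p‖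
  have hsum : Summable fun n : ℕ => C ^ 2 * 8 *
      (∫ z in Set.Ioo (-(r + 1)) (r + 1), ‖modalCoeff s n z‖ ^ 2) +
      C ^ 2 * (4 * r * M ^ 2) * ((n : ℝ) ^ 2 * Real.exp (-2 * n)) :=
    ((hs2.summable_modalCoeff (by positivity)).mul_left _).add
      ((Real.summable_pow_mul_exp_neg_nat_mul 2 two_pos).mul_left _)
  -- The finitely many remaining modes, including every propagating one, do not affect summability.
  refine hsum.of_norm_bounded_eventually_nat ?_
  filter_upwards [eventually_waveNumber k] with n hn
  obtain ⟨q, hn1, hnq, hκ⟩ := hn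
  have hn1' : (1 : ℝ) ≤ n := by exact_mod_cast hn1
  have hq : 0 < q := by linarith
  rw [Real.norm_of_nonneg (integral_nonneg fun _ => by positivity)]
  have h := integral_norm_sq_le_of_norm_le hr (integrable_modalCoeff hs1 n)
    (hs2.memLp_modalCoeff n (by positivity)) hq (hF n q hn1 hnq hκ)
  refine h.trans ?_
  set G := ∫ z in Set.Ioo (-(r + 1)) (r + 1), ‖modalCoeff s n z‖ ^ 2
  have hG : 0 ≤ G := integral_nonneg fun _ => by positivity
  have h1 : (n : ℝ) ^ 2 * (8 / q ^ 2 * G) ≤ 8 * G := by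
    have h2 : (n : ℝ) ^ 2 / q ^ 2 ≤ 1 :=
      div_le_one_of_le₀ (pow_le_pow_left₀ (by positivity) hnq 2) (by positivity)
    calc (n : ℝ) ^ 2 * (8 / q ^ 2 * G) = (n : ℝ) ^ 2 / q ^ 2 * (8 * G) := by ring
      _ ≤ 1 * (8 * G) := mul_le_mul_of_nonneg_right h2 (by positivity)
      _ = 8 * G := one_mul _
  have h3 : Real.exp (-(2 * q)) * (∫ z, ‖modalCoeff s n z‖) ^ 2 ≤ Real.exp (-2 * n) * M ^ 2 := by
    refine mul_le_mul (Real.exp_le_exp.2 (by linarith))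
      (pow_le_pow_left₀ (integral_nonneg fun _ => norm_nonneg _)
        (integral_norm_modalCoeff_le hs1 n) 2) (by positivity) (by positivity)
  calc (C * n) ^ 2 * (8 / q ^ 2 * G +
        4 * r * Real.exp (-(2 * q)) * (∫ z, ‖modalCoeff s n z‖) ^ 2)
      = C ^ 2 * ((n : ℝ) ^ 2 * (8 / q ^ 2 * G)) + C ^ 2 * ((n : ℝ) ^ 2 * (4 * r) *
        (Real.exp (-(2 * q)) * (∫ z, ‖modalCoeff s n z‖) ^ 2)) := by ring
    _ ≤ C ^ 2 * (8 * G) + C ^ 2 * ((n : ℝ) ^ 2 * (4 * r) * (Real.exp (-2 * n) * M ^ 2)) := by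
        gcongr
    _ = _ := by ring

theorem norm_modalSolution_le {n : ℕ} {q : ℝ} (hn : 1 ≤ n) (hnq : (n : ℝ) ≤ q)
    (hκ : waveNumber k n = Complex.I * q) (x : ℝ) :
    n * ‖modalSolution k s n x‖ ≤
      ∫ z, ‖modalCoeff s n z‖ * Real.exp (-(q * |x - z|)) := by
  have hn1 : (1 : ℝ) ≤ n := by exact_mod_cast hn
  have hq : 0 < q := by linarith
  have h := norm_outgoingSol_le (g := modalCoeff s n) hκ hq x
  rw [modalSolution_eq]
  set J := ∫ z, ‖modalCoeff s n z‖ * Real.exp (-(q * |x - z|))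
  have hJ : 0 ≤ J := integral_nonneg fun _ => by positivity
  calc n * ‖outgoingSol (waveNumber k n) (modalCoeff s n) x‖ ≤ n * (1 / (2 * q) * J) := by gcongr
    _ = (n / q) * (1 / 2) * J := by ring
    _ ≤ 1 * 1 * J := by
        gcongr
        · exact div_le_one_of_le₀ hnq hq.le
        · norm_num
    _ = J := by ring

/-- `u_n'`. -/
noncomputable def modalSolutionDeriv (k : ℝ) (s : ℝ × ℝ → ℂ) (n : ℕ) : ℝ → ℂ :=
  outgoingSolDeriv (waveNumber k n) (modalCoeff s n)

theorem norm_modalSolutionDeriv_le {n : ℕ} {q : ℝ} (hκ : waveNumber k n = Complex.I * q) (x : ℝ) :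
    ‖modalSolutionDeriv k s n x‖ ≤
      ∫ z, ‖modalCoeff s n z‖ * Real.exp (-(q * |x - z|)) := by
  have h := norm_outgoingSolDeriv_le (g := modalCoeff s n) hκ x
  have hJ : 0 ≤ ∫ z, ‖modalCoeff s n z‖ * Real.exp (-(q * |x - z|)) :=
    integral_nonneg fun _ => by positivity
  rw [modalSolutionDeriv]
  linarith

/-- Multipliers of size n² on u_n are those of u_yy. The factor 1/(2q) in the kernel pays for one
power of n, and the L² estimate pays for the other; u_n' lacks that factor and tolerates only
multipliers of size n, those of u_xy. -/
theorem summable_modalSolution (hs1 : IntegrableOn s strip) (hs2 : MemL2Loc s) {a : ℕ → ℂ} {C : ℝ}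
    (ha : ∀ n : ℕ, 1 ≤ n → ‖a n‖ ≤ C * n ^ 2) {r : ℝ} (hr : 0 < r) :
    Summable fun n => ∫ x in Set.Ioo (-r) r, ‖a n * modalSolution k s n x‖ ^ 2 := by
  have hC : 0 ≤ C := by
    have := (norm_nonneg _).trans (ha 1 le_rfl)
    simpa using this
  refine summable_integral_norm_sq (k := k) (C := C) hs1 hs2 (fun n q hn hnq hκ x => ?_) hr
  rw [norm_mul]
  calc ‖a n‖ * ‖modalSolution k s n x‖ ≤ C * n ^ 2 * ‖modalSolution k s n x‖ := by
        gcongr; exact ha n hn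
    _ = C * n * (n * ‖modalSolution k s n x‖) := by ring
    _ ≤ _ := by
        gcongr
        exact norm_modalSolution_le hn hnq hκ x

theorem summable_modalSolutionDeriv (hs1 : IntegrableOn s strip) (hs2 : MemL2Loc s) {a : ℕ → ℂ}
    {C : ℝ} (ha : ∀ n : ℕ, 1 ≤ n → ‖a n‖ ≤ C * n) {r : ℝ} (hr : 0 < r) :
    Summable fun n => ∫ x in Set.Ioo (-r) r, ‖a n * modalSolutionDeriv k s n x‖ ^ 2 := by
  have hC : 0 ≤ C := by
    have := (norm_nonneg _).trans (ha 1 le_rfl)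
    simpa using this
  refine summable_integral_norm_sq (k := k) (C := C) hs1 hs2 (fun n q hn hnq hκ x => ?_) hr
  rw [norm_mul]
  exact mul_le_mul (ha n hn) (norm_modalSolutionDeriv_le hκ x) (norm_nonneg _) (by positivity)

end Summability

/-! ### Weak derivatives of separated products and of sums -/

section WeakDerivatives

theorem memLp_Ioo_of_continuous {c : ℝ → ℂ} (hc : Continuous c) (a b : ℝ) :
    MemLp c 2 (volume.restrict (Set.Ioo a b)) := by
  rw [memLp_two_iff_integrable_sq_norm hc.aestronglyMeasurable]
  exact integrableOn_Ioo_of_continuous (by fun_prop) a b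

/-- On each horizontal line the slice of ψ is a test function on ℝ, so the claim reduces to the
one-dimensional identity and Fubini. -/
theorem hasWeakDeriv_x_mul {c d : ℝ → ℂ} (h : HasWeakDeriv1 c d)
    (hc : ∀ r : ℝ, 0 < r → MemLp c 2 (volume.restrict (Set.Ioo (-r) r)))
    (hd : ∀ r : ℝ, 0 < r → MemLp d 2 (volume.restrict (Set.Ioo (-r) r)))
    {b : ℝ → ℝ} (hb : Continuous b) {C : ℝ} (hC : ∀ y, |b y| ≤ C) :
    HasWeakDeriv (1, 0) (fun p => c p.1 * (b p.2 : ℂ)) (fun p => d p.1 * (b p.2 : ℂ)) := by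
  have hcb := memL2Loc_mul hc hb hC
  have hdb := memL2Loc_mul hd hb hC
  refine ⟨hcb, hdb, fun ψ h1 h2 _ => ?_⟩
  have i1 := (fderiv_xTest h1 h2 (1, 0)).integrableOn_mul hcb
  have i2 := (XTest.of_hasCompactSupport h1.continuous h2).integrableOn_mul hdb
  rw [IntegrableOn, restrict_strip] at i1 i2
  rw [restrict_strip, integral_prod_symm _ i1, integral_prod_symm _ i2, ← integral_neg]
  refine integral_congr_ae (Eventually.of_forall fun y => ?_)
  have hχ : ContDiff ℝ ∞ fun x => ψ (x, y) := h1.comp (contDiff_id.prodMk contDiff_const)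
  have hχs : HasCompactSupport fun x => ψ (x, y) := by
    refine HasCompactSupport.intro (K := Prod.fst '' tsupport ψ)
      (h2.isCompact.image continuous_fst) fun x hx => ?_
    by_contra h
    exact hx ⟨(x, y), subset_tsupport ψ h, rfl⟩
  have hder : ∀ x, deriv (fun x => ψ (x, y)) x = fderiv ℝ ψ (x, y) (1, 0) := by
    intro x
    have h3 : HasDerivAt (fun x : ℝ => (x, y)) ((1 : ℝ), (0 : ℝ)) x :=
      (hasDerivAt_id x).prodMk (hasDerivAt_const x y)
    exact (((h1.differentiable (by simp)) (x, y)).hasFDerivAt.comp_hasDerivAt x h3).deriv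
  have h4 := h _ hχ hχs
  simp_rw [hder] at h4
  simp only
  simp_rw [← mul_assoc]
  rw [integral_mul_const, integral_mul_const, h4, neg_mul]

/-- Only the products ψ b must vanish at y = 0 and y = 1. This admits test functions supported in
the strip with any b, and arbitrary test functions when b is a sine mode; the latter gives the
Neumann condition. -/
theorem integral_by_parts_y {c : ℝ → ℂ}
    (hc : ∀ r : ℝ, 0 < r → MemLp c 2 (volume.restrict (Set.Ioo (-r) r)))
    {b b' : ℝ → ℝ} (hb : Continuous b) (hb' : Continuous b')
    {C : ℝ} (hC : ∀ y, |b y| ≤ C) {C' : ℝ} (hC' : ∀ y, |b' y| ≤ C')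
    (hbd : ∀ y, HasDerivAt b (b' y) y) {ψ : ℝ × ℝ → ℝ} (h1 : ContDiff ℝ ∞ ψ)
    (h2 : HasCompactSupport ψ) (h0 : ∀ x, ψ (x, 0) * b 0 = 0) (h1' : ∀ x, ψ (x, 1) * b 1 = 0) :
    (∫ p in strip, ((fderiv ℝ ψ p (0, 1) : ℝ) : ℂ) * (c p.1 * (b p.2 : ℂ))) +
      ∫ p in strip, (ψ p : ℂ) * (c p.1 * (b' p.2 : ℂ)) = 0 := by
  have hcb := memL2Loc_mul hc hb hC
  have hdb := memL2Loc_mul hc hb' hC'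
  have i1 := (fderiv_xTest h1 h2 (0, 1)).integrableOn_mul hcb
  have i2 := (XTest.of_hasCompactSupport h1.continuous h2).integrableOn_mul hdb
  rw [← integral_add i1 i2]
  have i3 := i1.add i2
  rw [IntegrableOn, restrict_strip] at i3
  rw [restrict_strip]
  refine (integral_prod _ i3).trans ?_
  refine integral_eq_zero_of_ae (Eventually.of_forall fun x => ?_)
  have hfc : Continuous fun p => fderiv ℝ ψ p (0, 1) :=
    (h1.continuous_fderiv (by simp)).clm_apply continuous_const
  have hψc := h1.continuous
  have hder : ∀ y, HasDerivAt (fun y => ψ (x, y) * b y)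
      (fderiv ℝ ψ (x, y) (0, 1) * b y + ψ (x, y) * b' y) y := by
    intro y
    have h3 : HasDerivAt (fun y : ℝ => (x, y)) ((0 : ℝ), (1 : ℝ)) y :=
      (hasDerivAt_const y x).prodMk (hasDerivAt_id y)
    exact (((h1.differentiable (by simp)) (x, y)).hasFDerivAt.comp_hasDerivAt y h3).mul (hbd y)
  have hcont : Continuous fun y => fderiv ℝ ψ (x, y) (0, 1) * b y + ψ (x, y) * b' y := by
    have := hfc.comp (Continuous.prodMk (continuous_const (y := x)) continuous_id)
    exact (this.mul hb).add (by fun_prop)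
  have h3 := intervalIntegral.integral_eq_sub_of_hasDerivAt (a := 0) (b := 1)
    (fun y _ => hder y) (hcont.intervalIntegrable _ _)
  rw [h0, h1', sub_zero, intervalIntegral.integral_of_le zero_le_one,
    integral_Ioc_eq_integral_Ioo] at h3
  have e : ∀ y, ((fderiv ℝ ψ (x, y) (0, 1) : ℝ) : ℂ) * (c x * (b y : ℂ)) +
      (ψ (x, y) : ℂ) * (c x * (b' y : ℂ)) =
      c x * ((fderiv ℝ ψ (x, y) (0, 1) * b y + ψ (x, y) * b' y : ℝ) : ℂ) := fun y => by
    push_cast; ring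
  simp only [Pi.zero_apply, Pi.add_apply]
  simp_rw [e]
  rw [integral_const_mul, integral_complex_ofReal, h3]
  simp

theorem hasWeakDeriv_y_mul {c : ℝ → ℂ}
    (hc : ∀ r : ℝ, 0 < r → MemLp c 2 (volume.restrict (Set.Ioo (-r) r)))
    {b b' : ℝ → ℝ} (hb : Continuous b) (hb' : Continuous b')
    {C : ℝ} (hC : ∀ y, |b y| ≤ C) {C' : ℝ} (hC' : ∀ y, |b' y| ≤ C')
    (hbd : ∀ y, HasDerivAt b (b' y) y) :
    HasWeakDeriv (0, 1) (fun p => c p.1 * (b p.2 : ℂ)) (fun p => c p.1 * (b' p.2 : ℂ)) := by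
  refine ⟨memL2Loc_mul hc hb hC, memL2Loc_mul hc hb' hC', fun ψ h1 h2 h3 => ?_⟩
  rw [eq_neg_iff_add_eq_zero]
  have h4 : ∀ x y : ℝ, y ∉ Set.Ioo (0 : ℝ) 1 → ψ (x, y) = 0 := fun x y hy =>
    image_eq_zero_of_notMem_tsupport fun h => hy (h3 h).2
  exact integral_by_parts_y hc hb hb' hC hC' hbd h1 h2
    (fun x => by rw [h4 x 0 (by simp), zero_mul]) (fun x => by rw [h4 x 1 (by simp), zero_mul])

theorem XTest.integral_sum_add_eq_zero {f g : ℝ × ℝ → ℂ} (hf : XTest f) (hg : XTest g)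
    {S T : ℕ → ℝ × ℝ → ℂ} (hS : ∀ n, MemL2Loc (S n)) (hT : ∀ n, MemL2Loc (T n))
    (h : ∀ n, (∫ p in strip, f p * S n p) + ∫ p in strip, g p * T n p = 0) (N : ℕ) :
    (∫ p in strip, f p * ∑ n ∈ Finset.range N, S n p) +
      ∫ p in strip, g p * ∑ n ∈ Finset.range N, T n p = 0 := by
  simp_rw [Finset.mul_sum]
  rw [integral_finsetSum _ fun n _ => hf.integrableOn_mul (hS n),
    integral_finsetSum _ fun n _ => hg.integrableOn_mul (hT n), ← Finset.sum_add_distrib]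
  exact Finset.sum_eq_zero fun n _ => h n

theorem HasWeakDeriv.sum_range {e : ℝ × ℝ} {S T : ℕ → ℝ × ℝ → ℂ}
    (h : ∀ n, HasWeakDeriv e (S n) (T n)) (N : ℕ) :
    HasWeakDeriv e (fun p => ∑ n ∈ Finset.range N, S n p)
      (fun p => ∑ n ∈ Finset.range N, T n p) := by
  refine ⟨MemL2Loc.sum _ fun n _ => (h n).1, MemL2Loc.sum _ fun n _ => (h n).2.1,
    fun ψ h1 h2 h3 => ?_⟩
  rw [eq_neg_iff_add_eq_zero]
  exact (fderiv_xTest h1 h2 e).integral_sum_add_eq_zero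
    (XTest.of_hasCompactSupport h1.continuous h2) (fun n => (h n).1) (fun n => (h n).2.1)
    (fun n => eq_neg_iff_add_eq_zero.1 ((h n).2.2 ψ h1 h2 h3)) N

end WeakDerivatives

/-! ### Modal expansions and pointwise convergence -/

section Expansion

theorem MemL2Loc.modalCoeff_sub {f g : ℝ × ℝ → ℂ} (hf : MemL2Loc f) (hg : MemL2Loc g) (n : ℕ) :
    ∀ᵐ x : ℝ, modalCoeff (fun p => f p - g p) n x = modalCoeff f n x - modalCoeff g n x := by
  filter_upwards [hf.prod_integrable, hg.prod_integrable] with x h1 h2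
  simp only [modalCoeff, mul_sub]
  exact integral_sub (integrableOn_ofReal_mul (contDiff_mode n).continuous h1)
    (integrableOn_ofReal_mul (contDiff_mode n).continuous h2)

/-- A function in `L²_loc(Ω)` is determined by its modal coefficients. -/
theorem MemL2Loc.ae_eq_of_modalCoeff {f g : ℝ × ℝ → ℂ} (hf : MemL2Loc f) (hg : MemL2Loc g)
    (h : ∀ n, ∀ᵐ x : ℝ, modalCoeff f n x = modalCoeff g n x) :
    ∀ᵐ p ∂(volume.restrict strip), f p = g p := by
  have h0 := (hf.sub hg).ae_eq_zero fun n => by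
    filter_upwards [h n, hf.modalCoeff_sub hg n] with x h1 h2
    rw [h2, h1, sub_self]
  filter_upwards [h0] with p hp
  exact sub_eq_zero.1 hp

/-- Functions in `L²_loc(Ω)` are the sums of their modal expansions. -/
theorem MemL2Loc.tendsto_modal_expansion {f : ℝ × ℝ → ℂ} (hf : MemL2Loc f) :
    TendstoL2Loc (fun N p => ∑ n ∈ Finset.range N, modalCoeff f n p.1 * (mode n p.2 : ℂ)) f := by
  obtain ⟨w, hw⟩ := exists_tendstoL2Loc_series (c := modalCoeff f) (b := mode)
    (fun n r hr => hf.memLp_modalCoeff n hr) (fun n => (contDiff_mode n).continuous)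
    (abs_mode_le) (fun m n hmn => by rw [integral_mode_mul_mode, if_neg hmn])
    (fun r hr => hf.summable_modalCoeff hr)
  -- Riesz–Fischer gives some limit; it has the coefficients of f, so completeness identifies it
  -- with f.
  refine hw.congr_lim (hw.memLim.ae_eq_of_modalCoeff hf fun n => ?_)
  refine hw.modalCoeff_ae_eq n (hf.locallyIntegrable_modalCoeff n) ?_
  filter_upwards [eventually_gt_atTop n] with N hN x
  exact modalCoeff_sum_mode _ hN x

theorem ae_summable_of_summable_integral {α : Type*} [MeasurableSpace α] {μ : Measure α}
    {f : ℕ → α → ℝ} (hf : ∀ n, Integrable (f n) μ) (hf0 : ∀ n a, 0 ≤ f n a)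
    (h : Summable fun n => ∫ a, f n a ∂μ) : ∀ᵐ a ∂μ, Summable fun n => f n a := by
  have hm : ∀ n, AEMeasurable (fun a => ENNReal.ofReal (f n a)) μ :=
    fun n => (hf n).aestronglyMeasurable.aemeasurable.ennreal_ofReal
  have h1 : ∫⁻ a, ∑' n, ENNReal.ofReal (f n a) ∂μ ≠ ⊤ := by
    rw [lintegral_tsum hm]
    have e : ∀ n, ∫⁻ a, ENNReal.ofReal (f n a) ∂μ = ENNReal.ofReal (∫ a, f n a ∂μ) := fun n =>
      (ofReal_integral_eq_lintegral_ofReal (hf n) (Eventually.of_forall (hf0 n))).symm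
    simp_rw [e]
    exact h.tsum_ofReal_ne_top
  filter_upwards [ae_lt_top' (AEMeasurable.tsum hm) h1] with a ha
  have h2 := ENNReal.summable_toReal ha.ne
  refine h2.congr fun n => ?_
  rw [ENNReal.toReal_ofReal (hf0 n a)]

/-- Write |a_n| = (n²|a_n|) · n⁻² and bound the product by the sum of the squares. -/
theorem summable_norm_of_summable_norm_sq {a : ℕ → ℂ}
    (h : Summable fun n : ℕ => ‖(n : ℂ) ^ 2 * a n‖ ^ 2) : Summable fun n => ‖a n‖ := by
  have h2 : Summable fun n : ℕ => 1 / (n : ℝ) ^ 4 := Real.summable_one_div_nat_pow.2 (by norm_num)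
  refine (h.add h2).of_norm_bounded_eventually_nat ?_
  filter_upwards [eventually_ge_atTop 1] with n hn
  have hn' : (1 : ℝ) ≤ n := by exact_mod_cast hn
  rw [norm_norm, norm_mul, norm_pow, Complex.norm_natCast]
  set A := ‖a n‖
  have e : A = ((n : ℝ) ^ 2 * A) * (1 / (n : ℝ) ^ 2) := by field_simp
  have e2 : 1 / (n : ℝ) ^ 4 = (1 / (n : ℝ) ^ 2) ^ 2 := by
    rw [div_pow, one_pow, ← pow_mul]
  rw [e2]
  have h3 : 0 ≤ A := norm_nonneg _
  nlinarith [sq_nonneg ((n : ℝ) ^ 2 * A - 1 / (n : ℝ) ^ 2), sq_nonneg ((n : ℝ) ^ 2 * A),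
    sq_nonneg (1 / (n : ℝ) ^ 2)]

theorem ae_strip_of_ae {P : ℝ → Prop} (h : ∀ᵐ x : ℝ, P x) :
    ∀ᵐ p ∂((volume : Measure (ℝ × ℝ)).restrict strip), P p.1 := by
  rw [restrict_strip]
  exact Measure.quasiMeasurePreserving_fst.ae h

/-- An `L²_loc` limit agrees with an almost everywhere pointwise limit. -/
theorem TendstoL2Loc.ae_eq_of_tendsto {S : ℕ → ℝ × ℝ → ℂ} {w v : ℝ × ℝ → ℂ}
    (hS : TendstoL2Loc S w)
    (h : ∀ᵐ p ∂(volume.restrict strip), Tendsto (fun N => S N p) atTop (𝓝 (v p))) :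
    ∀ᵐ p ∂(volume.restrict strip), w p = v p := by
  rw [ae_strip_iff]
  intro r hr
  have h1 : Tendsto (fun N => eLpNorm (S N - w) 2 (volume.restrict (truncStrip r)))
      atTop (𝓝 0) := by
    refine (hS.tendsto r hr).congr fun N => ?_
    rw [eLpNorm_sub_comm]
    rfl
  -- L² convergence gives almost everywhere convergence along a subsequence, whose limit must be the
  -- pointwise one.
  obtain ⟨ns, hns, hns2⟩ := (tendstoInMeasure_of_tendsto_eLpNorm (by norm_num)
    (fun N => (hS.mem N r hr).aestronglyMeasurable) (hS.memLim r hr).aestronglyMeasurable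
    h1).exists_seq_tendsto_ae
  filter_upwards [hns2, ae_strip_iff.1 h r hr] with p h1 h2
  exact tendsto_nhds_unique h1 (h2.comp hns.tendsto_atTop)

end Expansion

/-! ### Existence of the outgoing solution -/

section Existence

variable {k : ℝ} {s : ℝ × ℝ → ℂ}

theorem hasDerivAt_modalSolution (hk : 0 < k) (hkn : ∀ n : ℕ, k ≠ n * Real.pi)
    (hs : IntegrableOn s strip) (n : ℕ) (x : ℝ) :
    HasDerivAt (modalSolution k s n) (modalSolutionDeriv k s n x) x :=
  hasDerivAt_outgoingSol (waveNumber_ne_zero hk hkn n) (waveNumber_im_nonneg k n)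
    (integrable_modalCoeff hs n) x

theorem contDiff_modalSolution (hk : 0 < k) (hkn : ∀ n : ℕ, k ≠ n * Real.pi)
    (hs : IntegrableOn s strip) (n : ℕ) : ContDiff ℝ 1 (modalSolution k s n) :=
  contDiff_outgoingSol (waveNumber_ne_zero hk hkn n) (waveNumber_im_nonneg k n)
    (integrable_modalCoeff hs n)

theorem continuous_modalSolutionDeriv (hs : IntegrableOn s strip) (n : ℕ) :
    Continuous (modalSolutionDeriv k s n) :=
  continuous_outgoingSolDeriv (waveNumber_im_nonneg k n) (integrable_modalCoeff hs n)

theorem hasWeakDeriv1_modalSolutionDeriv (hk : 0 < k) (hkn : ∀ n : ℕ, k ≠ n * Real.pi)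
    (hs : IntegrableOn s strip) (n : ℕ) :
    HasWeakDeriv1 (modalSolutionDeriv k s n)
      (fun x => -waveNumber k n ^ 2 * modalSolution k s n x - modalCoeff s n x) :=
  hasWeakDeriv1_outgoingSolDeriv (waveNumber_ne_zero hk hkn n) (waveNumber_im_nonneg k n)
    (integrable_modalCoeff hs n)

/-- The partial sums of the modal series of the solution. -/
noncomputable def modalPartialSum (k : ℝ) (s : ℝ × ℝ → ℂ) (N : ℕ) (p : ℝ × ℝ) : ℂ :=
  ∑ n ∈ Finset.range N, modalSolution k s n p.1 * (mode n p.2 : ℂ)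

/-- The multipliers a n carry the powers of nπ produced by differentiation in y. An odd number of
y-derivatives yields sines instead, which have their own orthogonality. -/
theorem exists_tendstoL2Loc_mode {a : ℕ → ℂ} {c : ℕ → ℝ → ℂ} (hc : ∀ n, Continuous (c n))
    (hs : ∀ r : ℝ, 0 < r → Summable fun n => ∫ x in Set.Ioo (-r) r, ‖a n * c n x‖ ^ 2) :
    ∃ w, TendstoL2Loc (fun N p => ∑ n ∈ Finset.range N, a n * c n p.1 * (mode n p.2 : ℂ)) w :=
  exists_tendstoL2Loc_series (c := fun n x => a n * c n x) (b := mode)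
    (fun n _ _ => memLp_Ioo_of_continuous (continuous_const.mul (hc n)) _ _)
    (fun n => (contDiff_mode n).continuous) abs_mode_le
    (fun m n hmn => by rw [integral_mode_mul_mode, if_neg hmn]) hs

theorem exists_tendstoL2Loc_sinMode {a : ℕ → ℂ} {c : ℕ → ℝ → ℂ} (hc : ∀ n, Continuous (c n))
    (hs : ∀ r : ℝ, 0 < r → Summable fun n => ∫ x in Set.Ioo (-r) r, ‖a n * c n x‖ ^ 2) :
    ∃ w, TendstoL2Loc (fun N p => ∑ n ∈ Finset.range N, a n * c n p.1 * (sinMode n p.2 : ℂ)) w :=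
  exists_tendstoL2Loc_series (c := fun n x => a n * c n x) (b := sinMode)
    (fun n _ _ => memLp_Ioo_of_continuous (continuous_const.mul (hc n)) _ _)
    (fun n => (contDiff_sinMode n).continuous) abs_sinMode_le
    (fun _ _ hmn => integral_sinMode_mul_sinMode hmn) hs

theorem norm_natCast_mul_pi (n : ℕ) : ‖-((n : ℂ) * (Real.pi : ℂ))‖ = Real.pi * n := by
  rw [norm_neg, norm_mul, Complex.norm_natCast, Complex.norm_real,
    Real.norm_of_nonneg Real.pi_pos.le, mul_comm]

/-- Existence of an outgoing solution, as the sum of the modal series. -/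
theorem exists_isSolution (hk : 0 < k) (hkn : ∀ n : ℕ, k ≠ n * Real.pi)
    (hs1 : IntegrableOn s strip) (hs2 : MemL2Loc s) :
    ∃ u, IsSolution k s u ∧ TendstoL2Loc (modalPartialSum k s) u := by
  have hu1 := contDiff_modalSolution hk hkn hs1
  have huc : ∀ n, Continuous (modalSolution k s n) := fun n => (hu1 n).continuous
  have hvc := continuous_modalSolutionDeriv (k := k) hs1
  have hm := fun n => (contDiff_mode n).continuous
  have hsm := fun n => (contDiff_sinMode n).continuous
  set ν : ℕ → ℂ := fun n => -((n : ℂ) * (Real.pi : ℂ)) with hν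
  obtain ⟨u, hu⟩ := exists_tendstoL2Loc_mode (a := fun _ => 1) huc fun r hr =>
    summable_modalSolution (C := 1) hs1 hs2 (fun n hn => by
      have : (1 : ℝ) ≤ n := by exact_mod_cast hn
      rw [norm_one, one_mul]; exact one_le_pow₀ this) hr
  obtain ⟨ux, hux⟩ := exists_tendstoL2Loc_mode (a := fun _ => 1) hvc fun r hr =>
    summable_modalSolutionDeriv (C := 1) hs1 hs2 (fun n hn => by
      have : (1 : ℝ) ≤ n := by exact_mod_cast hn
      rw [norm_one, one_mul]; exact this) hr
  obtain ⟨uy, huy⟩ := exists_tendstoL2Loc_sinMode (a := ν) huc fun r hr =>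
    summable_modalSolution (C := Real.pi) hs1 hs2 (fun n hn => by
      have : (1 : ℝ) ≤ n := by exact_mod_cast hn
      rw [norm_natCast_mul_pi]
      exact mul_le_mul_of_nonneg_left (by nlinarith) Real.pi_pos.le) hr
  obtain ⟨uxy, huxy⟩ := exists_tendstoL2Loc_sinMode (a := ν) hvc fun r hr =>
    summable_modalSolutionDeriv (C := Real.pi) hs1 hs2 (fun n _ => by
      rw [norm_natCast_mul_pi]) hr
  obtain ⟨uyy, huyy⟩ := exists_tendstoL2Loc_mode (a := fun n => -(ν n) ^ 2) huc fun r hr =>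
    summable_modalSolution (C := Real.pi ^ 2) hs1 hs2 (fun n hn => by
      rw [norm_neg, norm_pow, norm_natCast_mul_pi, mul_pow]) hr
  have hs := hs2.tendsto_modal_expansion
  -- The second x-derivative is defined as -s - k²u - u_yy, so the Helmholtz equation holds by
  -- construction. What remains is that this is the weak derivative of u_x, which is the modal
  -- equation with k_n² = k² - n²π².
  have huxx := ((hs.const_mul (-1)).add (hu.const_mul (-(k : ℂ) ^ 2))).add
    (huyy.const_mul (-1))
  have hmemu : ∀ (a : ℂ) n (r : ℝ), 0 < r →
      MemLp (fun x => a * modalSolution k s n x) 2 (volume.restrict (Set.Ioo (-r) r)) :=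
    fun a n r _ => memLp_Ioo_of_continuous (continuous_const.mul (huc n)) _ _
  have hmemv : ∀ (a : ℂ) n (r : ℝ), 0 < r →
      MemLp (fun x => a * modalSolutionDeriv k s n x) 2 (volume.restrict (Set.Ioo (-r) r)) :=
    fun a n r _ => memLp_Ioo_of_continuous (continuous_const.mul (hvc n)) _ _
  have hwu : ∀ (a : ℂ) n, HasWeakDeriv1 (fun x => a * modalSolution k s n x)
      fun x => a * modalSolutionDeriv k s n x := fun a n =>
    hasWeakDeriv1_of_hasDerivAt (fun x => (hasDerivAt_modalSolution hk hkn hs1 n x).const_mul a)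
      (continuous_const.mul (hvc n))
  have dux : HasWeakDeriv (1, 0) u ux := HasWeakDeriv.of_tendsto hu hux fun N =>
    HasWeakDeriv.sum_range (fun n => hasWeakDeriv_x_mul (hwu 1 n) (hmemu 1 n) (hmemv 1 n) (hm n)
      (abs_mode_le n)) N
  have duyx : HasWeakDeriv (1, 0) uy uxy := HasWeakDeriv.of_tendsto huy huxy fun N =>
    HasWeakDeriv.sum_range (fun n => hasWeakDeriv_x_mul (hwu (ν n) n) (hmemu _ n) (hmemv _ n)
      (hsm n) (abs_sinMode_le n)) N
  have hb1 : ∀ n y, |-(n * Real.pi) * sinMode n y| ≤ n * Real.pi * Real.sqrt 2 := fun n y => by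
    rw [abs_mul, abs_neg, abs_of_nonneg (by positivity)]
    exact mul_le_mul_of_nonneg_left (abs_sinMode_le n y) (by positivity)
  have hb2 : ∀ n y, |n * Real.pi * mode n y| ≤ n * Real.pi * Real.sqrt 2 := fun n y => by
    rw [abs_mul, abs_of_nonneg (by positivity)]
    exact mul_le_mul_of_nonneg_left (abs_mode_le n y) (by positivity)
  have ey : ∀ n (z : ℂ) (y : ℝ), ν n * z * (sinMode n y : ℂ) =
      1 * z * ((-(n * Real.pi) * sinMode n y : ℝ) : ℂ) := fun n z y => by
    simp only [hν]
    push_cast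
    ring
  have duy : HasWeakDeriv (0, 1) u uy := HasWeakDeriv.of_tendsto hu huy fun N => by
    simp_rw [ey]
    exact HasWeakDeriv.sum_range (fun n => hasWeakDeriv_y_mul (hmemu 1 n) (hm n)
      (continuous_const.mul (hsm n)) (abs_mode_le n) (hb1 n) (hasDerivAt_mode n)) N
  have duxy : HasWeakDeriv (0, 1) ux uxy := HasWeakDeriv.of_tendsto hux huxy fun N => by
    simp_rw [ey]
    exact HasWeakDeriv.sum_range (fun n => hasWeakDeriv_y_mul (hmemv 1 n) (hm n)
      (continuous_const.mul (hsm n)) (abs_mode_le n) (hb1 n) (hasDerivAt_mode n)) N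
  have eyy : ∀ n (p : ℝ × ℝ), -(ν n) ^ 2 * modalSolution k s n p.1 * (mode n p.2 : ℂ) =
      ν n * modalSolution k s n p.1 * ((n * Real.pi * mode n p.2 : ℝ) : ℂ) := fun n p => by
    simp only [hν]
    push_cast
    ring
  have duyy : HasWeakDeriv (0, 1) uy uyy := HasWeakDeriv.of_tendsto huy huyy fun N => by
    simp_rw [eyy]
    exact HasWeakDeriv.sum_range (fun n => hasWeakDeriv_y_mul (hmemu (ν n) n) (hsm n)
      (continuous_const.mul (hm n)) (abs_sinMode_le n) (hb2 n) (hasDerivAt_sinMode n)) N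
  have hmemxx : ∀ n (r : ℝ), 0 < r →
      MemLp (fun x => -waveNumber k n ^ 2 * modalSolution k s n x - modalCoeff s n x) 2
        (volume.restrict (Set.Ioo (-r) r)) := fun n r hr =>
    (hmemu _ n r hr).sub (hs2.memLp_modalCoeff n hr)
  have duxx := HasWeakDeriv.of_tendsto (e := (1, 0)) hux huxx fun N => by
    have h := HasWeakDeriv.sum_range (fun n => hasWeakDeriv_x_mul
      (c := fun x => 1 * modalSolutionDeriv k s n x)
      (by simpa using hasWeakDeriv1_modalSolutionDeriv hk hkn hs1 n)
      (hmemv 1 n) (hmemxx n) (hm n) (abs_mode_le n)) N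
    convert h using 2 with p
    rw [Finset.mul_sum, Finset.mul_sum, Finset.mul_sum, ← Finset.sum_add_distrib,
      ← Finset.sum_add_distrib]
    refine Finset.sum_congr rfl fun n _ => ?_
    rw [waveNumber_sq]
    simp only [hν]
    ring
  have hU : TendstoL2Loc (modalPartialSum k s) u := by
    have e : modalPartialSum k s =
        fun N p => ∑ n ∈ Finset.range N, 1 * modalSolution k s n p.1 * (mode n p.2 : ℂ) := by
      ext N p
      simp [modalPartialSum]
    rw [e]
    exact hu
  refine ⟨u, ⟨⟨ux, uy, dux, duy, ⟨_, uxy, duxx, duxy⟩, ⟨uxy, uyy, duyx, duyy⟩⟩,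
    ⟨ux, uy, _, uyy, dux, duy, duxx, duyy, Eventually.of_forall fun p => by ring⟩,
    ⟨uy, duy, locallyIntegrable_zero, locallyIntegrable_zero, uyy, duyy, fun ψ h1 h2 => ?_⟩,
    fun n => ?_⟩, hU⟩
  · have h3 : ∀ N, (∫ p in strip, ((fderiv ℝ ψ p (0, 1) : ℝ) : ℂ) *
        ∑ n ∈ Finset.range N, ν n * modalSolution k s n p.1 * (sinMode n p.2 : ℂ)) +
        ∫ p in strip, (ψ p : ℂ) * ∑ n ∈ Finset.range N,
          -(ν n) ^ 2 * modalSolution k s n p.1 * (mode n p.2 : ℂ) = 0 := by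
      simp_rw [eyy]
      refine (fderiv_xTest h1 h2 (0, 1)).integral_sum_add_eq_zero
        (XTest.of_hasCompactSupport h1.continuous h2)
        (fun n => memL2Loc_mul (hmemu (ν n) n) (hsm n) (abs_sinMode_le n))
        (fun n => memL2Loc_mul (hmemu (ν n) n) (continuous_const.mul (hm n)) (hb2 n))
        fun n => ?_
      exact integral_by_parts_y (hmemu (ν n) n) (hsm n) (continuous_const.mul (hm n))
        (abs_sinMode_le n) (hb2 n) (hasDerivAt_sinMode n) h1 h2
        (fun x => by rw [sinMode_zero, mul_zero]) (fun x => by rw [sinMode_one, mul_zero])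
    rw [huy.integral_add_eq_zero huyy (fderiv_xTest h1 h2 (0, 1))
      (XTest.of_hasCompactSupport h1.continuous h2) h3]
    simp
  · refine ⟨modalSolution k s n, hu1 n, ?_, ?_⟩
    · refine hU.modalCoeff_ae_eq n (huc n).locallyIntegrable ?_
      filter_upwards [eventually_gt_atTop n] with N hN x
      exact modalCoeff_sum_mode _ hN x
    · have h := tendsto_radiation_outgoingSol (waveNumber_ne_zero hk hkn n)
        (waveNumber_im_nonneg k n) (integrable_modalCoeff hs1 n)
      refine h.congr fun x => ?_
      rw [(hasDerivAt_modalSolution hk hkn hs1 n x).deriv]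
      rfl

end Existence

/-- The modal series of the solution converges absolutely almost everywhere. -/
theorem ae_hasSum_of_tendstoL2Loc {k : ℝ} {s u : ℝ × ℝ → ℂ} (hk : 0 < k)
    (hkn : ∀ n : ℕ, k ≠ n * Real.pi) (hs1 : IntegrableOn s strip) (hs2 : MemL2Loc s)
    (hu : TendstoL2Loc (modalPartialSum k s) u) :
    ∀ᵐ p ∂(volume.restrict strip),
      HasSum (fun n : ℕ => modalSolution k s n p.1 * (mode n p.2 : ℂ)) (u p) := by
  have huc := fun n => (contDiff_modalSolution hk hkn hs1 n).continuous
  have h1 : ∀ᵐ x : ℝ, Summable fun n => ‖modalSolution k s n x‖ := by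
    rw [ae_real_iff]
    intro r hr
    -- The full n² gain is used here: it makes n² u_n(x) square summable for almost every x.
    have h2 := summable_modalSolution (k := k) (a := fun n => (n : ℂ) ^ 2) (C := 1) hs1 hs2
      (fun n _ => by simp) hr
    have h3 := ae_summable_of_summable_integral (fun n => integrableOn_Ioo_of_continuous
      (by have := huc n; fun_prop) _ _) (fun n x => by positivity) h2
    filter_upwards [h3] with x hx
    exact summable_norm_of_summable_norm_sq hx
  have h2 : ∀ᵐ p ∂(volume.restrict strip),
      Summable fun n : ℕ => modalSolution k s n p.1 * (mode n p.2 : ℂ) := by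
    filter_upwards [ae_strip_of_ae h1] with p hp
    refine (hp.mul_right (Real.sqrt 2)).of_norm_bounded fun n => ?_
    rw [norm_mul, Complex.norm_real]
    exact mul_le_mul_of_nonneg_left (abs_mode_le n _) (norm_nonneg _)
  have h3 := hu.ae_eq_of_tendsto (v := fun p =>
    ∑' n : ℕ, modalSolution k s n p.1 * (mode n p.2 : ℂ)) (by
      filter_upwards [h2] with p hp
      exact hp.hasSum.tendsto_sum_nat)
  filter_upwards [h2, h3] with p hp hp3
  rw [hp3]
  exact hp.hasSum

/-! ### Cut-offs and test functions reaching the boundary -/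

section Cutoff

theorem exists_bound_deriv_smoothTransition :
    ∃ C : ℝ, 0 ≤ C ∧ ∀ t, |deriv Real.smoothTransition t| ≤ C ∧
      (t < 0 ∨ 1 < t → deriv Real.smoothTransition t = 0) := by
  have hc : Continuous (deriv Real.smoothTransition) :=
    (Real.smoothTransition.contDiff (n := 1)).continuous_deriv le_rfl
  obtain ⟨C, hC⟩ := (isCompact_Icc (a := (0 : ℝ)) (b := 1)).exists_bound_of_continuousOn
    hc.continuousOn
  have h0 : ∀ t : ℝ, t < 0 ∨ 1 < t → deriv Real.smoothTransition t = 0 := by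
    rintro t (ht | ht)
    · have : Real.smoothTransition =ᶠ[𝓝 t] fun _ => 0 := by
        filter_upwards [Iio_mem_nhds ht] with s hs
        exact Real.smoothTransition.zero_of_nonpos (le_of_lt hs)
      rw [this.deriv_eq, deriv_const]
    · have : Real.smoothTransition =ᶠ[𝓝 t] fun _ => 1 := by
        filter_upwards [Ioi_mem_nhds ht] with s hs
        exact Real.smoothTransition.one_of_one_le (le_of_lt hs)
      rw [this.deriv_eq, deriv_const]
  have hC0 : 0 ≤ C := (norm_nonneg _).trans (hC 0 (by simp))
  refine ⟨C, hC0, fun t => ⟨?_, h0 t⟩⟩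
  by_cases ht : t ∈ Set.Icc (0 : ℝ) 1
  · exact hC t ht
  · rw [h0 t (by rw [Set.mem_Icc, not_and_or, not_le, not_le] at ht; exact ht), abs_zero]
    exact hC0

/-- Smooth cut-offs in `(0,1)` that exhaust the interval. -/
noncomputable def cutoff (j : ℕ) (y : ℝ) : ℝ :=
  Real.smoothTransition (j * y - 1) * Real.smoothTransition (j * (1 - y) - 1)

/-- The derivative of `cutoff`. -/
noncomputable def cutoffDeriv (j : ℕ) (y : ℝ) : ℝ :=
  deriv Real.smoothTransition (j * y - 1) * j * Real.smoothTransition (j * (1 - y) - 1) +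
    Real.smoothTransition (j * y - 1) * (deriv Real.smoothTransition (j * (1 - y) - 1) * (-j))

theorem contDiff_cutoff (j : ℕ) : ContDiff ℝ ∞ (cutoff j) := by
  have h := Real.smoothTransition.contDiff (n := ⊤)
  exact (h.comp ((contDiff_const.mul contDiff_id).sub contDiff_const)).mul
    (h.comp ((contDiff_const.mul (contDiff_const.sub contDiff_id)).sub contDiff_const))

theorem hasDerivAt_cutoff (j : ℕ) (y : ℝ) : HasDerivAt (cutoff j) (cutoffDeriv j y) y := by
  have h : ∀ t, HasDerivAt Real.smoothTransition (deriv Real.smoothTransition t) t := fun t =>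
    ((Real.smoothTransition.contDiff (n := 1)).differentiable (by simp) t).hasDerivAt
  have h1 : HasDerivAt (fun y : ℝ => j * y - 1) (j : ℝ) y := by
    simpa using ((hasDerivAt_id y).const_mul (j : ℝ)).sub_const 1
  have h2 : HasDerivAt (fun y : ℝ => j * (1 - y) - 1) (-(j : ℝ)) y := by
    simpa using (((hasDerivAt_id y).const_sub 1).const_mul (j : ℝ)).sub_const 1
  exact ((h _).comp y h1).mul ((h _).comp y h2)

theorem cutoff_eq_zero {j : ℕ} {y : ℝ} (h : (j : ℝ) * y ≤ 1 ∨ (j : ℝ) * (1 - y) ≤ 1) :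
    cutoff j y = 0 := by
  rcases h with h | h
  · rw [cutoff, Real.smoothTransition.zero_of_nonpos (by linarith), zero_mul]
  · rw [cutoff, mul_comm, Real.smoothTransition.zero_of_nonpos (by linarith), zero_mul]

theorem abs_cutoff_le_one (j : ℕ) (y : ℝ) : |cutoff j y| ≤ 1 := by
  rw [cutoff, abs_mul, abs_of_nonneg (Real.smoothTransition.nonneg _),
    abs_of_nonneg (Real.smoothTransition.nonneg _)]
  exact mul_le_one₀ (Real.smoothTransition.le_one _) (Real.smoothTransition.nonneg _)
    (Real.smoothTransition.le_one _)

theorem eventually_lt_natCast_mul {y : ℝ} (hy : 0 < y) (a : ℝ) : ∀ᶠ j : ℕ in atTop, a < j * y := by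
  filter_upwards [eventually_gt_atTop ⌈a / y⌉₊] with j hj
  exact (div_lt_iff₀ hy).1 (Nat.lt_of_ceil_lt hj)

theorem eventually_cutoff {y : ℝ} (hy : y ∈ Set.Ioo (0 : ℝ) 1) :
    ∀ᶠ j : ℕ in atTop, cutoff j y = 1 ∧ cutoffDeriv j y = 0 := by
  obtain ⟨C, _, hC⟩ := exists_bound_deriv_smoothTransition
  filter_upwards [eventually_lt_natCast_mul hy.1 2,
    eventually_lt_natCast_mul (sub_pos.2 hy.2) 2] with j h1 h2
  constructor
  · rw [cutoff, Real.smoothTransition.one_of_one_le (by linarith),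
      Real.smoothTransition.one_of_one_le (by linarith), one_mul]
  · rw [cutoffDeriv, (hC _).2 (Or.inr (by linarith)), (hC _).2 (Or.inr (by linarith))]
    ring

/-- The derivative is of size j but lives where the distance to an endpoint is at most 2/j, so
multiplying by the distance gives a bound uniform in j. -/
theorem exists_bound_cutoffDeriv : ∃ C : ℝ, 0 ≤ C ∧ ∀ (j : ℕ), ∀ y ∈ Set.Ioo (0 : ℝ) 1,
    |cutoffDeriv j y| * min y (1 - y) ≤ C := by
  obtain ⟨C, hC0, hC⟩ := exists_bound_deriv_smoothTransition
  have key : ∀ (j : ℕ) (t : ℝ), 0 < t → |deriv Real.smoothTransition (j * t - 1)| * (j * t) ≤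
      C * 2 := by
    intro j t ht
    by_cases h : j * t - 1 ≤ 1
    · exact mul_le_mul (hC _).1 (by linarith) (by positivity) hC0
    · rw [(hC _).2 (Or.inr (not_le.1 h)), abs_zero, zero_mul]
      positivity
  refine ⟨C * 2 + C * 2, by positivity, fun j y hy => ?_⟩
  have hy1 : 0 < 1 - y := sub_pos.2 hy.2
  have hm : 0 ≤ min y (1 - y) := le_min hy.1.le hy1.le
  have hs := fun t => Real.smoothTransition.nonneg t
  have hs1 := fun t => Real.smoothTransition.le_one t
  rw [cutoffDeriv]
  refine (mul_le_mul_of_nonneg_right (abs_add_le _ _) hm).trans ?_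
  rw [add_mul]
  refine add_le_add ((le_trans ?_ (key j y hy.1))) ((le_trans ?_ (key j (1 - y) hy1)))
  · rw [abs_mul, abs_mul, Nat.abs_cast, abs_of_nonneg (hs _)]
    calc _ ≤ |deriv Real.smoothTransition (j * y - 1)| * j * 1 * y := by
          gcongr
          · exact hs1 _
          · exact min_le_left _ _
      _ = _ := by ring
  · rw [abs_mul, abs_mul, abs_neg, Nat.abs_cast, abs_of_nonneg (hs _)]
    calc _ ≤ 1 * (|deriv Real.smoothTransition (j * (1 - y) - 1)| * j) * (1 - y) := by
          gcongr
          · exact hs1 _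
          · exact min_le_right _ _
      _ = _ := by ring

/-- The cut-off depends on y alone, so its derivative enters only through the normal component of e.
-/
theorem hasFDerivAt_mul_cutoff {ψ : ℝ × ℝ → ℝ} (h1 : ContDiff ℝ ∞ ψ) (j : ℕ) (p e : ℝ × ℝ) :
    fderiv ℝ (fun p => ψ p * cutoff j p.2) p e =
      fderiv ℝ ψ p e * cutoff j p.2 + e.2 * ψ p * cutoffDeriv j p.2 := by
  have h2 := ((h1.differentiable (by simp)) p).hasFDerivAt
  have h3 := (hasDerivAt_cutoff j p.2).comp_hasFDerivAt p (hasFDerivAt_snd (p := p) (𝕜 := ℝ))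
  have h4 := h2.mul h3
  have h5 : fderiv ℝ (fun p => ψ p * cutoff j p.2) p = _ := h4.fderiv
  rw [h5]
  simp
  ring

/-- Integration by parts against test functions that do not vanish near `∂Ω`, provided the
component of `e` normal to `∂Ω` times the test function vanishes linearly on `∂Ω`. -/
theorem HasWeakDeriv.integral_by_parts {e : ℝ × ℝ} {u v : ℝ × ℝ → ℂ} (h : HasWeakDeriv e u v)
    {ψ : ℝ × ℝ → ℝ} (h1 : ContDiff ℝ ∞ ψ) (h2 : HasCompactSupport ψ) {η : ℝ × ℝ → ℂ}
    (hη : XTest η) (hb : ∀ p ∈ strip, |e.2 * ψ p| ≤ ‖η p‖ * min p.2 (1 - p.2)) :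
    ∫ p in strip, ((fderiv ℝ ψ p e : ℝ) : ℂ) * u p = -∫ p in strip, (ψ p : ℂ) * v p := by
  obtain ⟨C, hC0, hC⟩ := exists_bound_cutoffDeriv
  have hψ := XTest.of_hasCompactSupport h1.continuous h2
  have hψd := fderiv_xTest h1 h2 e
  have hcd : ∀ j, Continuous (cutoffDeriv j) := fun j => by
    have : cutoffDeriv j = deriv (cutoff j) := funext fun y => (hasDerivAt_cutoff j y).deriv.symm
    rw [this]
    exact (contDiff_cutoff j).continuous_deriv (by simp)
  have hcc := fun j => (contDiff_cutoff j).continuous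
  -- The product of ψ with the cut-off is supported where y and 1 - y are at least 1/j, so it is
  -- admissible in the definition of the weak derivative.
  have key : ∀ j : ℕ, 1 ≤ j →
      ∫ p in strip, ((fderiv ℝ ψ p e * cutoff j p.2 + e.2 * ψ p * cutoffDeriv j p.2 : ℝ) : ℂ) *
        u p = -∫ p in strip, ((ψ p * cutoff j p.2 : ℝ) : ℂ) * v p := by
    intro j hj
    have hj' : (0 : ℝ) < j := by exact_mod_cast hj
    have h3 := h.2.2 (fun p => ψ p * cutoff j p.2)
      (h1.mul ((contDiff_cutoff j).comp contDiff_snd)) h2.mul_right ?_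
    · simp_rw [hasFDerivAt_mul_cutoff h1] at h3
      exact h3
    · have hcl : IsClosed ({p : ℝ × ℝ | 1 ≤ (j : ℝ) * p.2} ∩
          {p : ℝ × ℝ | 1 ≤ (j : ℝ) * (1 - p.2)}) :=
        (isClosed_le (by fun_prop) (by fun_prop)).inter
          (isClosed_le (by fun_prop) (by fun_prop))
      refine (closure_minimal (fun p hp => ?_) hcl).trans fun p hp => ⟨trivial, ?_, ?_⟩
      · by_contra hn
        rw [Set.mem_inter_iff, Set.mem_ofPred_eq, Set.mem_ofPred_eq, not_and_or, not_le,
          not_le] at hn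
        refine hp ?_
        simp only
        rw [cutoff_eq_zero (hn.imp le_of_lt le_of_lt), mul_zero]
      · by_contra hn
        have := mul_nonpos_of_nonneg_of_nonpos hj'.le (not_lt.1 hn)
        have hp1 : 1 ≤ (j : ℝ) * p.2 := hp.1
        linarith
      · by_contra hn
        have := mul_nonpos_of_nonneg_of_nonpos hj'.le (sub_nonpos.2 (not_lt.1 hn))
        have hp2 : 1 ≤ (j : ℝ) * (1 - p.2) := hp.2
        linarith
  have hstrip : ∀ᵐ p ∂(volume.restrict strip), p ∈ strip := ae_restrict_mem measurableSet_strip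
  have hfc : Continuous fun p => fderiv ℝ ψ p e :=
    (h1.continuous_fderiv (by simp)).clm_apply continuous_const
  have hψc := h1.continuous
  have t1 : Tendsto (fun j : ℕ => ∫ p in strip,
      ((fderiv ℝ ψ p e * cutoff j p.2 + e.2 * ψ p * cutoffDeriv j p.2 : ℝ) : ℂ) * u p) atTop
      (𝓝 (∫ p in strip, ((fderiv ℝ ψ p e : ℝ) : ℂ) * u p)) := by
    -- The growing derivative of the cut-off is compensated by the linear vanishing `hb`, so C ‖η u‖
    -- is an integrable majorant. At each interior point the cut-off is eventually 1 with zero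
    -- derivative.
    refine tendsto_integral_of_dominated_convergence
      (fun p => ‖((fderiv ℝ ψ p e : ℝ) : ℂ) * u p‖ + C * ‖η p * u p‖)
      (fun j => ?_) ((hψd.integrableOn_mul h.1).norm.add
        ((hη.integrableOn_mul h.1).norm.const_mul C)) (fun j => ?_) ?_
    · have := hcc j
      have := hcd j
      exact (by fun_prop : Continuous fun p : ℝ × ℝ =>
        ((fderiv ℝ ψ p e * cutoff j p.2 + e.2 * ψ p * cutoffDeriv j p.2 : ℝ) : ℂ)
        ).aestronglyMeasurable.mul h.1.aestronglyMeasurable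
    · filter_upwards [hstrip] with p hp
      rw [norm_mul, norm_mul, norm_mul, Complex.norm_real, Complex.norm_real, ← mul_assoc,
        ← add_mul]
      refine mul_le_mul_of_nonneg_right ((norm_add_le _ _).trans (add_le_add ?_ ?_))
        (norm_nonneg _)
      · rw [norm_mul]
        exact mul_le_of_le_one_right (norm_nonneg _) (abs_cutoff_le_one j p.2)
      · rw [norm_mul, Real.norm_eq_abs, Real.norm_eq_abs]
        calc |e.2 * ψ p| * |cutoffDeriv j p.2|
            ≤ (‖η p‖ * min p.2 (1 - p.2)) * |cutoffDeriv j p.2| :=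
              mul_le_mul_of_nonneg_right (hb p hp) (abs_nonneg _)
          _ = (|cutoffDeriv j p.2| * min p.2 (1 - p.2)) * ‖η p‖ := by ring
          _ ≤ C * ‖η p‖ := mul_le_mul_of_nonneg_right (hC j p.2 hp.2) (norm_nonneg _)
    · filter_upwards [hstrip] with p hp
      refine tendsto_const_nhds.congr' ?_
      filter_upwards [eventually_cutoff hp.2] with j hj
      rw [hj.1, hj.2, mul_one, mul_zero, add_zero]
  have t2 : Tendsto (fun j : ℕ => ∫ p in strip, ((ψ p * cutoff j p.2 : ℝ) : ℂ) * v p) atTop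
      (𝓝 (∫ p in strip, (ψ p : ℂ) * v p)) := by
    refine tendsto_integral_of_dominated_convergence (fun p => ‖(ψ p : ℂ) * v p‖)
      (fun j => ?_) (hψ.integrableOn_mul h.2.1).norm (fun j => ?_) ?_
    · have := hcc j
      exact (by fun_prop : Continuous fun p : ℝ × ℝ =>
        ((ψ p * cutoff j p.2 : ℝ) : ℂ)).aestronglyMeasurable.mul h.2.1.aestronglyMeasurable
    · refine Eventually.of_forall fun p => ?_
      rw [norm_mul, norm_mul, Complex.norm_real, Complex.norm_real, norm_mul]
      exact mul_le_mul_of_nonneg_right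
        (mul_le_of_le_one_right (norm_nonneg _) (abs_cutoff_le_one j p.2)) (norm_nonneg _)
    · filter_upwards [hstrip] with p hp
      refine tendsto_const_nhds.congr' ?_
      filter_upwards [eventually_cutoff hp.2] with j hj
      rw [hj.1, mul_one]
  refine tendsto_nhds_unique t1 (t2.neg.congr' ?_)
  filter_upwards [eventually_ge_atTop 1] with j hj
  exact (key j hj).symm

/-- Products `χ(x) b(y)` extend from the strip to test functions on the plane. -/
theorem exists_product_test {χ b b' : ℝ → ℝ} (hχ : ContDiff ℝ ∞ χ) (hs : HasCompactSupport χ)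
    (hb : ContDiff ℝ ∞ b) (hbd : ∀ y, HasDerivAt b (b' y) y) :
    ∃ ψ : ℝ × ℝ → ℝ, ContDiff ℝ ∞ ψ ∧ HasCompactSupport ψ ∧ ∀ p ∈ strip,
      ψ p = χ p.1 * b p.2 ∧ fderiv ℝ ψ p (1, 0) = deriv χ p.1 * b p.2 ∧
        fderiv ℝ ψ p (0, 1) = χ p.1 * b' p.2 := by
  -- This bump equals 1 on [-2,2], a neighbourhood of [0,1], so multiplying by it changes neither
  -- the function nor its derivatives on the strip.
  let ζ : ContDiffBump (0 : ℝ) := ⟨2, 3, by norm_num, by norm_num⟩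
  have hζ : ∀ p ∈ strip, ∀ᶠ q : ℝ × ℝ in 𝓝 p, χ q.1 * (b q.2 * ζ q.2) = χ q.1 * b q.2 := by
    intro p hp
    filter_upwards [isOpen_strip.mem_nhds hp] with q hq
    have : ζ q.2 = 1 := ζ.one_of_mem_closedBall (by
      rw [Metric.mem_closedBall, dist_zero_right, Real.norm_eq_abs, abs_of_pos hq.2.1]
      exact hq.2.2.le.trans one_le_two)
    rw [this, mul_one]
  refine ⟨fun p => χ p.1 * (b p.2 * ζ p.2), ?_, ?_, fun p hp => ⟨(hζ p hp).self_of_nhds, ?_, ?_⟩⟩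
  · exact (hχ.comp contDiff_fst).mul ((hb.comp contDiff_snd).mul (ζ.contDiff.comp contDiff_snd))
  · refine HasCompactSupport.intro (hs.isCompact.prod ζ.hasCompactSupport.isCompact)
      fun p hp => ?_
    rw [Set.mem_prod, not_and_or] at hp
    rcases hp with hp | hp
    · rw [image_eq_zero_of_notMem_tsupport hp, zero_mul]
    · rw [image_eq_zero_of_notMem_tsupport hp, mul_zero, mul_zero]
  all_goals
    have h1 := ((hχ.differentiable (by simp)) p.1).hasDerivAt.comp_hasFDerivAt p
      (hasFDerivAt_fst (p := p) (𝕜 := ℝ))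
    have h2 := (hbd p.2).comp_hasFDerivAt p (hasFDerivAt_snd (p := p) (𝕜 := ℝ))
    have h3 := (h1.mul h2).congr_of_eventuallyEq (hζ p hp)
    rw [h3.fderiv]
    simp
    try ring

end Cutoff

/-! ### The weak modal equation of a solution -/

section ModalEquation

/-- The sine mode vanishes at both ends and has slope at most nπ√2. This linear vanishing is what
removal of the cut-off requires for y-derivatives. -/
theorem abs_sinMode_le_min (n : ℕ) {y : ℝ} (hy : y ∈ Set.Ioo (0 : ℝ) 1) :
    |sinMode n y| ≤ n * Real.pi * Real.sqrt 2 * min y (1 - y) := by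
  have key : ∀ a b : ℝ, |sinMode n b - sinMode n a| ≤ n * Real.pi * Real.sqrt 2 * |b - a| := by
    intro a b
    refine convex_univ.norm_image_sub_le_of_norm_hasDerivWithin_le
      (fun x _ => (hasDerivAt_sinMode n x).hasDerivWithinAt) (fun x _ => ?_)
      (Set.mem_univ a) (Set.mem_univ b)
    rw [Real.norm_eq_abs, abs_mul, abs_of_nonneg (by positivity)]
    exact mul_le_mul_of_nonneg_left (abs_mode_le n x) (by positivity)
  rcases min_choice y (1 - y) with h | h
  · have := key 0 y
    rw [sinMode_zero, sub_zero, sub_zero, abs_of_pos hy.1] at this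
    rwa [h]
  · have := key 1 y
    rw [sinMode_one, sub_zero, abs_sub_comm, abs_of_pos (sub_pos.2 hy.2)] at this
    rwa [h]

variable {χ : ℝ → ℝ}

theorem setIntegral_strip_congr {f g : ℝ × ℝ → ℂ} (h : ∀ p ∈ strip, f p = g p) :
    ∫ p in strip, f p = ∫ p in strip, g p :=
  setIntegral_congr_fun measurableSet_strip h

/-- The direction is tangential to ∂Ω, so cosine tests, which do not vanish there, are allowed
without any boundary condition. -/
theorem HasWeakDeriv.integral_x_mode {u v : ℝ × ℝ → ℂ} (h : HasWeakDeriv (1, 0) u v)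
    (hχ : ContDiff ℝ ∞ χ) (hs : HasCompactSupport χ) (n : ℕ) :
    ∫ x, ((deriv χ x : ℝ) : ℂ) * modalCoeff u n x = -∫ x, (χ x : ℂ) * modalCoeff v n x := by
  obtain ⟨ψ, h1, h2, h3⟩ := exists_product_test hχ hs (contDiff_mode n) (hasDerivAt_mode n)
  have h4 := h.integral_by_parts h1 h2 (XTest.of_hasCompactSupport h1.continuous h2)
    (fun p hp => by
      rw [zero_mul, abs_zero]
      exact mul_nonneg (norm_nonneg _) (le_min hp.2.1.le (sub_nonneg.2 hp.2.2.le)))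
  rw [← integral_strip_mode_mul (hχ.continuous_deriv (by simp)) hs.deriv n h.1,
    ← integral_strip_mode_mul hχ.continuous hs n h.2.1]
  rw [setIntegral_strip_congr fun p hp => by rw [(h3 p hp).2.1, Complex.ofReal_mul],
    setIntegral_strip_congr (f := fun p => (ψ p : ℂ) * v p) fun p hp => by
      rw [(h3 p hp).1, Complex.ofReal_mul]] at h4
  exact h4

theorem HasWeakDeriv.integral_y_mode {u uy : ℝ × ℝ → ℂ} (h : HasWeakDeriv (0, 1) u uy)
    (hχ : ContDiff ℝ ∞ χ) (hs : HasCompactSupport χ) (n : ℕ) :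
    ∫ p in strip, ((χ p.1 : ℂ) * (sinMode n p.2 : ℂ)) * uy p =
      -((n * Real.pi : ℝ) : ℂ) * ∫ x, (χ x : ℂ) * modalCoeff u n x := by
  obtain ⟨ψ, h1, h2, h3⟩ := exists_product_test hχ hs (contDiff_sinMode n) (hasDerivAt_sinMode n)
  have h4 := h.integral_by_parts h1 h2 (modal_test_xTest hχ.continuous hs
    (continuous_const (y := n * Real.pi * Real.sqrt 2)) ⟨_, fun _ => le_rfl⟩) (fun p hp => by
      rw [one_mul, (h3 p hp).1, abs_mul, norm_mul, Complex.norm_real, Complex.norm_real, mul_assoc]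
      refine mul_le_mul_of_nonneg_left ?_ (abs_nonneg _)
      rw [Real.norm_of_nonneg (by positivity)]
      exact abs_sinMode_le_min n hp.2)
  rw [setIntegral_strip_congr (g := fun p => ((n * Real.pi : ℝ) : ℂ) *
      (((χ p.1 : ℂ) * (mode n p.2 : ℂ)) * u p)) fun p hp => by
        rw [(h3 p hp).2.2]; push_cast; ring,
    setIntegral_strip_congr (f := fun p => (ψ p : ℂ) * uy p) fun p hp => by
      rw [(h3 p hp).1, Complex.ofReal_mul], integral_const_mul,
    integral_strip_mode_mul hχ.continuous hs n h.1] at h4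
  rw [neg_mul, h4, neg_neg]

/-- The modal coefficients of a solution satisfy `v_n'' + k_n² v_n = -s_n` weakly. -/
theorem IsSolution.modal_equation {k : ℝ} {s v : ℝ × ℝ → ℂ} (hv : IsSolution k s v)
    (hs2 : MemL2Loc s) (hχ : ContDiff ℝ ∞ χ) (hs : HasCompactSupport χ) (n : ℕ) :
    ∫ x, ((deriv (deriv χ) x : ℝ) : ℂ) * modalCoeff v n x =
      -waveNumber k n ^ 2 * (∫ x, (χ x : ℂ) * modalCoeff v n x) -
        ∫ x, (χ x : ℂ) * modalCoeff s n x := by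
  obtain ⟨ux, uy, uxx, uyy, dx, dy, dxx, dyy, heq⟩ := hv.helmholtz
  obtain ⟨uy', dy', _, _, wy, dwy, htr⟩ := hv.neumann
  have hd : ContDiff ℝ ∞ (deriv χ) := contDiff_infty_iff_deriv.1 hχ |>.2
  -- The equation and the Neumann condition each supply their own derivatives; uniqueness of weak
  -- derivatives identifies them.
  have hwy : ∀ᵐ p ∂(volume.restrict strip), wy p = uyy p :=
    dwy.ae_eq dyy (dy'.ae_eq dy (Eventually.of_forall fun _ => rfl))
  have ex := dx.integral_x_mode hd hs.deriv n
  have exx := dxx.integral_x_mode hχ hs n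
  have ey := dy'.integral_y_mode hχ hs n
  -- The boundary condition enters here: the cosine test does not vanish on ∂Ω, and the zero traces
  -- cancel the boundary terms. The second integration by parts, `ey`, has a sine test and needs no
  -- boundary condition.
  have eyy : ∫ x, (χ x : ℂ) * modalCoeff uyy n x =
      ((n * Real.pi : ℝ) : ℂ) * ∫ p in strip, ((χ p.1 : ℂ) * (sinMode n p.2 : ℂ)) * uy' p := by
    obtain ⟨ψ, h1, h2, h3⟩ := exists_product_test hχ hs (contDiff_mode n) (hasDerivAt_mode n)
    have h4 := htr ψ h1 h2
    rw [setIntegral_strip_congr (g := fun p => -((n * Real.pi : ℝ) : ℂ) *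
        (((χ p.1 : ℂ) * (sinMode n p.2 : ℂ)) * uy' p)) fun p hp => by
          rw [(h3 p hp).2.2]; push_cast; ring,
      setIntegral_strip_congr (f := fun p => (ψ p : ℂ) * wy p) fun p hp => by
        rw [(h3 p hp).1, Complex.ofReal_mul], integral_const_mul] at h4
    have h5 : ∫ p in strip, ((χ p.1 : ℂ) * (mode n p.2 : ℂ)) * wy p =
        ∫ p in strip, ((χ p.1 : ℂ) * (mode n p.2 : ℂ)) * uyy p := by
      refine integral_congr_ae ?_
      filter_upwards [hwy] with p hp
      rw [hp]
    rw [h5, integral_strip_mode_mul hχ.continuous hs n dyy.2.1] at h4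
    simp only [Pi.zero_apply, mul_zero, integral_zero, sub_zero] at h4
    linear_combination h4
  have ht := modal_test_xTest hχ.continuous hs (contDiff_mode n).continuous ⟨_, abs_mode_le n⟩
  have hsum : (∫ p in strip, ((χ p.1 : ℂ) * (mode n p.2 : ℂ)) * uxx p) +
      (∫ p in strip, ((χ p.1 : ℂ) * (mode n p.2 : ℂ)) * uyy p) +
      (k : ℂ) ^ 2 * (∫ p in strip, ((χ p.1 : ℂ) * (mode n p.2 : ℂ)) * v p) =
      -∫ p in strip, ((χ p.1 : ℂ) * (mode n p.2 : ℂ)) * s p := by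
    have i1 := ht.integrableOn_mul dxx.2.1
    have i2 := ht.integrableOn_mul dyy.2.1
    have i3 := (ht.integrableOn_mul dx.1).const_mul ((k : ℂ) ^ 2)
    rw [← integral_const_mul, ← integral_add i1 i2, ← integral_neg]
    refine (integral_add (i1.add i2) i3).symm.trans (integral_congr_ae ?_)
    filter_upwards [heq] with p hp
    simp only [Pi.add_apply]
    linear_combination ((χ p.1 : ℂ) * (mode n p.2 : ℂ)) * hp
  rw [integral_strip_mode_mul hχ.continuous hs n dxx.2.1,
    integral_strip_mode_mul hχ.continuous hs n dyy.2.1,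
    integral_strip_mode_mul hχ.continuous hs n dx.1,
    integral_strip_mode_mul hχ.continuous hs n hs2] at hsum
  rw [waveNumber_sq, ex, exx]
  rw [eyy, ey] at hsum
  push_cast at hsum
  linear_combination hsum

end ModalEquation

/-! ### The homogeneous equation on the line -/

section ODE

/-- A test function with vanishing integral is the derivative of a test function. -/
theorem exists_test_primitive {η : ℝ → ℝ} (hη : ContDiff ℝ ∞ η) (hs : HasCompactSupport η)
    (h0 : ∫ x, η x = 0) :
    ∃ χ : ℝ → ℝ, ContDiff ℝ ∞ χ ∧ HasCompactSupport χ ∧ deriv χ = η := by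
  obtain ⟨R, hR⟩ := hs.isCompact.isBounded.subset_closedBall 0
  have hi : Integrable η := hη.continuous.integrable_of_hasCompactSupport hs
  have hz : ∀ x, R < |x| → η x = 0 := by
    intro x hx
    by_contra h
    have h2 := hR (subset_tsupport η h)
    rw [Metric.mem_closedBall, dist_zero_right, Real.norm_eq_abs] at h2
    linarith
  have hd : ∀ x, HasDerivAt (fun x => ∫ t in Set.Iic x, η t) (η x) x := by
    intro x
    have h1 := intervalIntegral.integral_hasDerivAt_right (a := 0) (b := x)
      (hη.continuous.intervalIntegrable _ _)
      hη.continuous.stronglyMeasurable.stronglyMeasurableAtFilter hη.continuous.continuousAt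
    have h2 : (fun x => ∫ t in Set.Iic x, η t) =
        fun x => (∫ t in (0 : ℝ)..x, η t) + ∫ t in Set.Iic 0, η t := by
      ext y
      rw [← intervalIntegral.integral_Iic_sub_Iic hi.integrableOn hi.integrableOn, sub_add_cancel]
    rw [h2]
    exact h1.add_const _
  have hder : deriv (fun x => ∫ t in Set.Iic x, η t) = η := funext fun x => (hd x).deriv
  refine ⟨fun x => ∫ t in Set.Iic x, η t, ?_, ?_, hder⟩
  · rw [contDiff_infty_iff_deriv, hder]
    exact ⟨fun x => (hd x).differentiableAt, hη⟩
  · refine HasCompactSupport.intro (isCompact_Icc (a := -R) (b := R)) fun x hx => ?_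
    rw [Set.mem_Icc, not_and_or, not_le, not_le] at hx
    rcases hx with hx | hx
    · refine setIntegral_eq_zero_of_forall_eq_zero fun t ht => hz t ?_
      have ht' : t ≤ x := ht
      exact lt_of_lt_of_le (by linarith) (neg_le_abs t)
    -- Beyond the support of η the primitive equals the total integral, which is zero; hence it has
    -- compact support.
    · rw [← h0]
      refine setIntegral_eq_integral_of_forall_compl_eq_zero fun t ht => hz t ?_
      exact (hx.trans (not_le.1 ht)).trans_le (le_abs_self t)

/-- The lemma of du Bois-Reymond for continuous functions. -/
theorem eq_const_of_integral_deriv_test {G : ℝ → ℂ} (hG : Continuous G)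
    (h : ∀ χ : ℝ → ℝ, ContDiff ℝ ∞ χ → HasCompactSupport χ →
      ∫ x, ((deriv χ x : ℝ) : ℂ) * G x = 0) : ∃ C : ℂ, ∀ x, G x = C := by
  let ζ : ContDiffBump (0 : ℝ) := ⟨1, 2, by norm_num, by norm_num⟩
  have hζ : ContDiff ℝ ∞ (ζ.normed volume) := ζ.contDiff_normed
  have hζs : HasCompactSupport (ζ.normed volume) := ζ.hasCompactSupport_normed
  have hint : ∀ χ : ℝ → ℝ, ContDiff ℝ ∞ χ → HasCompactSupport χ → Integrable χ :=
    fun χ h1 h2 => h1.continuous.integrable_of_hasCompactSupport h2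
  set C := ∫ x, ((ζ.normed volume x : ℝ) : ℂ) * G x
  refine ⟨C, fun x => ?_⟩
  have hae : ∀ᵐ x : ℝ, G x = (fun _ => C) x := by
    refine ae_eq_of_integral_test_mul hG.locallyIntegrable
      (continuous_const.locallyIntegrable) fun ψ h1 h2 => ?_
    set a := ∫ x, ψ x
    -- Subtracting the mean times a bump of unit mass leaves a test of zero integral, hence a
    -- derivative. The constant is the average of G against that bump.
    obtain ⟨χ, hχ, hχs, hχd⟩ := exists_test_primitive (η := fun x => ψ x - a * ζ.normed volume x)
      (h1.sub (contDiff_const.mul hζ)) (h2.sub hζs.mul_left) (by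
        rw [integral_sub (hint ψ h1 h2) ((hint _ hζ hζs).const_mul a), integral_const_mul,
          ζ.integral_normed, mul_one, sub_self])
    have h3 := h χ hχ hχs
    rw [hχd] at h3
    have e : ∀ x, ((ψ x - a * ζ.normed volume x : ℝ) : ℂ) * G x =
        (ψ x : ℂ) * G x - (a : ℂ) * (((ζ.normed volume x : ℝ) : ℂ) * G x) := fun x => by
      push_cast; ring
    simp_rw [e] at h3
    rw [integral_sub
      (integrable_ofReal_mul_of_locallyIntegrable h1.continuous h2 hG.locallyIntegrable)
      ((integrable_ofReal_mul_of_locallyIntegrable hζ.continuous hζs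
        hG.locallyIntegrable).const_mul _), integral_const_mul, sub_eq_zero] at h3
    rw [h3, integral_mul_const, integral_complex_ofReal]
  exact congrFun ((hG.ae_eq_iff_eq volume continuous_const).1 hae) x

/-- A `C¹` function with `h'' = -κ² h` weakly satisfies this equation classically. -/
theorem hasDerivAt_of_weak_ode {h h' : ℝ → ℂ} {κ : ℂ} (hd : ∀ x, HasDerivAt h (h' x) x)
    (hc' : Continuous h')
    (hw : ∀ χ : ℝ → ℝ, ContDiff ℝ ∞ χ → HasCompactSupport χ →
      ∫ x, ((deriv (deriv χ) x : ℝ) : ℂ) * h x = -κ ^ 2 * ∫ x, (χ x : ℂ) * h x) (x : ℝ) :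
    HasDerivAt h' (-κ ^ 2 * h x) x := by
  have hc : Continuous h := continuous_iff_continuousAt.2 fun x => (hd x).continuousAt
  have hH : ∀ x, HasDerivAt (fun x => ∫ t in (0 : ℝ)..x, h t) (h x) x := fun x =>
    intervalIntegral.integral_hasDerivAt_right (hc.intervalIntegrable _ _)
      hc.stronglyMeasurable.stronglyMeasurableAtFilter hc.continuousAt
  set H := fun x => ∫ t in (0 : ℝ)..x, h t
  have hHc : Continuous H := continuous_iff_continuousAt.2 fun x => (hH x).continuousAt
  -- With H a primitive of h, the weak equation says that h' + κ²H is orthogonal to derivatives of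
  -- tests, hence constant. So h' is differentiable.
  obtain ⟨C, hC⟩ := eq_const_of_integral_deriv_test (G := fun x => h' x + κ ^ 2 * H x)
    (hc'.add (continuous_const.mul hHc)) fun χ h1 h2 => by
      have hdχ : ContDiff ℝ ∞ (deriv χ) := contDiff_infty_iff_deriv.1 h1 |>.2
      have e1 := hasWeakDeriv1_of_hasDerivAt hd hc' (deriv χ) hdχ h2.deriv
      have e2 := hasWeakDeriv1_of_hasDerivAt hH hc χ h1 h2
      have e : ∀ x, ((deriv χ x : ℝ) : ℂ) * (h' x + κ ^ 2 * H x) =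
          ((deriv χ x : ℝ) : ℂ) * h' x + κ ^ 2 * (((deriv χ x : ℝ) : ℂ) * H x) :=
        fun x => by ring
      simp_rw [e]
      rw [integral_add (integrable_ofReal_mul_of_locallyIntegrable hdχ.continuous h2.deriv
          hc'.locallyIntegrable)
        ((integrable_ofReal_mul_of_locallyIntegrable hdχ.continuous h2.deriv
          hHc.locallyIntegrable).const_mul _), integral_const_mul, e2]
      linear_combination e1 - hw χ h1 h2
  have e : h' = fun x => C - κ ^ 2 * H x := funext fun x => by rw [← hC x]; ring
  rw [e]
  exact (((hH x).const_mul (κ ^ 2)).const_sub C).congr_deriv (by ring)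

theorem eq_exp_of_hasDerivAt {p : ℝ → ℂ} {a : ℂ} (hp : ∀ x, HasDerivAt p (a * p x) x) (x : ℝ) :
    p x = p 0 * Complex.exp (a * x) := by
  have h1 : ∀ x : ℝ, HasDerivAt (fun x : ℝ => p x * Complex.exp (-a * x)) 0 x := by
    intro x
    have h2 : HasDerivAt (fun x : ℝ => -a * (x : ℂ)) (-a) x := by
      simpa using (Complex.ofRealCLM.hasDerivAt (x := x)).const_mul (-a)
    exact ((hp x).mul h2.cexp).congr_deriv (by ring)
  have h3 := is_const_of_deriv_eq_zero (fun x => (h1 x).differentiableAt)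
    (fun x => (h1 x).deriv) x 0
  simp only [Complex.ofReal_zero, mul_zero, Complex.exp_zero, mul_one] at h3
  rw [← h3, mul_assoc, ← Complex.exp_add]
  simp

/-- The homogeneous equation has no nonzero outgoing solution. -/
theorem eq_zero_of_outgoing {h h' : ℝ → ℂ} {κ : ℂ} (hκ0 : κ ≠ 0) (hκ : 0 ≤ κ.im)
    (hd : ∀ x, HasDerivAt h (h' x) x) (hd' : ∀ x, HasDerivAt h' (-κ ^ 2 * h x) x)
    (hr : Tendsto (fun x => h' x - Complex.I * κ * h x) atTop (𝓝 0))
    (hl : Tendsto (fun x => -h' x - Complex.I * κ * h x) atBot (𝓝 0)) (x : ℝ) : h x = 0 := by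
  -- The second-order operator factors: these two combinations satisfy first-order equations with
  -- coefficients -iκ and +iκ.
  have hp : ∀ x, HasDerivAt (fun x => h' x - Complex.I * κ * h x)
      (-(Complex.I * κ) * (h' x - Complex.I * κ * h x)) x := fun x =>
    ((hd' x).sub ((hd x).const_mul _)).congr_deriv (by
      linear_combination -κ ^ 2 * h x * Complex.I_sq)
  have hm : ∀ x, HasDerivAt (fun x => -h' x - Complex.I * κ * h x)
      (Complex.I * κ * (-h' x - Complex.I * κ * h x)) x := fun x =>
    ((hd' x).neg.sub ((hd x).const_mul _)).congr_deriv (by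
      linear_combination κ ^ 2 * h x * Complex.I_sq)
  set p := fun x => h' x - Complex.I * κ * h x
  set m := fun x => -h' x - Complex.I * κ * h x
  have ep : ∀ x : ℝ, p x = p 0 * Complex.exp (-(Complex.I * κ) * x) := eq_exp_of_hasDerivAt hp
  have em : ∀ x : ℝ, m x = m 0 * Complex.exp (Complex.I * κ * x) := eq_exp_of_hasDerivAt hm
  -- As Im κ ≥ 0, |p(x)| = |p(0)| exp(Im κ · x) ≥ |p(0)| for x ≥ 0, while p tends to zero at +∞. The
  -- mirror argument at -∞ handles m.
  have hp0 : p 0 = 0 := by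
    rw [← norm_le_zero_iff]
    refine ge_of_tendsto (tendsto_zero_iff_norm_tendsto_zero.1 hr) ?_
    filter_upwards [eventually_ge_atTop 0] with x hx
    change ‖p 0‖ ≤ ‖p x‖
    rw [ep x, norm_mul, Complex.norm_exp]
    refine le_mul_of_one_le_right (norm_nonneg _) (Real.one_le_exp ?_)
    simp only [Complex.mul_re, Complex.neg_re, Complex.neg_im, Complex.mul_im, Complex.I_re,
      Complex.I_im, Complex.ofReal_re, Complex.ofReal_im]
    nlinarith
  have hm0 : m 0 = 0 := by
    rw [← norm_le_zero_iff]
    refine ge_of_tendsto (tendsto_zero_iff_norm_tendsto_zero.1 hl) ?_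
    filter_upwards [eventually_le_atBot 0] with x hx
    change ‖m 0‖ ≤ ‖m x‖
    rw [em x, norm_mul, Complex.norm_exp]
    refine le_mul_of_one_le_right (norm_nonneg _) (Real.one_le_exp ?_)
    simp only [Complex.mul_re, Complex.mul_im, Complex.I_re,
      Complex.I_im, Complex.ofReal_re, Complex.ofReal_im]
    nlinarith
  have h1 : p x = 0 := by rw [ep x, hp0, zero_mul]
  have h2 : m x = 0 := by rw [em x, hm0, zero_mul]
  have h3 : Complex.I * κ * h x = 0 := by
    have h4 : p x + m x = -2 * (Complex.I * κ * h x) := by simp only [p, m]; ring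
    rw [h1, h2] at h4
    linear_combination (1 / 2 : ℂ) * h4
  exact (mul_eq_zero.1 h3).resolve_left (mul_ne_zero Complex.I_ne_zero hκ0)

end ODE

/-! ### Uniqueness and conclusion -/

/-- The modal coefficients of an outgoing solution are given by the outgoing kernel. -/
theorem IsSolution.modalCoeff_ae_eq {k : ℝ} {s v : ℝ × ℝ → ℂ} (hv : IsSolution k s v)
    (hk : 0 < k) (hkn : ∀ n : ℕ, k ≠ n * Real.pi) (hs1 : IntegrableOn s strip)
    (hs2 : MemL2Loc s) (n : ℕ) : ∀ᵐ x : ℝ, modalCoeff v n x = modalSolution k s n x := by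
  obtain ⟨c, hc1, hcv, hcr⟩ := hv.outgoing n
  have hcd : ∀ x, HasDerivAt c (deriv c x) x := fun x =>
    (hc1.differentiable (by simp) x).hasDerivAt
  have hcd' : Continuous (deriv c) := hc1.continuous_deriv le_rfl
  have hu := hasDerivAt_modalSolution hk hkn hs1 n
  have huc := (contDiff_modalSolution hk hkn hs1 n).continuous
  have hu' := continuous_modalSolutionDeriv (k := k) hs1 n
  have hur := tendsto_radiation_outgoingSol (waveNumber_ne_zero hk hkn n)
    (waveNumber_im_nonneg k n) (integrable_modalCoeff hs1 n)
  rw [tendsto_radiation_iff] at hcr hur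
  -- The source cancels in the difference with the kernel solution, and the radiation condition is
  -- linear, so this is an outgoing homogeneous solution.
  have hd : ∀ x, HasDerivAt (fun x => c x - modalSolution k s n x)
      (deriv c x - modalSolutionDeriv k s n x) x := fun x => (hcd x).sub (hu x)
  have hzero := eq_zero_of_outgoing (waveNumber_ne_zero hk hkn n) (waveNumber_im_nonneg k n) hd
    (hasDerivAt_of_weak_ode hd (hcd'.sub hu') fun χ hχ hs => ?_) ?_ ?_
  · filter_upwards [hcv] with x hx
    rw [hx]
    exact sub_eq_zero.1 (hzero x)
  · have hdχ : ContDiff ℝ ∞ (deriv χ) := contDiff_infty_iff_deriv.1 hχ |>.2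
    have hddχ : Continuous (deriv (deriv χ)) := hdχ.continuous_deriv (by simp)
    have e1 := hv.modal_equation hs2 hχ hs n
    have e2 := hasWeakDeriv1_of_hasDerivAt hu hu' (deriv χ) hdχ hs.deriv
    have e3 := hasWeakDeriv1_modalSolutionDeriv hk hkn hs1 n χ hχ hs
    have ec : ∀ a : ℝ → ℝ, ∫ x, (a x : ℂ) * modalCoeff v n x = ∫ x, (a x : ℂ) * c x := fun a => by
      refine integral_congr_ae ?_
      filter_upwards [hcv] with x hx
      rw [hx]
    rw [ec, ec] at e1
    have iu := integrable_ofReal_mul_of_locallyIntegrable hχ.continuous hs huc.locallyIntegrable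
    have ic := integrable_ofReal_mul_of_locallyIntegrable hχ.continuous hs
      hc1.continuous.locallyIntegrable
    have is' := integrable_ofReal_mul_of_locallyIntegrable hχ.continuous hs
      (hs2.locallyIntegrable_modalCoeff n)
    have e4 : ∀ x, (χ x : ℂ) * (-waveNumber k n ^ 2 * modalSolution k s n x - modalCoeff s n x) =
        -waveNumber k n ^ 2 * ((χ x : ℂ) * modalSolution k s n x) -
          (χ x : ℂ) * modalCoeff s n x := fun x => by ring
    simp_rw [e4] at e3
    rw [integral_sub (iu.const_mul _) is', integral_const_mul] at e3
    simp_rw [mul_sub]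
    rw [integral_sub (integrable_ofReal_mul_of_locallyIntegrable hddχ hs.deriv.deriv
        hc1.continuous.locallyIntegrable)
      (integrable_ofReal_mul_of_locallyIntegrable hddχ hs.deriv.deriv huc.locallyIntegrable),
      integral_sub ic iu, e1, e2, e3]
    ring
  · have h := hcr.1.sub hur.1
    rw [sub_zero] at h
    refine h.congr fun x => ?_
    rw [modalSolution_eq, modalSolutionDeriv]
    ring
  · have h := hcr.2.sub hur.2
    rw [sub_zero] at h
    refine h.congr fun x => ?_
    rw [modalSolution_eq, modalSolutionDeriv]
    ring

theorem IsSolution.memL2Loc {k : ℝ} {s v : ℝ × ℝ → ℂ} (hv : IsSolution k s v) : MemL2Loc v := by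
  obtain ⟨_, _, h, _⟩ := hv.memH2Loc
  exact h.1

end Waveguide

theorem mainTheorem8 (k : ℝ) (hk : 0 < k) (hkn : ∀ n : ℕ, k ≠ n * Real.pi)
    (s : ℝ × ℝ → ℂ) (hs1 : IntegrableOn s Waveguide.strip volume)
    (hs2 : Waveguide.MemL2Loc s) :
    ∃ u : ℝ × ℝ → ℂ,
      Waveguide.IsSolution k s u ∧
      (∀ v : ℝ × ℝ → ℂ, Waveguide.IsSolution k s v →
        ∀ᵐ p ∂(volume.restrict Waveguide.strip), v p = u p) ∧
      (∀ (n : ℕ) (x : ℝ), Integrable (fun z : ℝ => Waveguide.modalCoeff s n z *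
        Complex.exp (Complex.I * Waveguide.waveNumber k n * (|x - z| : ℝ)))) ∧
      (∀ n : ℕ, ∀ᵐ x : ℝ, Waveguide.modalCoeff u n x = Waveguide.modalSolution k s n x) ∧
      (∀ᵐ p ∂(volume.restrict Waveguide.strip),
        HasSum (fun n : ℕ => Waveguide.modalSolution k s n p.1 * (Waveguide.mode n p.2 : ℂ))
          (u p)) ∧
      (∀ r : ℝ, 0 < r →
        Tendsto (fun N : ℕ => eLpNorm (fun p : ℝ × ℝ => u p - ∑ n ∈ Finset.range N,
            Waveguide.modalSolution k s n p.1 * (Waveguide.mode n p.2 : ℂ)) 2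
            (volume.restrict (Waveguide.truncStrip r))) atTop (𝓝 0)) := by
  obtain ⟨u, hu, hlim⟩ := Waveguide.exists_isSolution hk hkn hs1 hs2
  have hcoeff := fun n => hu.modalCoeff_ae_eq hk hkn hs1 hs2 n
  refine ⟨u, hu, fun v hv => hv.memL2Loc.ae_eq_of_modalCoeff hu.memL2Loc fun n => ?_,
    fun n x => Waveguide.integrable_mul_waveKernel (Waveguide.waveNumber_im_nonneg k n)
      (Waveguide.integrable_modalCoeff hs1 n) x,
    hcoeff, Waveguide.ae_hasSum_of_tendstoL2Loc hk hkn hs1 hs2 hlim, hlim.tendsto⟩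
  -- Any two solutions have the same kernel coefficients, and these determine a function in L²_loc.
  filter_upwards [hv.modalCoeff_ae_eq hk hkn hs1 hs2 n, hcoeff n] with x h1 h2
  rw [h1, h2]
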